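/- **Theorem.** Let $\frac12<\alpha\le 1$, $s>\frac12$ and $a<2\alpha-1$. For $r\in\mathbb R$ write $\|f\|_{H^r}=\|(1+\xi^2)^{r/2}\widehat f(\xi)\|_{L^2_\xi(\mathbb R)}$, and let $e^{it(-\Delta)^\alpha}$ be the Fourier multiplier with symbol $e^{it|\xi|^{2\alpha}}$. Consider the fractional cubic Schrödinger equation on the real line, with either sign, $$ i u_t+(-\Delta)^\alpha u=\pm|u|^2u,\qquad x\in\mathbb R,\ t\in\mathbb R,\qquad u(\cdot,0)=u_0\in H^s(\mathbb R). $$ A solution on an interval $I\ni 0$ is a function $u\in C^0(I;H^s(\mathbb R))$ such that, for all $t\in I$, $$u(t)=e^{it(-\Delta)^\alpha}u_0\mp i\int_0^t e^{i(t-t')(-\Delta)^\alpha}\big(|u(t')|^2u(t')\big)\,dt'.$$ It is maximal if it does not extend to a solution on a larger interval. For $t<0$ the integrals $\int_0^t$ in the bounds below are understood as $\int_t^0$. Let $u$ be a solution on an interval $I\ni0$ (for instance the maximal interval of existence). 1. $u(t)-e^{it(-\Delta)^\alpha}u_0\in C^0_t(I;H^{s+a}(\mathbb R))$. 2. For every $s_0$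 with $\frac12<s_0\le s$ there is a constant $C=C(\alpha,s,a,s_0)$ such that for all $t\in I$ $$\|u(t)-e^{it(-\Delta)^\alpha}u_0\|_{H^{s+a}}\le C\Big[\|u_0\|_{H^s}\big(1+\|u_0\|_{H^{s_0}}^2\big)+\|u(t)\|_{H^s}\|u(t)\|_{H^{s_0}}^2+\int_0^t\|u(t')\|_{H^s}\big(\|u(t')\|_{H^{s_0}}^2+\|u(t')\|_{H^{s_0}}^4\big)dt'\Big].$$ 3. If moreover $s\ge\alpha$, then every maximal solution is global ($I=\mathbb R$), and for every $R$ there is a constant $C=C(\alpha,s,a,R)$ such that, whenever $\|u_0\|_{H^\alpha}\le R$, for all $t\in I$ $$\|u(t)-e^{it(-\Delta)^\alpha}u_0\|_{H^{s+a}}\le C\Big[\|u_0\|_{H^s}+\|u(t)\|_{H^s}+\int_0^t\|u(t')\|_{H^s}\,dt'\Big].$$ -/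

import Mathlib

namespace FractionalNLS

open MeasureTheory Filter Topology FourierTransform

noncomputable section

/-- The space `L²(ℝ; ℂ)`. -/
abbrev L2 : Type := Lp ℂ 2 (volume : Measure ℝ)

/-- The `H^r(ℝ)` norm `‖⟨ξ⟩^r f̂‖_{L²}` of `f ∈ L²`, as an extended nonnegative real. The Fourier
transform is `f̂(ξ) = ∫ f(x) e^{-2πixξ} dx`, so the frequency variable is `2πξ`. -/
def sobolevENorm (r : ℝ) (f : L2) : ENNReal :=
  eLpNorm (fun ξ : ℝ => (((1 + (2 * Real.pi * ξ) ^ 2) ^ (r / 2) : ℝ) : ℂ) * (𝓕 f : L2) ξ) 2 volume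

/-- `f ∈ H^r(ℝ)`, for `f ∈ L²`. -/
def MemH (r : ℝ) (f : L2) : Prop := sobolevENorm r f < ⊤

/-- The `H^r(ℝ)` norm as a real number; meaningful for `f` with `MemH r f`. -/
def sobolevNorm (r : ℝ) (f : L2) : ℝ := (sobolevENorm r f).toReal

/-- `w ∈ C⁰(I; H^r(ℝ))`. -/
def ContinuousInH (r : ℝ) (I : Set ℝ) (w : ℝ → L2) : Prop :=
  (∀ t ∈ I, MemH r (w t)) ∧
    ∀ t₀ ∈ I, Tendsto (fun t => sobolevNorm r (w t - w t₀)) (𝓝[I] t₀) (𝓝 0)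

/-- The Fourier symbol `e^{it|2πξ|^{2α}}` of `e^{it(-Δ)^α}`. -/
def propagatorSymbol (α t ξ : ℝ) : ℂ :=
  Complex.exp (Complex.I * ((t * |2 * Real.pi * ξ| ^ (2 * α) : ℝ) : ℂ))

theorem norm_propagatorSymbol (α t ξ : ℝ) : ‖propagatorSymbol α t ξ‖ = 1 := by
  rw [propagatorSymbol, mul_comm, Complex.norm_exp_ofReal_mul_I]

theorem measurable_propagatorSymbol (α t : ℝ) : Measurable (propagatorSymbol α t) := by
  unfold propagatorSymbol
  fun_prop

theorem memLp_propagatorSymbol_mul (α t : ℝ) (g : L2) :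
    MemLp (fun ξ => propagatorSymbol α t ξ * g ξ) 2 volume :=
  (Lp.memLp g).of_le
    ((measurable_propagatorSymbol α t).aestronglyMeasurable.mul (Lp.memLp g).1)
    (Eventually.of_forall fun ξ => by simp [norm_propagatorSymbol])

/-- The linear propagator `e^{it(-Δ)^α}` on `L²(ℝ)`. -/
def propagator (α t : ℝ) (f : L2) : L2 :=
  𝓕⁻ ((memLp_propagatorSymbol_mul α t (𝓕 f)).toLp _ : L2)

open Classical in
/-- The cubic nonlinearity `|f|²f` as an element of `L²(ℝ)`. It is in `L²` exactly when
`f ∈ L⁶`, in particular for every `f ∈ H^s(ℝ)` with `s > 1/2`, as such an `f` is bounded. -/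
def cubic (f : L2) : L2 :=
  if h : MemLp (fun x => ((‖f x‖ ^ 2 : ℝ) : ℂ) * f x) 2 (volume : Measure ℝ) then h.toLp _ else 0

/-- `u ∈ C⁰(I; H^s(ℝ))` is a solution on the interval `I ∋ 0` of
`i u_t + (-Δ)^α u = σ |u|² u`, `u(0) = u₀ ∈ H^s(ℝ)`, in the usual sense of Duhamel's formula
`u(t) = e^{it(-Δ)^α} u₀ - iσ ∫₀ᵗ e^{i(t-t')(-Δ)^α} |u(t')|²u(t') dt'`.
The values of `u` outside `I` play no role. -/
structure IsSolution (σ α s : ℝ) (u₀ : L2) (I : Set ℝ) (u : ℝ → L2) : Prop where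
  ordConnected : I.OrdConnected
  zero_mem : (0 : ℝ) ∈ I
  data_mem : MemH s u₀
  continuous : ContinuousInH s I u
  duhamel : ∀ t ∈ I, u t = propagator α t u₀ -
    (Complex.I * (σ : ℂ)) • ∫ t' in (0 : ℝ)..t, propagator α (t - t') (cubic (u t'))

/-- A solution that has no extension, as an `H^s` solution, to a larger interval: its interval is
the maximal interval of existence. -/
structure IsMaximalSolution (σ α s : ℝ) (u₀ : L2) (I : Set ℝ) (u : ℝ → L2) : Prop where
  isSolution : IsSolution σ α s u₀ I u
  maximal : ∀ (J : Set ℝ) (v : ℝ → L2), IsSolution σ α s u₀ J v → I ⊆ J →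
    (∀ t ∈ I, v t = u t) → J = I

end

end FractionalNLS

namespace FractionalNLS

open MeasureTheory Filter Topology FourierTransform
open scoped ENNReal

noncomputable section

/-! ### Trilinear convolution estimates for nonnegative functions -/

/-! Pass to the profile `V = ⟨ξ⟩^s e^{-itω} û`, where `ω = |2πξ|^{2α}`. In this variable the
equation is an ordinary differential equation in `L²`, `V' = -iσ T(V, V, V)`. The trilinear kernel
of `T` is `e^{-itΦ}` times Sobolev weights, and `Φ` is the resonance function of the interaction of
`ξ₁`, `ξ₂` and `ξ₃ = ξ - ξ₁ + ξ₂` with output `ξ` (`propagator_cubic_state`, `IsSolution.isFlow`).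
For `s > 1/2` the algebra property of `H^s` makes `T` bounded on `L²` (`exists_algebra_estimate`).

The gain of regularity comes from a normal form, that is, differentiation by parts in time, based on
the identity `e^{-itΦ} = e^{-itΦ} / (1 + iΦ) - d/dt [e^{-itΦ} / (1 + iΦ)]`. It turns `V(t) - V(0)`
into cubic boundary terms, the time integral of a cubic term, and the time integral of a quintic
term in which one factor is `V'` (`IsFlow.normal_form`). Each of them carries the factor `(1 +
iΦ)⁻¹`. Dividing by `1 + iΦ` instead of `iΦ` removes any need to treat the resonant set separately.

The factor `(1 + iΦ)⁻¹` gains derivatives because `Φ` is a second difference of a strictly convex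
function, so that `|Φ|` is at least a constant times `|ξ - ξ₁| |ξ₁ - ξ₂| (|ξ| + |ξ - ξ₁| + |ξ₁ -
ξ₂|)^{2α-2}` (`le_abs_phase`). For `|ξ| ≥ 1` there are three regimes. If both differences are at
least `|ξ|/4`, then `|Φ|` controls `|ξ|^{2α-1}`. If exactly one is small, a power `θ = a/(2α-1) < 1`
of `|Φ|` is spent, which leaves a locally integrable kernel such as `|ξ - ξ₁|^{-θ}`, to be handled
by Young's inequality. If both are small, all frequencies are comparable, the two lower norms supply
the missing powers of `|ξ|`, and Cauchy-Schwarz in `(ξ₁, ξ₂)` concludes. The outcome is the tame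
estimate `exists_smoothing_estimate`, with one factor in `H^s` and two in `H^{s₀}`, from which
`exists_norm_smoothPart_le` and the first two claims follow.

For `s ≥ α`, mass and energy are conserved (`IsFlow.mass_eq`, `IsFlow.energy_eq`); this is proved
directly at the regularity `H^α`, without approximation by smooth solutions. The potential energy is
absorbed by the kinetic energy at the price of a large multiple of the mass, which bounds the `H^α`
norm for both signs (`exists_norm_flow_le`). With `s₀ = α` the bound of the second claim then
becomes that of the third. Moreover the nonlinearity is then at most linear in the `H^s` norm, which
therefore grows at most exponentially. A solution thus reaches any finite endpoint of its interval
and, by Picard-Lindelöf, continues beyond it (`IsMaximalSolution.not_endpoint`). -/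

/-- The square of the `L²` norm of a nonnegative function. -/
def normSq (f : ℝ → ℝ≥0∞) : ℝ≥0∞ := ∫⁻ x, f x ^ 2

/-- The positive trilinear form `∫ M(ξ, ξ₁, ξ₂) f(ξ₁) g(ξ₂) h(ξ - ξ₁ + ξ₂) dξ₁ dξ₂`. -/
def posTri (M : ℝ → ℝ → ℝ → ℝ≥0∞) (f g h : ℝ → ℝ≥0∞) (ξ : ℝ) : ℝ≥0∞ :=
  ∫⁻ p : ℝ × ℝ, M ξ p.1 p.2 * (f p.1 * g p.2 * h (ξ - p.1 + p.2))

theorem sq_lintegral_mul_le {X : Type*} [MeasurableSpace X] (μ : Measure X) {f g : X → ℝ≥0∞}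
    (hf : Measurable f) (hg : Measurable g) :
    (∫⁻ x, f x * g x ∂μ) ^ 2 ≤ (∫⁻ x, f x ^ 2 ∂μ) * ∫⁻ x, g x ^ 2 ∂μ := by
  have h := ENNReal.lintegral_mul_le_Lp_mul_Lq μ Real.HolderConjugate.two_two
    hf.aemeasurable hg.aemeasurable
  simp only [Pi.mul_apply, ENNReal.rpow_ofNat] at h
  calc _ ≤ ((∫⁻ x, f x ^ 2 ∂μ) ^ ((1 : ℝ) / 2) * (∫⁻ x, g x ^ 2 ∂μ) ^ ((1 : ℝ) / 2)) ^ 2 := by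
        gcongr
    _ = _ := by
        rw [mul_pow, ← ENNReal.rpow_natCast, ← ENNReal.rpow_natCast, ← ENNReal.rpow_mul,
          ← ENNReal.rpow_mul]
        norm_num

/-- Cauchy-Schwarz for `1` and `g` with respect to the measure `K μ`. -/
theorem sq_lintegral_mul_le_weighted {X : Type*} [MeasurableSpace X] (μ : Measure X)
    {K g : X → ℝ≥0∞} (hK : Measurable K) (hg : Measurable g) :
    (∫⁻ x, K x * g x ∂μ) ^ 2 ≤ (∫⁻ x, K x ∂μ) * ∫⁻ x, K x * g x ^ 2 ∂μ := by
  have h := sq_lintegral_mul_le (μ.withDensity K) (f := fun _ => 1) measurable_const hg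
  rw [lintegral_withDensity_eq_lintegral_mul μ hK (by fun_prop),
    lintegral_withDensity_eq_lintegral_mul μ hK (by fun_prop),
    lintegral_withDensity_eq_lintegral_mul μ hK (by fun_prop)] at h
  simpa using h

/-- A superposition, with weights `K p`, of rearranged copies of `G` that all have the `L²` norm of
`G`: weighted Cauchy-Schwarz and Tonelli replace Minkowski's inequality. Each placement of the `L²`
factor in the trilinear form reduces to this. -/
theorem normSq_lintegral_le {K : ℝ × ℝ → ℝ≥0∞} {G : ℝ → ℝ≥0∞} {φ : ℝ → ℝ × ℝ → ℝ}
    (hK : Measurable K) (hG : Measurable G) (hφ : Measurable (Function.uncurry φ))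
    (hinv : ∀ p, ∫⁻ ξ, G (φ ξ p) ^ 2 = normSq G) :
    normSq (fun ξ => ∫⁻ p, K p * G (φ ξ p)) ≤ (∫⁻ p, K p) ^ 2 * normSq G := by
  have hφ' : ∀ ξ, Measurable (φ ξ) := fun ξ => hφ.comp measurable_prodMk_left
  have hm : Measurable (Function.uncurry fun (ξ : ℝ) (p : ℝ × ℝ) => K p * G (φ ξ p) ^ 2) :=
    (hK.comp measurable_snd).mul ((hG.comp hφ).pow_const 2)
  calc normSq (fun ξ => ∫⁻ p, K p * G (φ ξ p))
      ≤ ∫⁻ ξ, (∫⁻ p, K p) * ∫⁻ p, K p * G (φ ξ p) ^ 2 :=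
        lintegral_mono fun ξ => sq_lintegral_mul_le_weighted volume hK (hG.comp (hφ' ξ))
    _ = (∫⁻ p, K p) * ∫⁻ ξ, ∫⁻ p, K p * G (φ ξ p) ^ 2 :=
        lintegral_const_mul _ hm.lintegral_prod_right'
    _ = (∫⁻ p, K p) * ∫⁻ p, ∫⁻ ξ, K p * G (φ ξ p) ^ 2 := by
        rw [lintegral_lintegral_swap hm.aemeasurable]
    _ = (∫⁻ p, K p) * ∫⁻ p, K p * normSq G := by
        congr 1
        refine lintegral_congr fun p => ?_
        rw [lintegral_const_mul _ (by
          have : Measurable fun ξ => φ ξ p := hφ.comp measurable_prodMk_right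
          fun_prop), hinv]
    _ = _ := by
        rw [lintegral_mul_const _ hK]
        ring

/-- The change of variables that exchanges `ξ₁` with `ξ₃ = ξ - ξ₁ + ξ₂`. -/
theorem lintegral_prod_eq_shear_fst {F : ℝ × ℝ → ℝ≥0∞} (hF : Measurable F) (ξ : ℝ) :
    ∫⁻ p, F p = ∫⁻ p : ℝ × ℝ, F (ξ - p.1 + p.2, p.2) := by
  rw [Measure.volume_eq_prod, lintegral_prod_symm _ hF.aemeasurable,
    lintegral_prod_symm _ (by fun_prop)]
  refine lintegral_congr fun y => ?_
  rw [← lintegral_sub_left_eq_self (fun x => F (x, y)) (ξ + y)]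
  exact lintegral_congr fun x => by ring_nf

/-- The change of variables to `(ξ₁, ξ₃)`, in which `ξ₂ = ξ₁ + ξ₃ - ξ`. -/
theorem lintegral_prod_eq_shear_snd {F : ℝ × ℝ → ℝ≥0∞} (hF : Measurable F) (ξ : ℝ) :
    ∫⁻ p, F p = ∫⁻ p : ℝ × ℝ, F (p.1, p.1 + p.2 - ξ) := by
  rw [Measure.volume_eq_prod, lintegral_prod _ hF.aemeasurable,
    lintegral_prod _ (by fun_prop)]
  refine lintegral_congr fun x => ?_
  rw [← lintegral_add_right_eq_self (fun y => F (x, y)) (x - ξ)]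
  exact lintegral_congr fun y => by ring_nf

theorem measurable_posTri_integrand {M : ℝ → ℝ → ℝ → ℝ≥0∞} {f g h : ℝ → ℝ≥0∞}
    (hM : Measurable fun q : ℝ × ℝ × ℝ => M q.1 q.2.1 q.2.2)
    (hf : Measurable f) (hg : Measurable g) (hh : Measurable h) :
    Measurable fun q : ℝ × ℝ × ℝ =>
      M q.1 q.2.1 q.2.2 * (f q.2.1 * g q.2.2 * h (q.1 - q.2.1 + q.2.2)) := by
  fun_prop

theorem measurable_posTri {M : ℝ → ℝ → ℝ → ℝ≥0∞} {f g h : ℝ → ℝ≥0∞}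
    (hM : Measurable fun q : ℝ × ℝ × ℝ => M q.1 q.2.1 q.2.2)
    (hf : Measurable f) (hg : Measurable g) (hh : Measurable h) :
    Measurable (posTri M f g h) :=
  (measurable_posTri_integrand hM hf hg hh).lintegral_prod_right'

/-- The symmetry between the two factors that are not conjugated; bounds with the first factor in
`L²` are deduced from those with the third. -/
theorem posTri_swap {M : ℝ → ℝ → ℝ → ℝ≥0∞} {f g h : ℝ → ℝ≥0∞}
    (hM : Measurable fun q : ℝ × ℝ × ℝ => M q.1 q.2.1 q.2.2)
    (hf : Measurable f) (hg : Measurable g) (hh : Measurable h) (ξ : ℝ) :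
    posTri M f g h ξ = posTri (fun ξ x y => M ξ (ξ - x + y) y) h g f ξ := by
  unfold posTri
  rw [lintegral_prod_eq_shear_fst
    (F := fun p => M ξ p.1 p.2 * (f p.1 * g p.2 * h (ξ - p.1 + p.2)))
    ((measurable_posTri_integrand hM hf hg hh).comp (measurable_prodMk_left (x := ξ))) ξ]
  refine lintegral_congr fun p => ?_
  simp only
  rw [show ξ - (ξ - p.1 + p.2) + p.2 = p.1 by ring]
  ring

theorem posTri_mono {M M' : ℝ → ℝ → ℝ → ℝ≥0∞} {f g h f' g' h' : ℝ → ℝ≥0∞} {ξ : ℝ}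
    (H : ∀ x y, M ξ x y * (f x * g y * h (ξ - x + y)) ≤
      M' ξ x y * (f' x * g' y * h' (ξ - x + y))) :
    posTri M f g h ξ ≤ posTri M' f' g' h' ξ :=
  lintegral_mono fun p => H p.1 p.2

theorem normSq_mono {f g : ℝ → ℝ≥0∞} (h : ∀ x, f x ≤ g x) : normSq f ≤ normSq g :=
  lintegral_mono fun x => by gcongr; exact h x

theorem normSq_add_le {f g : ℝ → ℝ≥0∞} (hf : Measurable f) :
    normSq (fun x => f x + g x) ≤ 2 * (normSq f + normSq g) := by
  unfold normSq
  rw [← lintegral_add_left (by fun_prop), ← lintegral_const_mul' _ _ (by simp)]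
  refine lintegral_mono fun x => ?_
  have := ENNReal.rpow_add_le_mul_rpow_add_rpow (f x) (g x) (p := 2) (by norm_num)
  simp only [ENNReal.rpow_ofNat] at this
  convert this using 2
  norm_num

theorem normSq_const_mul (c : ℝ≥0∞) {f : ℝ → ℝ≥0∞} (hf : Measurable f) :
    normSq (fun x => c * f x) = c ^ 2 * normSq f := by
  unfold normSq
  simp only [mul_pow]
  exact lintegral_const_mul _ (by fun_prop)

theorem lintegral_prod_mul' {f g : ℝ → ℝ≥0∞} (hf : Measurable f) (hg : Measurable g) :
    ∫⁻ p : ℝ × ℝ, f p.1 * g p.2 = (∫⁻ x, f x) * ∫⁻ x, g x := by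
  rw [Measure.volume_eq_prod]
  exact lintegral_prod_mul hf.aemeasurable hg.aemeasurable

/-- The form with the kernel `k(ξ - ξ₃)` and the third function in `L²`. -/
theorem normSq_posTri_kernel_right_le {k f g h : ℝ → ℝ≥0∞} (hk : Measurable k)
    (hf : Measurable f) (hg : Measurable g) (hh : Measurable h) :
    normSq (posTri (fun _ x y => k (x - y)) f g h) ≤
      (∫⁻ p : ℝ × ℝ, k (p.1 - p.2) * (f p.1 * g p.2)) ^ 2 * normSq h := by
  have := normSq_lintegral_le (K := fun p => k (p.1 - p.2) * (f p.1 * g p.2)) (G := h)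
    (φ := fun ξ p => ξ - p.1 + p.2) (by fun_prop) hh (by unfold Function.uncurry; fun_prop)
    (fun p => by
      rw [normSq, ← lintegral_add_right_eq_self (fun x => h x ^ 2) (-p.1 + p.2)]
      exact lintegral_congr fun x => by ring_nf)
  convert this using 2
  ext ξ
  exact lintegral_congr fun p => by ring

theorem normSq_posTri_one_right_le {f g h : ℝ → ℝ≥0∞}
    (hf : Measurable f) (hg : Measurable g) (hh : Measurable h) :
    normSq (posTri (fun _ _ _ => 1) f g h) ≤
      ((∫⁻ x, f x) * ∫⁻ x, g x) ^ 2 * normSq h := by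
  have := normSq_posTri_kernel_right_le (k := fun _ => 1) measurable_const hf hg hh
  simpa [lintegral_prod_mul' hf hg] using this

theorem normSq_posTri_one_left_le {f g h : ℝ → ℝ≥0∞}
    (hf : Measurable f) (hg : Measurable g) (hh : Measurable h) :
    normSq (posTri (fun _ _ _ => 1) f g h) ≤
      ((∫⁻ x, h x) * ∫⁻ x, g x) ^ 2 * normSq f := by
  refine le_trans (le_of_eq ?_) (normSq_posTri_one_right_le hh hg hf)
  congr 1
  ext ξ
  exact posTri_swap measurable_const hf hg hh ξ

theorem normSq_posTri_one_middle_le {f g h : ℝ → ℝ≥0∞}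
    (hf : Measurable f) (hg : Measurable g) (hh : Measurable h) :
    normSq (posTri (fun _ _ _ => 1) f g h) ≤
      ((∫⁻ x, f x) * ∫⁻ x, h x) ^ 2 * normSq g := by
  have := normSq_lintegral_le (K := fun p => f p.1 * h p.2) (G := g)
    (φ := fun ξ p => p.1 + p.2 - ξ) (by fun_prop) hg (by unfold Function.uncurry; fun_prop)
    (fun p => by
      rw [normSq, ← lintegral_sub_left_eq_self (fun x => g x ^ 2) (p.1 + p.2)])
  rw [lintegral_prod_mul' hf hh] at this
  convert this using 2
  ext ξ
  unfold posTri
  rw [lintegral_prod_eq_shear_snd (by fun_prop) ξ]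
  refine lintegral_congr fun p => ?_
  simp only
  rw [show ξ - p.1 + (p.1 + p.2 - ξ) = p.2 by ring]
  ring

/-- The form with the kernel `k(ξ - ξ₁)` and the first function in `L²`. -/
theorem normSq_posTri_kernel_left_le {k f g h : ℝ → ℝ≥0∞} (hk : Measurable k)
    (hf : Measurable f) (hg : Measurable g) (hh : Measurable h) :
    normSq (posTri (fun ξ x _ => k (ξ - x)) f g h) ≤
      (∫⁻ p : ℝ × ℝ, k (p.1 - p.2) * (h p.1 * g p.2)) ^ 2 * normSq f := by
  refine le_trans (le_of_eq ?_) (normSq_posTri_kernel_right_le hk hh hg hf)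
  congr 1
  ext ξ
  rw [posTri_swap (by fun_prop) hf hg hh ξ]
  congr 1
  ext ξ x y
  congr 1
  ring

/-- The Cauchy-Schwarz bound for a square-integrable kernel. -/
theorem normSq_posTri_le_of_kernel_sq {M : ℝ → ℝ → ℝ → ℝ≥0∞} {f g h : ℝ → ℝ≥0∞} {C : ℝ≥0∞}
    (hM : Measurable fun q : ℝ × ℝ × ℝ => M q.1 q.2.1 q.2.2)
    (hf : Measurable f) (hg : Measurable g) (hh : Measurable h)
    (hC : ∀ ξ, ∫⁻ p : ℝ × ℝ, M ξ p.1 p.2 ^ 2 ≤ C) :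
    normSq (posTri M f g h) ≤ C * (normSq f * normSq g * normSq h) := by
  have key : ∫⁻ ξ, ∫⁻ p : ℝ × ℝ, (f p.1 * g p.2 * h (ξ - p.1 + p.2)) ^ 2 =
      normSq f * normSq g * normSq h := by
    rw [lintegral_lintegral_swap (by fun_prop)]
    have : ∀ p : ℝ × ℝ, ∫⁻ ξ, (f p.1 * g p.2 * h (ξ - p.1 + p.2)) ^ 2 =
        (f p.1 ^ 2 * g p.2 ^ 2) * normSq h := fun p => by
      simp only [mul_pow]
      rw [lintegral_const_mul _ (by fun_prop), normSq,
        ← lintegral_add_right_eq_self (fun x => h x ^ 2) (-p.1 + p.2)]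
      congr 1
      exact lintegral_congr fun x => by ring_nf
    simp only [this]
    rw [lintegral_mul_const _ (by fun_prop),
      lintegral_prod_mul' (hf.pow_const 2) (hg.pow_const 2)]
    rfl
  calc normSq (posTri M f g h)
      ≤ ∫⁻ ξ, C * ∫⁻ p : ℝ × ℝ, (f p.1 * g p.2 * h (ξ - p.1 + p.2)) ^ 2 := by
        refine lintegral_mono fun ξ => ?_
        refine (sq_lintegral_mul_le volume (f := fun p : ℝ × ℝ => M ξ p.1 p.2)
          (g := fun p : ℝ × ℝ => f p.1 * g p.2 * h (ξ - p.1 + p.2))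
          (hM.comp (measurable_prodMk_left (x := ξ))) (by fun_prop)).trans ?_
        gcongr
        exact hC ξ
    _ = _ := by
        rw [lintegral_const_mul _ (Measurable.lintegral_prod_right'
          (f := fun q : ℝ × ℝ × ℝ => (f q.2.1 * g q.2.2 * h (q.1 - q.2.1 + q.2.2)) ^ 2)
          (by fun_prop)), key]

end

noncomputable section

/-! ### Sobolev weights -/

/-- The Sobolev weight `⟨2πξ⟩^r`. -/
def wt (r ξ : ℝ) : ℝ := (1 + (2 * Real.pi * ξ) ^ 2) ^ (r / 2)

theorem wt_pos (r ξ : ℝ) : 0 < wt r ξ := by unfold wt; positivity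

theorem wt_nonneg (r ξ : ℝ) : 0 ≤ wt r ξ := (wt_pos r ξ).le

theorem measurable_wt (r : ℝ) : Measurable (wt r) := by unfold wt; fun_prop

attribute [fun_prop] measurable_wt

theorem wt_mul_wt (r r' ξ : ℝ) : wt r ξ * wt r' ξ = wt (r + r') ξ := by
  unfold wt
  rw [← Real.rpow_add (by positivity)]
  ring_nf

@[simp]
theorem wt_zero (ξ : ℝ) : wt 0 ξ = 1 := by simp [wt]

theorem wt_neg_mul_wt (r ξ : ℝ) : wt (-r) ξ * wt r ξ = 1 := by simp [wt_mul_wt]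

theorem wt_mul_wt_neg (r ξ : ℝ) : wt r ξ * wt (-r) ξ = 1 := by simp [wt_mul_wt]

theorem wt_mono {r r' : ℝ} (h : r ≤ r') (ξ : ℝ) : wt r ξ ≤ wt r' ξ :=
  Real.rpow_le_rpow_of_exponent_le (by nlinarith [sq_nonneg (2 * Real.pi * ξ)]) (by linarith)

theorem wt_le_one {r : ℝ} (h : r ≤ 0) (ξ : ℝ) : wt r ξ ≤ 1 := by
  simpa using wt_mono h ξ

theorem one_le_wt {r : ℝ} (h : 0 ≤ r) (ξ : ℝ) : 1 ≤ wt r ξ := by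
  simpa using wt_mono h ξ

theorem wt_le_of_abs_le {r c ξ η : ℝ} (hr : 0 ≤ r) (hc : 1 ≤ c) (h : |ξ| ≤ c * |η|) :
    wt r ξ ≤ c ^ r * wt r η := by
  have h1 : ξ ^ 2 ≤ c ^ 2 * η ^ 2 := by
    rw [← sq_abs ξ, ← sq_abs η, ← mul_pow]
    gcongr
  have h2 : 1 + (2 * Real.pi * ξ) ^ 2 ≤ c ^ 2 * (1 + (2 * Real.pi * η) ^ 2) := by
    have : 1 ≤ c ^ 2 := one_le_pow₀ hc
    nlinarith [mul_le_mul_of_nonneg_left h1 (sq_nonneg (2 * Real.pi))]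
  calc wt r ξ ≤ (c ^ 2 * (1 + (2 * Real.pi * η) ^ 2)) ^ (r / 2) := by
        unfold wt; gcongr
    _ = c ^ r * wt r η := by
        rw [Real.mul_rpow (by positivity) (by positivity), ← Real.rpow_natCast c 2,
          ← Real.rpow_mul (by linarith)]
        congr 2
        push_cast
        ring

theorem abs_rpow_le_wt {r : ℝ} (hr : 0 ≤ r) (ξ : ℝ) : |2 * Real.pi * ξ| ^ r ≤ wt r ξ := by
  unfold wt
  calc |2 * Real.pi * ξ| ^ r = ((2 * Real.pi * ξ) ^ 2) ^ (r / 2) := by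
        rw [← sq_abs, ← Real.rpow_natCast _ 2, ← Real.rpow_mul (abs_nonneg _)]
        congr 1
        push_cast
        ring
    _ ≤ _ := by gcongr; linarith

theorem abs_rpow_le_wt' {r : ℝ} (hr : 0 ≤ r) (ξ : ℝ) : |ξ| ^ r ≤ wt r ξ := by
  refine le_trans ?_ (abs_rpow_le_wt hr ξ)
  refine Real.rpow_le_rpow (abs_nonneg _) ?_ hr
  rw [abs_mul, abs_of_pos Real.two_pi_pos]
  nlinarith [abs_nonneg ξ, Real.pi_gt_three]

theorem wt_le_abs_rpow {r ξ : ℝ} (hr : 0 ≤ r) (h : 1 ≤ |ξ|) : wt r ξ ≤ wt r 1 * |ξ| ^ r := by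
  have h1 : 1 + (2 * Real.pi * ξ) ^ 2 ≤ (1 + (2 * Real.pi * 1) ^ 2) * |ξ| ^ 2 := by
    rw [mul_pow, ← sq_abs ξ]
    nlinarith
  calc wt r ξ ≤ ((1 + (2 * Real.pi * 1) ^ 2) * |ξ| ^ 2) ^ (r / 2) := by
        unfold wt; gcongr
    _ = wt r 1 * |ξ| ^ r := by
        rw [Real.mul_rpow (by positivity) (by positivity), ← Real.rpow_natCast |ξ| 2,
          ← Real.rpow_mul (abs_nonneg _)]
        unfold wt
        congr 2
        push_cast
        ring

/-- The Sobolev weight as an extended nonnegative real. -/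
def ewt (r ξ : ℝ) : ℝ≥0∞ := ENNReal.ofReal (wt r ξ)

theorem measurable_ewt (r : ℝ) : Measurable (ewt r) := by unfold ewt; fun_prop

attribute [fun_prop] measurable_ewt

theorem ewt_mul_ewt (r r' ξ : ℝ) : ewt r ξ * ewt r' ξ = ewt (r + r') ξ := by
  rw [ewt, ewt, ← ENNReal.ofReal_mul (wt_nonneg _ _), wt_mul_wt, ewt]

@[simp]
theorem ewt_zero (ξ : ℝ) : ewt 0 ξ = 1 := by simp [ewt]

theorem ewt_mono {r r' : ℝ} (h : r ≤ r') (ξ : ℝ) : ewt r ξ ≤ ewt r' ξ :=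
  ENNReal.ofReal_le_ofReal (wt_mono h ξ)

theorem lintegral_ewt_lt_top {r : ℝ} (hr : r < -1) : ∫⁻ ξ, ewt r ξ < ⊤ := by
  have h := (integrable_rpow_neg_one_add_norm_sq (E := ℝ) (μ := volume) (r := -r)
    (by simp; linarith)).comp_mul_left' Real.two_pi_pos.ne'
  have h2 : Integrable (wt r) := by
    refine h.congr (Eventually.of_forall fun x => ?_)
    simp only [wt, neg_neg, Real.norm_eq_abs, sq_abs]
  have := h2.hasFiniteIntegral
  rw [hasFiniteIntegral_iff_ofReal (Eventually.of_forall (wt_nonneg r))] at this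
  exact this

/-- The embedding of `H^r` into the functions with integrable Fourier transform; the constant is
finite once `r > 1/2`. -/
theorem sq_lintegral_le_ewt {r : ℝ} {g : ℝ → ℝ≥0∞} (hg : Measurable g) :
    (∫⁻ x, g x) ^ 2 ≤ (∫⁻ x, ewt (-2 * r) x) * normSq (fun x => ewt r x * g x) := by
  have := sq_lintegral_mul_le volume (f := ewt (-r)) (g := fun x => ewt r x * g x)
    (by fun_prop) (by fun_prop)
  simp only [← mul_assoc, ewt_mul_ewt, sq (ewt (-r) _), neg_add_cancel, ewt_zero, one_mul] at this
  unfold normSq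
  convert this using 4
  ring_nf

/-! ### The resonance function -/

/-- As `β ≤ 2`, the second derivative of `x^β` on `(0, M]` is smallest at `M`, and a parabola with
that curvature can be subtracted. The difference on `[0, M]` is convex and increasing, so its
composition with `|x|` is convex on the symmetric interval, with no differentiation at the origin.
-/
theorem convexOn_abs_rpow_sub_sq {β M : ℝ} (hβ : 1 < β) (hβ' : β ≤ 2) (hM : 0 < M) :
    ConvexOn ℝ (Set.Icc (-M) M)
      (fun x => |x| ^ β - β * (β - 1) * M ^ (β - 2) / 2 * x ^ 2) := by
  set κ := β * (β - 1) * M ^ (β - 2) with hκ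
  have hd : ∀ x ∈ Set.Ioo 0 M,
      HasDerivAt (fun x : ℝ => x ^ β - κ / 2 * x ^ 2) (β * x ^ (β - 1) - κ * x) x := by
    intro x hx
    have := (Real.hasDerivAt_rpow_const (x := x) (p := β) (Or.inl hx.1.ne')).sub
      ((hasDerivAt_pow 2 x).const_mul (κ / 2))
    refine this.congr_deriv ?_
    norm_num
    ring
  have hd2 : ∀ x ∈ Set.Ioo 0 M,
      HasDerivAt (fun x : ℝ => β * x ^ (β - 1) - κ * x) (β * ((β - 1) * x ^ (β - 2)) - κ) x := by
    intro x hx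
    have := ((Real.hasDerivAt_rpow_const (x := x) (p := β - 1) (Or.inl hx.1.ne')).const_mul β).sub
      ((hasDerivAt_id x).const_mul κ)
    refine this.congr_deriv ?_
    rw [show β - 1 - 1 = β - 2 by ring]
    ring
  have hpow : ∀ x ∈ Set.Ioo 0 M, M ^ (β - 2) ≤ x ^ (β - 2) := fun x hx =>
    Real.rpow_le_rpow_of_nonpos hx.1 hx.2.le (by linarith)
  have hcont : ContinuousOn (fun x : ℝ => x ^ β - κ / 2 * x ^ 2) (Set.Icc 0 M) :=
    ((Real.continuous_rpow_const (by linarith)).sub (by fun_prop)).continuousOn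
  have hconv : ConvexOn ℝ (Set.Icc 0 M) (fun x : ℝ => x ^ β - κ / 2 * x ^ 2) := by
    refine convexOn_of_hasDerivWithinAt2_nonneg (convex_Icc 0 M) hcont
      (f' := fun x => β * x ^ (β - 1) - κ * x)
      (f'' := fun x => β * ((β - 1) * x ^ (β - 2)) - κ) ?_ ?_ ?_
    · intro x hx
      rw [interior_Icc] at hx
      exact (hd x hx).hasDerivWithinAt
    · intro x hx
      rw [interior_Icc] at hx
      exact (hd2 x hx).hasDerivWithinAt
    · intro x hx
      rw [interior_Icc] at hx
      have := mul_le_mul_of_nonneg_left (hpow x hx)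
        (mul_nonneg (by linarith : 0 ≤ β) (by linarith : 0 ≤ β - 1))
      simp only [hκ]
      linarith
  -- Here `β - 1 ≤ 1` is used: `x^{β-1} = x^{β-2} x ≥ (β - 1) M^{β-2} x`.
  have hmono : MonotoneOn (fun x : ℝ => x ^ β - κ / 2 * x ^ 2) (Set.Icc 0 M) := by
    refine monotoneOn_of_deriv_nonneg (convex_Icc 0 M) hcont ?_ ?_
    · intro x hx
      rw [interior_Icc] at hx
      exact (hd x hx).differentiableAt.differentiableWithinAt
    · intro x hx
      rw [interior_Icc] at hx
      rw [(hd x hx).deriv]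
      have h1 : x ^ (β - 1) = x ^ (β - 2) * x := by
        rw [← Real.rpow_add_one hx.1.ne']
        ring_nf
      rw [h1]
      have h2 := mul_le_mul_of_nonneg_right (hpow x hx) hx.1.le
      have h3 : 0 ≤ M ^ (β - 2) * x := mul_nonneg (by positivity) hx.1.le
      have h4 : (β - 1) * (M ^ (β - 2) * x) ≤ x ^ (β - 2) * x := by nlinarith
      have := mul_le_mul_of_nonneg_left h4 (by linarith : 0 ≤ β)
      simp only [hκ]
      linarith
  have himg : (fun x : ℝ => |x|) '' Set.Icc (-M) M = Set.Icc 0 M := by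
    ext y
    constructor
    · rintro ⟨x, hx, rfl⟩
      exact ⟨abs_nonneg x, abs_le.2 hx⟩
    · intro hy
      exact ⟨y, ⟨by linarith [hy.1], hy.2⟩, abs_of_nonneg hy.1⟩
  have habs : ConvexOn ℝ (Set.Icc (-M) M) (fun x : ℝ => |x|) :=
    (convexOn_norm (convex_Icc (-M) M))
  have := ConvexOn.comp (f := fun x : ℝ => |x|) (s := Set.Icc (-M) M)
    (g := fun x : ℝ => x ^ β - κ / 2 * x ^ 2) (by rwa [himg]) habs (by rwa [himg])
  convert this using 2
  simp

/-- If `A` and `B` have the same sign, `x - A` and `x - B` are convex combinations of the extreme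
points `x` and `x - A - B` with complementary weights; the two convexity inequalities add up. -/
theorem four_point_of_convexOn {g : ℝ → ℝ} {S : Set ℝ} (hg : ConvexOn ℝ S g) {x A B : ℝ}
    (hAB : 0 ≤ A * B) (h0 : x ∈ S) (h1 : x - A - B ∈ S) :
    g (x - A) + g (x - B) ≤ g x + g (x - A - B) := by
  rcases eq_or_ne (A + B) 0 with h | h
  · have hA : A = 0 := by nlinarith [sq_nonneg A, sq_nonneg (A + B)]
    have hB : B = 0 := by linarith
    simp [hA, hB]
  · have hA : 0 ≤ A / (A + B) := by
      rw [show A / (A + B) = (A ^ 2 + A * B) / (A + B) ^ 2 by field_simp]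
      positivity
    have hB : 0 ≤ B / (A + B) := by
      rw [show B / (A + B) = (B ^ 2 + A * B) / (A + B) ^ 2 by field_simp; ring]
      positivity
    have hs : B / (A + B) + A / (A + B) = 1 := by field_simp; ring
    have e1 := hg.2 h0 h1 hB hA hs
    have e2 := hg.2 h0 h1 hA hB (by linarith)
    simp only [smul_eq_mul] at e1 e2
    rw [show B / (A + B) * x + A / (A + B) * (x - A - B) = x - A by field_simp; ring] at e1
    rw [show A / (A + B) * x + B / (A + B) * (x - A - B) = x - B by field_simp; ring] at e2
    have : B / (A + B) * g x + A / (A + B) * g (x - A - B) +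
        (A / (A + B) * g x + B / (A + B) * g (x - A - B)) = g x + g (x - A - B) := by
      field_simp
      ring
    linarith

/-- The four-point inequality is applied to `|x|^β` minus its parabola on `[-M, M]`. The four-point
difference of `x²` equals `2AB`, so the parabola yields the lower bound. -/
theorem abs_four_point_rpow {β x A B : ℝ} (hβ : 1 < β) (hβ' : β ≤ 2) :
    β * (β - 1) * (|A| * |B| * (|x| + |A| + |B|) ^ (β - 2)) ≤
      |(|x| ^ β - |x - A| ^ β - |x - B| ^ β + |x - A - B| ^ β)| := by
  rcases eq_or_ne (|x| + |A| + |B|) 0 with h0 | h0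
  · have hA : |A| = 0 := by linarith [abs_nonneg x, abs_nonneg A, abs_nonneg B]
    simp [hA]
  have hM : 0 < |x| + |A| + |B| :=
    lt_of_le_of_ne (by positivity) h0.symm
  set M := |x| + |A| + |B| with hMdef
  have hc := convexOn_abs_rpow_sub_sq hβ hβ' hM
  have hmem : ∀ y, |y| ≤ M → y ∈ Set.Icc (-M) M := fun y hy => abs_le.1 hy
  have nA := abs_nonneg A
  have nB := abs_nonneg B
  have nx := abs_nonneg x
  have mx := hmem x (by linarith)
  have mA := hmem (x - A) ((abs_sub x A).trans (by linarith))
  have mB := hmem (x - B) ((abs_sub x B).trans (by linarith))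
  have mAB := hmem (x - A - B) ((abs_sub (x - A) B).trans (by linarith [abs_sub x A]))
  rw [← abs_mul]
  rcases le_total 0 (A * B) with h | h
  · have := four_point_of_convexOn hc h mx mAB
    rw [abs_of_nonneg h]
    refine le_trans ?_ (le_abs_self _)
    nlinarith
  -- For `AB ≤ 0` the extreme points are `x - A` and `x - B`, and the difference changes sign.
  · have := four_point_of_convexOn hc (x := x - A) (A := -A) (B := B) (by linarith) mA
      (by convert mB using 1; ring)
    simp only [sub_neg_eq_add, sub_add_cancel] at this
    rw [abs_of_nonpos h]
    refine le_trans ?_ (neg_le_abs _)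
    nlinarith

/-- The dispersion relation `|2πξ|^{2α}`. -/
def disp (α ξ : ℝ) : ℝ := |2 * Real.pi * ξ| ^ (2 * α)

theorem measurable_disp (α : ℝ) : Measurable (disp α) := by unfold disp; fun_prop

attribute [fun_prop] measurable_disp

/-- The resonance function of the interaction `(ξ₁, ξ₂, ξ - ξ₁ + ξ₂) → ξ`. -/
def phase (α ξ x y : ℝ) : ℝ := disp α ξ - disp α x + disp α y - disp α (ξ - x + y)

theorem measurable_phase (α : ℝ) :
    Measurable fun q : ℝ × ℝ × ℝ => phase α q.1 q.2.1 q.2.2 := by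
  unfold phase; fun_prop

theorem phase_swap (α ξ x y : ℝ) : phase α ξ (ξ - x + y) y = phase α ξ x y := by
  unfold phase
  rw [show ξ - (ξ - x + y) + y = x by ring]
  ring

/-- The resonance function is the four-point difference of the dispersion relation with base point
`ξ` and steps `ξ - x` and `x - y`. The factor `(2π)^{2α} ≥ 1` is dropped. -/
theorem le_abs_phase {α : ℝ} (hα : 1 / 2 < α) (hα' : α ≤ 1) (ξ x y : ℝ) :
    2 * α * (2 * α - 1) * (|ξ - x| * |x - y| * (|ξ| + |ξ - x| + |x - y|) ^ (2 * α - 2)) ≤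
      |phase α ξ x y| := by
  have h := abs_four_point_rpow (β := 2 * α) (x := ξ) (A := ξ - x) (B := x - y)
    (by linarith) (by linarith)
  have e : phase α ξ x y = (2 * Real.pi) ^ (2 * α) * (|ξ| ^ (2 * α) - |ξ - (ξ - x)| ^ (2 * α) -
      |ξ - (x - y)| ^ (2 * α) + |ξ - (ξ - x) - (x - y)| ^ (2 * α)) := by
    unfold phase disp
    simp only [abs_mul (2 * Real.pi), abs_of_pos Real.two_pi_pos,
      Real.mul_rpow Real.two_pi_pos.le (abs_nonneg _)]
    rw [show ξ - (ξ - x) = x by ring, show x - (x - y) = y by ring,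
      show ξ - (x - y) = ξ - x + y by ring]
    ring
  rw [e, abs_mul, abs_of_pos (Real.rpow_pos_of_pos Real.two_pi_pos _)]
  refine h.trans (le_mul_of_one_le_left (abs_nonneg _) (Real.one_le_rpow ?_ (by linarith)))
  linarith [Real.pi_gt_three]

end

noncomputable section

/-! ### The smoothing multiplier -/

/-- The multiplier `(1 + iΦ)⁻¹` produced by the differentiation by parts. -/
def res (α ξ x y : ℝ) : ℂ := (1 + Complex.I * (phase α ξ x y : ℂ))⁻¹

theorem measurable_res (α : ℝ) : Measurable fun q : ℝ × ℝ × ℝ => res α q.1 q.2.1 q.2.2 := by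
  unfold res
  have := measurable_phase α
  fun_prop

theorem res_swap (α ξ x y : ℝ) : res α ξ (ξ - x + y) y = res α ξ x y := by
  rw [res, phase_swap, res]

theorem one_le_norm_one_add_I_mul (φ : ℝ) : 1 ≤ ‖(1 + Complex.I * (φ : ℂ))‖ := by
  simpa using Complex.abs_re_le_norm (1 + Complex.I * (φ : ℂ))

theorem abs_le_norm_one_add_I_mul (φ : ℝ) : |φ| ≤ ‖(1 + Complex.I * (φ : ℂ))‖ := by
  simpa using Complex.abs_im_le_norm (1 + Complex.I * (φ : ℂ))

theorem norm_res_le_one (α ξ x y : ℝ) : ‖res α ξ x y‖ ≤ 1 := by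
  rw [res, norm_inv]
  exact inv_le_one_of_one_le₀ (one_le_norm_one_add_I_mul _)

/-- Interpolation between `|1 + iΦ| ≥ 1` and `|1 + iΦ| ≥ |Φ|`: any fractional power of a lower bound
for the resonance may be spent. -/
theorem norm_res_mul_rpow_le {α ξ x y θ L : ℝ} (hθ : 0 ≤ θ) (hθ' : θ ≤ 1) (hL : 0 ≤ L)
    (h : L ≤ |phase α ξ x y|) : ‖res α ξ x y‖ * L ^ θ ≤ 1 := by
  rw [res, norm_inv]
  have h1 := one_le_norm_one_add_I_mul (phase α ξ x y)
  have h2 := abs_le_norm_one_add_I_mul (phase α ξ x y)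
  set n := ‖(1 + Complex.I * (phase α ξ x y : ℂ))‖
  have h3 : L ^ θ ≤ n := by
    calc L ^ θ ≤ n ^ θ := by gcongr; linarith
      _ ≤ n ^ (1 : ℝ) := Real.rpow_le_rpow_of_exponent_le h1 hθ'
      _ = n := Real.rpow_one n
  rw [inv_mul_le_iff₀ (by linarith)]
  linarith

/-- In this regime the sum of the three lengths is at most `6|x - y|`, so `|x - y|` raises its power
from `2α - 2` to the positive exponent `2α - 1`, and the sum may then be replaced by `|ξ|`. -/
theorem le_abs_phase_of_le {α : ℝ} (hα : 1 / 2 < α) (hα' : α ≤ 1) {ξ x y : ℝ} (hξ : 0 < |ξ|)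
    (h1 : |ξ| / 4 ≤ |x - y|) (h2 : |ξ - x| ≤ |x - y|) :
    2 * α * (2 * α - 1) / 6 * (|ξ - x| * |ξ| ^ (2 * α - 1)) ≤ |phase α ξ x y| := by
  refine le_trans ?_ (le_abs_phase hα hα' ξ x y)
  set M := |ξ| + |ξ - x| + |x - y| with hM
  have hM0 : 0 < M := by positivity
  have h3 : M / 6 ≤ |x - y| := by linarith
  have h4 : |ξ| ^ (2 * α - 1) ≤ M ^ (2 * α - 1) := by
    refine Real.rpow_le_rpow hξ.le ?_ (by linarith)
    linarith [abs_nonneg (ξ - x), abs_nonneg (x - y)]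
  have h5 : M ^ (2 * α - 1) = M ^ (2 * α - 2) * M := by
    rw [← Real.rpow_add_one hM0.ne']
    ring_nf
  have hk : 0 < 2 * α * (2 * α - 1) := by nlinarith
  have h6 : |ξ| ^ (2 * α - 1) / 6 ≤ |x - y| * M ^ (2 * α - 2) := by
    have := mul_le_mul_of_nonneg_left h3 (by positivity : 0 ≤ M ^ (2 * α - 2))
    linarith
  have h7 := mul_le_mul_of_nonneg_left (mul_le_mul_of_nonneg_left h6 (abs_nonneg (ξ - x))) hk.le
  linarith

/-- Now the sum of the three lengths is at most `2|ξ|`, and the exponent `2α - 2` is not positive.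
-/
theorem le_abs_phase_of_lt {α : ℝ} (hα : 1 / 2 < α) (hα' : α ≤ 1) {ξ x y : ℝ} (hξ : 0 < |ξ|)
    (h1 : |ξ - x| < |ξ| / 4) (h2 : |x - y| < |ξ| / 4) :
    2 * α * (2 * α - 1) / 4 * (|ξ - x| * |x - y| * |ξ| ^ (2 * α - 2)) ≤ |phase α ξ x y| := by
  refine le_trans ?_ (le_abs_phase hα hα' ξ x y)
  set M := |ξ| + |ξ - x| + |x - y| with hM
  have hM0 : 0 < M := by positivity
  have h4 : (2 * |ξ|) ^ (2 * α - 2) ≤ M ^ (2 * α - 2) :=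
    Real.rpow_le_rpow_of_nonpos hM0 (by linarith) (by linarith)
  rw [Real.mul_rpow (by norm_num) hξ.le] at h4
  have h5 : (1 / 4 : ℝ) ≤ 2 ^ (2 * α - 2) := by
    calc (1 / 4 : ℝ) = 2 ^ (-2 : ℝ) := by
          rw [Real.rpow_neg (by norm_num)]; norm_num
      _ ≤ _ := Real.rpow_le_rpow_of_exponent_le (by norm_num) (by linarith)
  have hk : 0 < 2 * α * (2 * α - 1) := by nlinarith
  have h6 : |ξ| ^ (2 * α - 2) / 4 ≤ M ^ (2 * α - 2) := by
    have := mul_le_mul_of_nonneg_right h5 (by positivity : 0 ≤ |ξ| ^ (2 * α - 2))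
    linarith
  have h7 := mul_le_mul_of_nonneg_left (mul_le_mul_of_nonneg_left h6
    (by positivity : 0 ≤ |ξ - x| * |x - y|)) hk.le
  linarith

theorem wt_le_sum {s : ℝ} (hs : 0 ≤ s) (ξ x y : ℝ) :
    wt s ξ ≤ 3 ^ s * (wt s x + wt s y + wt s (ξ - x + y)) := by
  have h3 : (0 : ℝ) ≤ 3 ^ s := by positivity
  have nx := wt_nonneg s x
  have ny := wt_nonneg s y
  have nz := wt_nonneg s (ξ - x + y)
  have tri : |ξ| ≤ |x| + |y| + |ξ - x + y| := by
    have := abs_add_three x (-y) (ξ - x + y)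
    rwa [abs_neg, show x + -y + (ξ - x + y) = ξ by ring] at this
  have key : ∀ v, |ξ| ≤ 3 * |v| → wt s ξ ≤ 3 ^ s * wt s v := fun v hv =>
    wt_le_of_abs_le hs (by norm_num) hv
  by_cases hx : |ξ| ≤ 3 * |x|
  · exact (key x hx).trans (by gcongr; linarith)
  by_cases hy : |ξ| ≤ 3 * |y|
  · exact (key y hy).trans (by gcongr; linarith)
  · exact (key _ (by linarith)).trans (by gcongr; linarith)

/-- Both differences are comparable to the output frequency. -/
theorem smoothing_bound_nonresonant {α s a : ℝ} (hα : 1 / 2 < α) (hα' : α ≤ 1) (hs : 0 ≤ s)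
    (ha : 0 ≤ a) (ha' : a ≤ 2 * α - 1) {ξ x y : ℝ} (hξ : 1 ≤ |ξ|) (h1 : |ξ| / 4 ≤ |x - y|)
    (h2 : |ξ| / 4 ≤ |ξ - x|) :
    wt (s + a) ξ * ‖res α ξ x y‖ ≤ 3 ^ s * wt a 1 * (2 * α * (2 * α - 1) / 24)⁻¹ *
      (wt s x + wt s y + wt s (ξ - x + y)) := by
  have hk : 0 < 2 * α * (2 * α - 1) := by nlinarith
  have hL : 2 * α * (2 * α - 1) / 24 * |ξ| ^ (2 * α - 1) ≤ |phase α ξ x y| := by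
    have hp : 0 ≤ |ξ| ^ (2 * α - 1) := by positivity
    rcases le_total |ξ - x| |x - y| with h | h
    · refine le_trans ?_ (le_abs_phase_of_le hα hα' (by linarith) h1 h)
      have := mul_le_mul_of_nonneg_right (by linarith : (1 : ℝ) / 4 ≤ |ξ - x|) hp
      nlinarith
    -- Exchanging the first and third frequencies swaps the two differences and preserves the phase.
    · have e1 : ξ - (ξ - x + y) = x - y := by ring
      have e2 : ξ - x + y - y = ξ - x := by ring
      have := le_abs_phase_of_le hα hα' (x := ξ - x + y) (y := y) (ξ := ξ) (by linarith)
        (by rwa [e2]) (by rwa [e1, e2])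
      rw [phase_swap, e1] at this
      refine le_trans ?_ this
      have := mul_le_mul_of_nonneg_right (by linarith : (1 : ℝ) / 4 ≤ |x - y|) hp
      nlinarith
  have hr := norm_res_mul_rpow_le zero_le_one le_rfl (by positivity) hL
  rw [Real.rpow_one] at hr
  have hw : wt a ξ ≤ wt a 1 * |ξ| ^ (2 * α - 1) :=
    (wt_le_abs_rpow ha hξ).trans (mul_le_mul_of_nonneg_left
      (Real.rpow_le_rpow_of_exponent_le hξ ha') (wt_nonneg _ _))
  have hr2 : wt a ξ * ‖res α ξ x y‖ ≤ wt a 1 * (2 * α * (2 * α - 1) / 24)⁻¹ := by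
    calc wt a ξ * ‖res α ξ x y‖ ≤ wt a 1 * |ξ| ^ (2 * α - 1) * ‖res α ξ x y‖ := by gcongr
      _ = wt a 1 * (2 * α * (2 * α - 1) / 24)⁻¹ *
          (‖res α ξ x y‖ * (2 * α * (2 * α - 1) / 24 * |ξ| ^ (2 * α - 1))) := by
          have : 2 * α * (2 * α - 1) / 24 ≠ 0 := by positivity
          generalize 2 * α * (2 * α - 1) / 24 = κ at this
          field_simp
      _ ≤ wt a 1 * (2 * α * (2 * α - 1) / 24)⁻¹ * 1 :=
          mul_le_mul_of_nonneg_left hr (mul_nonneg (wt_nonneg _ _) (by positivity))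
      _ = _ := mul_one _
  calc wt (s + a) ξ * ‖res α ξ x y‖ = wt s ξ * (wt a ξ * ‖res α ξ x y‖) := by
        rw [← wt_mul_wt]; ring
    _ ≤ (3 ^ s * (wt s x + wt s y + wt s (ξ - x + y))) *
        (wt a 1 * (2 * α * (2 * α - 1) / 24)⁻¹) :=
        mul_le_mul (wt_le_sum hs ξ x y) hr2 (mul_nonneg (wt_nonneg _ _) (norm_nonneg _))
          (mul_nonneg (by positivity)
            (add_nonneg (add_nonneg (wt_nonneg _ _) (wt_nonneg _ _)) (wt_nonneg _ _)))
    _ = _ := by ring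

/-- The first input frequency is close to the output frequency, the third one is not. -/
theorem smoothing_bound_left {α s a θ : ℝ} (hα : 1 / 2 < α) (hα' : α ≤ 1) (hs : 0 ≤ s)
    (hθ : 0 ≤ θ) (hθ' : θ ≤ 1) (haθ : a = θ * (2 * α - 1)) {ξ x y : ℝ} (hξ : 1 ≤ |ξ|)
    (h1 : |ξ| / 4 ≤ |x - y|) (h2 : |ξ - x| < |ξ| / 4) (hA : ξ - x ≠ 0) :
    wt (s + a) ξ * ‖res α ξ x y‖ ≤ 2 ^ s * wt a 1 * ((2 * α * (2 * α - 1) / 6) ^ θ)⁻¹ *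
      (|ξ - x| ^ (-θ) * wt s x) := by
  have hk : 0 < 2 * α * (2 * α - 1) := by nlinarith
  have hA' : 0 < |ξ - x| := abs_pos.2 hA
  have hξ0 : 0 < |ξ| := by linarith
  have hr := norm_res_mul_rpow_le hθ hθ' (by positivity)
    (le_abs_phase_of_le hα hα' hξ0 h1 (by linarith))
  rw [Real.mul_rpow (by positivity) (by positivity), Real.mul_rpow (by positivity) (by positivity),
    ← Real.rpow_mul hξ0.le, mul_comm (2 * α - 1) θ, ← haθ] at hr
  have ha : 0 ≤ a := by rw [haθ]; exact mul_nonneg hθ (by linarith)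
  have hr2 : wt a ξ * ‖res α ξ x y‖ ≤
      wt a 1 * ((2 * α * (2 * α - 1) / 6) ^ θ)⁻¹ * |ξ - x| ^ (-θ) := by
    calc wt a ξ * ‖res α ξ x y‖ ≤ wt a 1 * |ξ| ^ a * ‖res α ξ x y‖ := by
          gcongr; exact wt_le_abs_rpow ha hξ
      _ = wt a 1 * ((2 * α * (2 * α - 1) / 6) ^ θ)⁻¹ * |ξ - x| ^ (-θ) *
          (‖res α ξ x y‖ * ((2 * α * (2 * α - 1) / 6) ^ θ * (|ξ - x| ^ θ * |ξ| ^ a))) := by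
          rw [Real.rpow_neg hA'.le]
          have : (2 * α * (2 * α - 1) / 6) ^ θ ≠ 0 := by positivity
          have : |ξ - x| ^ θ ≠ 0 := by positivity
          field_simp
      _ ≤ wt a 1 * ((2 * α * (2 * α - 1) / 6) ^ θ)⁻¹ * |ξ - x| ^ (-θ) * 1 :=
          mul_le_mul_of_nonneg_left hr
            (mul_nonneg (mul_nonneg (wt_nonneg _ _) (by positivity)) (by positivity))
      _ = _ := mul_one _
  have hx : |ξ| ≤ 2 * |x| := by
    have := abs_sub_abs_le_abs_sub ξ x
    linarith
  calc wt (s + a) ξ * ‖res α ξ x y‖ = wt s ξ * (wt a ξ * ‖res α ξ x y‖) := by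
        rw [← wt_mul_wt]; ring
    _ ≤ (2 ^ s * wt s x) * (wt a 1 * ((2 * α * (2 * α - 1) / 6) ^ θ)⁻¹ * |ξ - x| ^ (-θ)) :=
        mul_le_mul (wt_le_of_abs_le hs (by norm_num) hx) hr2
          (mul_nonneg (wt_nonneg _ _) (norm_nonneg _))
          (mul_nonneg (by positivity) (wt_nonneg _ _))
    _ = _ := by ring

/-- All frequencies are comparable. -/
theorem smoothing_bound_resonant {α s a s₀ : ℝ} (hα : 1 / 2 < α) (hα' : α ≤ 1) (hs : 0 ≤ s)
    (ha : 0 ≤ a) (ha' : a ≤ 2 * α - 1) (hs₀ : 0 ≤ s₀) (hs₀' : s₀ ≤ 1)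
    {ξ x y : ℝ} (hξ : 1 ≤ |ξ|)
    (h1 : |ξ - x| < |ξ| / 4) (h2 : |x - y| < |ξ| / 4) (hA : ξ - x ≠ 0) (hB : x - y ≠ 0) :
    wt (s + a) ξ * ‖res α ξ x y‖ ≤
      2 ^ s * (2 ^ s₀) ^ 2 * wt a 1 * ((2 * α * (2 * α - 1) / 4) ^ (1 - s₀))⁻¹ *
      (|ξ| ^ (-(2 * s₀ - 1)) * |ξ - x| ^ (-(1 - s₀)) * |x - y| ^ (-(1 - s₀)) *
        (wt s x * wt s₀ y * wt s₀ (ξ - x + y))) := by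
  have hk : 0 < 2 * α * (2 * α - 1) := by nlinarith
  have hA' : 0 < |ξ - x| := abs_pos.2 hA
  have hB' : 0 < |x - y| := abs_pos.2 hB
  have hξ0 : 0 < |ξ| := by linarith
  -- Only the power `1 - s₀` of the resonance is spent, so that for `s₀ > 1/2` the squares of the
  -- two singular factors are locally integrable. The missing powers of `|ξ|` come from the weights
  -- of the second and third frequencies.
  have hr := norm_res_mul_rpow_le (by linarith : 0 ≤ 1 - s₀) (by linarith) (by positivity)
    (le_abs_phase_of_lt hα hα' hξ0 h1 h2)
  set κ := (2 * α * (2 * α - 1) / 4) ^ (1 - s₀) with hκ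
  have hκ0 : 0 < κ := by positivity
  rw [Real.mul_rpow (by positivity) (by positivity), Real.mul_rpow (by positivity) (by positivity),
    Real.mul_rpow (by positivity) (by positivity), ← Real.rpow_mul hξ0.le, ← hκ] at hr
  have hx : |ξ| ≤ 2 * |x| := by
    have := abs_sub_abs_le_abs_sub ξ x
    linarith
  have hy : |ξ| ≤ 2 * |y| := by
    have := abs_sub_abs_le_abs_sub ξ x
    have := abs_sub_abs_le_abs_sub x y
    linarith
  have hz : |ξ| ≤ 2 * |ξ - x + y| := by
    have := abs_sub_abs_le_abs_sub ξ (ξ - x + y)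
    rw [show ξ - (ξ - x + y) = x - y by ring] at this
    linarith
  have low : ∀ v, |ξ| ≤ 2 * |v| → |ξ| ^ s₀ ≤ 2 ^ s₀ * wt s₀ v := fun v hv => by
    calc |ξ| ^ s₀ ≤ (2 * |v|) ^ s₀ := by gcongr
      _ = 2 ^ s₀ * |v| ^ s₀ := Real.mul_rpow (by norm_num) (abs_nonneg _)
      _ ≤ _ := by gcongr; exact abs_rpow_le_wt' hs₀ v
  -- The exponents on the right add up to `2α - 1 + 2(1 - α)s₀`, which is at least `a`.
  have hexp : |ξ| ^ a ≤ |ξ| ^ ((2 * α - 2) * (1 - s₀)) * |ξ| ^ (-(2 * s₀ - 1)) *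
      (|ξ| ^ s₀ * |ξ| ^ s₀) := by
    rw [← Real.rpow_add hξ0, ← Real.rpow_add hξ0, ← Real.rpow_add hξ0]
    refine Real.rpow_le_rpow_of_exponent_le hξ ?_
    nlinarith [mul_nonneg (by linarith : 0 ≤ 1 - α) hs₀]
  set A := |ξ - x| ^ (1 - s₀) with hAdef
  set B := |x - y| ^ (1 - s₀) with hBdef
  have hA0 : 0 < A := by positivity
  have hB0 : 0 < B := by positivity
  rw [Real.rpow_neg hA'.le, Real.rpow_neg hB'.le, ← hAdef, ← hBdef]
  set E := |ξ| ^ ((2 * α - 2) * (1 - s₀)) with hE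
  set D := |ξ| ^ (-(2 * s₀ - 1)) with hD
  have hE0 : 0 < E := by positivity
  have hD0 : 0 < D := by positivity
  have hyz : |ξ| ^ s₀ * |ξ| ^ s₀ ≤ (2 ^ s₀ * wt s₀ y) * (2 ^ s₀ * wt s₀ (ξ - x + y)) :=
    mul_le_mul (low y hy) (low _ hz) (by positivity) (mul_nonneg (by positivity) (wt_nonneg _ _))
  set Y := (2 ^ s₀ * wt s₀ y) * (2 ^ s₀ * wt s₀ (ξ - x + y)) with hY
  have hY0 : 0 ≤ Y := le_trans (by positivity) hyz
  have hr2 : wt a ξ * ‖res α ξ x y‖ ≤ wt a 1 * κ⁻¹ * (D * A⁻¹ * B⁻¹) * Y := by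
    calc wt a ξ * ‖res α ξ x y‖ ≤ wt a 1 * (E * D * Y) * ‖res α ξ x y‖ := by
          gcongr
          refine (wt_le_abs_rpow ha hξ).trans (mul_le_mul_of_nonneg_left (hexp.trans ?_)
            (wt_nonneg _ _))
          gcongr
      _ = wt a 1 * κ⁻¹ * (D * A⁻¹ * B⁻¹) * Y * (‖res α ξ x y‖ * (κ * (A * B * E))) := by
          field_simp
      _ ≤ wt a 1 * κ⁻¹ * (D * A⁻¹ * B⁻¹) * Y * 1 :=
          mul_le_mul_of_nonneg_left hr
            (mul_nonneg (mul_nonneg (mul_nonneg (wt_nonneg _ _) (by positivity))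
              (by positivity)) hY0)
      _ = _ := mul_one _
  calc wt (s + a) ξ * ‖res α ξ x y‖ = wt s ξ * (wt a ξ * ‖res α ξ x y‖) := by
        rw [← wt_mul_wt]; ring
    _ ≤ (2 ^ s * wt s x) * (wt a 1 * κ⁻¹ * (D * A⁻¹ * B⁻¹) * Y) :=
        mul_le_mul (wt_le_of_abs_le hs (by norm_num) hx) hr2
          (mul_nonneg (wt_nonneg _ _) (norm_nonneg _))
          (mul_nonneg (by positivity) (wt_nonneg _ _))
    _ = _ := by rw [hY]; ring

end

noncomputable section

/-! ### Tame trilinear estimates -/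

/-- The squared weighted norm `‖⟨ξ⟩^r f‖²`. -/
def wnorm (r : ℝ) (f : ℝ → ℝ≥0∞) : ℝ≥0∞ := normSq fun x => ewt r x * f x

/-- The right-hand side of the tame trilinear estimates. -/
def tame (s s₀ : ℝ) (f g h : ℝ → ℝ≥0∞) : ℝ≥0∞ :=
  wnorm s f * wnorm s₀ g * wnorm s₀ h + wnorm s₀ f * wnorm s g * wnorm s₀ h +
    wnorm s₀ f * wnorm s₀ g * wnorm s h

theorem wnorm_mono {r r' : ℝ} (h : r ≤ r') (f : ℝ → ℝ≥0∞) : wnorm r f ≤ wnorm r' f :=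
  normSq_mono fun x => by gcongr; exact ewt_mono h x

theorem normSq_le_wnorm {r : ℝ} (h : 0 ≤ r) (f : ℝ → ℝ≥0∞) : normSq f ≤ wnorm r f := by
  simpa [wnorm] using wnorm_mono h f

theorem tame_mono {s s₀ s₁ : ℝ} (h : s₀ ≤ s₁) (f g k : ℝ → ℝ≥0∞) :
    tame s s₀ f g k ≤ tame s s₁ f g k := by
  unfold tame
  gcongr <;> exact wnorm_mono h _

/-- The singular kernel `|t|^{-θ}`. -/
def sing (θ t : ℝ) : ℝ≥0∞ := ENNReal.ofReal |t| ^ (-θ)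

theorem measurable_sing (θ : ℝ) : Measurable (sing θ) := by unfold sing; fun_prop

attribute [fun_prop] measurable_sing

theorem sing_of_ne_zero {θ t : ℝ} (ht : t ≠ 0) : sing θ t = ENNReal.ofReal (|t| ^ (-θ)) :=
  ENNReal.ofReal_rpow_of_pos (abs_pos.2 ht)

/-- With this value the domination of the multiplier holds trivially where a frequency difference
vanishes, so it can be stated pointwise everywhere. -/
theorem sing_zero {θ : ℝ} (hθ : 0 < θ) : sing θ 0 = ⊤ := by
  simp [sing, hθ]

theorem sing_le_one {θ t : ℝ} (hθ : 0 < θ) (ht : 1 ≤ |t|) : sing θ t ≤ 1 := by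
  rw [sing, ENNReal.rpow_neg]
  exact ENNReal.inv_le_one.2 (ENNReal.one_le_rpow (by simpa using ht) hθ)

theorem lintegral_sing_le {θ X : ℝ} (hθ : θ < 1) (hX : 0 ≤ X) :
    ∫⁻ t in Set.Ioo (-X) X, sing θ t ≤ ENNReal.ofReal (2 * (X ^ (1 - θ) / (1 - θ))) := by
  have hpos : ∫⁻ t in Set.Ioc 0 X, sing θ t = ENNReal.ofReal (X ^ (1 - θ) / (1 - θ)) := by
    have h1 : ∫⁻ t in Set.Ioc 0 X, sing θ t = ∫⁻ t in Set.Ioc 0 X, ENNReal.ofReal (t ^ (-θ)) := by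
      refine setLIntegral_congr_fun measurableSet_Ioc fun t ht => ?_
      rw [sing_of_ne_zero ht.1.ne', abs_of_pos ht.1]
    have h2 : IntegrableOn (fun t : ℝ => t ^ (-θ)) (Set.Ioc 0 X) :=
      (intervalIntegrable_iff_integrableOn_Ioc_of_le hX).1
        (intervalIntegral.intervalIntegrable_rpow' (by linarith))
    rw [h1, ← ofReal_integral_eq_lintegral_ofReal h2
      ((ae_restrict_iff' measurableSet_Ioc).2 (Eventually.of_forall fun t ht =>
        Real.rpow_nonneg ht.1.le _)), ← intervalIntegral.integral_of_le hX,
      integral_rpow (Or.inl (by linarith))]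
    congr 1
    rw [Real.zero_rpow (by linarith)]
    ring_nf
  have hneg : ∫⁻ t in Set.Ico (-X) 0, sing θ t = ENNReal.ofReal (X ^ (1 - θ) / (1 - θ)) := by
    rw [← hpos, ← lintegral_indicator measurableSet_Ico, ← lintegral_indicator measurableSet_Ioc,
      ← lintegral_neg_eq_self]
    refine lintegral_congr fun t => ?_
    have : -t ∈ Set.Ico (-X) 0 ↔ t ∈ Set.Ioc 0 X := by
      simp only [Set.mem_Ico, Set.mem_Ioc]
      constructor <;> rintro ⟨h1, h2⟩ <;> constructor <;> linarith
    by_cases ht : t ∈ Set.Ioc 0 X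
    · rw [Set.indicator_of_mem ht, Set.indicator_of_mem (this.2 ht), sing, sing, abs_neg]
    · rw [Set.indicator_of_notMem ht, Set.indicator_of_notMem (mt this.1 ht)]
  have hsub : Set.Ioo (-X) X ⊆ (Set.Ico (-X) 0 ∪ {0}) ∪ Set.Ioc 0 X := by
    intro t ht
    rcases lt_trichotomy t 0 with h | h | h
    · exact Or.inl (Or.inl ⟨ht.1.le, h⟩)
    · exact Or.inl (Or.inr h)
    · exact Or.inr ⟨h, ht.2.le⟩
  calc ∫⁻ t in Set.Ioo (-X) X, sing θ t
      ≤ ∫⁻ t in (Set.Ico (-X) 0 ∪ {0}) ∪ Set.Ioc 0 X, sing θ t := lintegral_mono_set hsub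
    _ ≤ (∫⁻ t in Set.Ico (-X) 0, sing θ t) + (∫⁻ t in {(0 : ℝ)}, sing θ t) +
        ∫⁻ t in Set.Ioc 0 X, sing θ t :=
        (lintegral_union_le _ _ _).trans (by gcongr; exact lintegral_union_le _ _ _)
    _ = _ := by
        rw [hpos, hneg, Measure.restrict_singleton]
        simp only [Real.volume_singleton, zero_smul, lintegral_zero_measure, add_zero]
        rw [← ENNReal.ofReal_add, two_mul] <;>
        exact div_nonneg (Real.rpow_nonneg hX _) (by linarith)

/-- Young's inequality for an integrable kernel and two `L²` functions. -/
theorem sq_lintegral_kernel_le {k f g : ℝ → ℝ≥0∞} (hk : Measurable k) (hf : Measurable f)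
    (hg : Measurable g) :
    (∫⁻ p : ℝ × ℝ, k (p.1 - p.2) * (f p.1 * g p.2)) ^ 2 ≤
      (∫⁻ t, k t) ^ 2 * (normSq f * normSq g) := by
  have h := sq_lintegral_mul_le ((volume : Measure (ℝ × ℝ)).withDensity fun p => k (p.1 - p.2))
    (f := fun p => f p.1) (g := fun p => g p.2) (by fun_prop) (by fun_prop)
  have hk2 : Measurable fun p : ℝ × ℝ => k (p.1 - p.2) := by fun_prop
  rw [lintegral_withDensity_eq_lintegral_mul _ hk2 (by fun_prop),
    lintegral_withDensity_eq_lintegral_mul _ hk2 (by fun_prop),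
    lintegral_withDensity_eq_lintegral_mul _ hk2 (by fun_prop)] at h
  simp only [Pi.mul_apply] at h
  have e1 : ∫⁻ p : ℝ × ℝ, k (p.1 - p.2) * f p.1 ^ 2 = (∫⁻ t, k t) * normSq f := by
    rw [Measure.volume_eq_prod, lintegral_prod _ (by fun_prop)]
    simp only
    have : ∀ x, ∫⁻ y, k (x - y) * f x ^ 2 = (∫⁻ t, k t) * f x ^ 2 := fun x => by
      rw [lintegral_mul_const _ (by fun_prop), lintegral_sub_left_eq_self k x]
    simp only [this]
    exact lintegral_const_mul _ (by fun_prop)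
  have e2 : ∫⁻ p : ℝ × ℝ, k (p.1 - p.2) * g p.2 ^ 2 = (∫⁻ t, k t) * normSq g := by
    rw [Measure.volume_eq_prod, lintegral_prod_symm _ (by fun_prop)]
    simp only
    have : ∀ y, ∫⁻ x, k (x - y) * g y ^ 2 = (∫⁻ t, k t) * g y ^ 2 := fun y => by
      rw [lintegral_mul_const _ (by fun_prop), lintegral_sub_right_eq_self k y]
    simp only [this]
    exact lintegral_const_mul _ (by fun_prop)
  rw [e1, e2] at h
  refine h.trans (le_of_eq (by ring))

theorem ennreal_add_sq_le (a b : ℝ≥0∞) : (a + b) ^ 2 ≤ 2 * (a ^ 2 + b ^ 2) := by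
  have := ENNReal.rpow_add_le_mul_rpow_add_rpow a b (p := 2) (by norm_num)
  simp only [ENNReal.rpow_ofNat] at this
  convert this using 2
  norm_num

theorem exists_sq_lintegral_mul_lintegral_le {s₀ : ℝ} (hs₀ : 1 / 2 < s₀) :
    ∃ C : ℝ≥0∞, C ≠ ⊤ ∧ ∀ f g : ℝ → ℝ≥0∞, Measurable f → Measurable g →
      ((∫⁻ x, f x) * ∫⁻ x, g x) ^ 2 ≤ C * (wnorm s₀ f * wnorm s₀ g) := by
  have hD := lintegral_ewt_lt_top (r := -2 * s₀) (by linarith)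
  refine ⟨(∫⁻ x, ewt (-2 * s₀) x) ^ 2, by finiteness, fun f g hf hg => ?_⟩
  rw [mul_pow]
  refine (mul_le_mul' (sq_lintegral_le_ewt (r := s₀) hf) (sq_lintegral_le_ewt (r := s₀) hg)).trans
    (le_of_eq ?_)
  unfold wnorm
  ring

/-- The part of the kernel on `(-1, 1)` is integrable because `θ < 1`, and Young's inequality
applies. Elsewhere the kernel is at most `1`, and both functions are integrable because `s₀ > 1/2`.
-/
theorem exists_sq_lintegral_sing_le {s₀ θ : ℝ} (hs₀ : 1 / 2 < s₀) (hθ : 0 < θ) (hθ' : θ < 1) :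
    ∃ C : ℝ≥0∞, C ≠ ⊤ ∧ ∀ f g : ℝ → ℝ≥0∞, Measurable f → Measurable g →
      (∫⁻ p : ℝ × ℝ, sing θ (p.1 - p.2) * (f p.1 * g p.2)) ^ 2 ≤
        C * (wnorm s₀ f * wnorm s₀ g) := by
  obtain ⟨C₁, hC₁, H₁⟩ := exists_sq_lintegral_mul_lintegral_le hs₀
  have hI := lintegral_sing_le hθ' zero_le_one
  set k : ℝ → ℝ≥0∞ := (Set.Ioo (-1) 1).indicator (sing θ) with hk
  have hkm : Measurable k := (measurable_sing θ).indicator measurableSet_Ioo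
  rw [← lintegral_indicator measurableSet_Ioo] at hI
  refine ⟨2 * ((∫⁻ t, k t) ^ 2 + C₁), ?_, fun f g hf hg => ?_⟩
  · have : ∫⁻ t, k t ≠ ⊤ := (hI.trans_lt ENNReal.ofReal_lt_top).ne
    finiteness
  · have h1 : ∫⁻ p : ℝ × ℝ, sing θ (p.1 - p.2) * (f p.1 * g p.2) ≤
        (∫⁻ p : ℝ × ℝ, k (p.1 - p.2) * (f p.1 * g p.2)) + (∫⁻ x, f x) * ∫⁻ x, g x := by
      rw [← lintegral_prod_mul' hf hg, ← lintegral_add_left (by fun_prop)]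
      refine lintegral_mono fun p => ?_
      by_cases ht : p.1 - p.2 ∈ Set.Ioo (-1 : ℝ) 1
      · rw [hk, Set.indicator_of_mem ht]
        exact le_self_add
      · have : sing θ (p.1 - p.2) ≤ 1 := by
          refine sing_le_one hθ ?_
          by_contra! hc
          exact ht (abs_lt.1 hc)
        exact (mul_le_mul_left this _).trans (by simp)
    calc _ ≤ ((∫⁻ p : ℝ × ℝ, k (p.1 - p.2) * (f p.1 * g p.2)) +
          (∫⁻ x, f x) * ∫⁻ x, g x) ^ 2 := by gcongr
      _ ≤ _ := ennreal_add_sq_le _ _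
      _ ≤ 2 * ((∫⁻ t, k t) ^ 2 * (wnorm s₀ f * wnorm s₀ g) +
          C₁ * (wnorm s₀ f * wnorm s₀ g)) := by
        gcongr
        · refine (sq_lintegral_kernel_le hkm hf hg).trans ?_
          gcongr <;> exact normSq_le_wnorm (by linarith) _
        · exact H₁ f g hf hg
      _ = _ := by ring

/-- The kernel used when all frequencies are comparable. -/
def resKernel (s₀ ξ x y : ℝ) : ℝ≥0∞ :=
  ENNReal.ofReal (|ξ| ^ (-(2 * s₀ - 1))) *
    ((if |ξ - x| < |ξ| then sing (1 - s₀) (ξ - x) else 0) *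
      (if |x - y| < |ξ| then sing (1 - s₀) (x - y) else 0))

theorem measurable_resKernel (s₀ : ℝ) :
    Measurable fun q : ℝ × ℝ × ℝ => resKernel s₀ q.1 q.2.1 q.2.2 := by
  unfold resKernel
  refine Measurable.mul (by fun_prop) (Measurable.mul ?_ ?_)
  · exact Measurable.ite (measurableSet_lt (by fun_prop) (by fun_prop)) (by fun_prop) (by fun_prop)
  · exact Measurable.ite (measurableSet_lt (by fun_prop) (by fun_prop)) (by fun_prop) (by fun_prop)

theorem sing_sq (θ t : ℝ) : sing θ t ^ 2 = sing (2 * θ) t := by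
  rw [sing, sing, ← ENNReal.rpow_natCast, ← ENNReal.rpow_mul]
  congr 1
  push_cast
  ring

/-- The squared singular factors are `|t|^{-2(1-s₀)}`, and each integrates over `|t| < |ξ|` to a
multiple of `|ξ|^{2s₀-1}`. The squared prefactor cancels both powers, which makes the bound uniform
in `ξ`. -/
theorem lintegral_resKernel_sq_le {s₀ : ℝ} (hs₀ : 1 / 2 < s₀) (ξ : ℝ) :
    ∫⁻ p : ℝ × ℝ, resKernel s₀ ξ p.1 p.2 ^ 2 ≤ ENNReal.ofReal ((2 / (2 * s₀ - 1)) ^ 2) := by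
  set X := |ξ| with hX
  set p := 2 * (1 - s₀) with hp
  set j : ℝ → ℝ≥0∞ := (Set.Ioo (-X) X).indicator (sing p) with hj
  have hjm : Measurable j := (measurable_sing p).indicator measurableSet_Ioo
  have hji : ∫⁻ t, j t ≤ ENNReal.ofReal (2 * (X ^ (2 * s₀ - 1) / (2 * s₀ - 1))) := by
    rw [hj, lintegral_indicator measurableSet_Ioo]
    have := lintegral_sing_le (θ := p) (X := X) (by linarith) (abs_nonneg _)
    rwa [show 1 - p = 2 * s₀ - 1 by rw [hp]; ring] at this
  have hsq : ∀ t : ℝ, (if |t| < X then sing (1 - s₀) t else 0) ^ 2 = j t := fun t => by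
    by_cases ht : |t| < X
    · rw [if_pos ht, hj, Set.indicator_of_mem (show t ∈ Set.Ioo (-X) X from abs_lt.1 ht), sing_sq]
    · rw [if_neg ht, hj, Set.indicator_of_notMem fun h : t ∈ Set.Ioo (-X) X => ht (abs_lt.2 h)]
      simp
  have e : ∫⁻ p : ℝ × ℝ, resKernel s₀ ξ p.1 p.2 ^ 2 =
      ENNReal.ofReal (X ^ (-(2 * s₀ - 1))) ^ 2 * ((∫⁻ t, j t) * ∫⁻ t, j t) := by
    have : ∀ p : ℝ × ℝ, resKernel s₀ ξ p.1 p.2 ^ 2 =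
        ENNReal.ofReal (X ^ (-(2 * s₀ - 1))) ^ 2 * (j (ξ - p.1) * j (p.1 - p.2)) := fun p => by
      rw [resKernel, mul_pow, mul_pow, hsq, hsq]
    simp only [this]
    rw [lintegral_const_mul _ (by fun_prop)]
    congr 1
    rw [Measure.volume_eq_prod, lintegral_prod _ (by fun_prop)]
    simp only
    have : ∀ x, ∫⁻ y, j (ξ - x) * j (x - y) = j (ξ - x) * ∫⁻ t, j t := fun x => by
      rw [lintegral_const_mul _ (by fun_prop), lintegral_sub_left_eq_self j x]
    simp only [this]
    rw [lintegral_mul_const _ (by fun_prop), lintegral_sub_left_eq_self j ξ]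
  rw [e]
  rcases eq_or_lt_of_le (abs_nonneg ξ : 0 ≤ |ξ|) with h0 | h0
  · have : ∫⁻ t, j t = 0 := by
      refine le_antisymm (hji.trans ?_) bot_le
      rw [hX, ← h0, Real.zero_rpow (by linarith)]
      simp
    simp [this]
  · calc _ ≤ ENNReal.ofReal (X ^ (-(2 * s₀ - 1))) ^ 2 *
          (ENNReal.ofReal (2 * (X ^ (2 * s₀ - 1) / (2 * s₀ - 1))) *
            ENNReal.ofReal (2 * (X ^ (2 * s₀ - 1) / (2 * s₀ - 1)))) := by gcongr
      _ = _ := by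
        have h1 : 0 ≤ 2 * (X ^ (2 * s₀ - 1) / (2 * s₀ - 1)) :=
          mul_nonneg zero_le_two (div_nonneg (by positivity) (by linarith))
        rw [← ENNReal.ofReal_pow (by positivity), ← ENNReal.ofReal_mul h1,
          ← ENNReal.ofReal_mul (by positivity)]
        congr 1
        rw [Real.rpow_neg h0.le]
        have : X ^ (2 * s₀ - 1) ≠ 0 := by positivity
        have : 2 * s₀ - 1 ≠ 0 := by linarith
        field_simp
        ring

/-- Pointwise domination of the smoothing multiplier. -/
theorem exists_ewt_mul_res_le {α s a s₀ θ : ℝ} (hα : 1 / 2 < α) (hα' : α ≤ 1) (hs : 0 ≤ s)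
    (hθ : 0 < θ) (hθ' : θ ≤ 1) (haθ : a = θ * (2 * α - 1)) (hs₀ : 0 ≤ s₀) (hs₀' : s₀ ≤ 1) :
    ∃ C : ℝ≥0∞, C ≠ ⊤ ∧ ∀ ξ x y, ewt (s + a) ξ * ‖res α ξ x y‖ₑ ≤
      C * (ewt s x + ewt s y + ewt s (ξ - x + y) + sing θ (ξ - x) * ewt s x +
        sing θ (x - y) * ewt s (ξ - x + y) +
        resKernel s₀ ξ x y * (ewt s x * ewt s₀ y * ewt s₀ (ξ - x + y))) := by
  have ha : 0 ≤ a := by rw [haθ]; exact mul_nonneg hθ.le (by linarith)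
  have ha' : a ≤ 2 * α - 1 := by rw [haθ]; nlinarith
  have hk : 0 < 2 * α * (2 * α - 1) := by nlinarith
  set c₁ := wt (s + a) 1
  set c₂ := 3 ^ s * wt a 1 * (2 * α * (2 * α - 1) / 24)⁻¹
  set c₃ := 2 ^ s * wt a 1 * ((2 * α * (2 * α - 1) / 6) ^ θ)⁻¹
  set c₄ := 2 ^ s * (2 ^ s₀) ^ 2 * wt a 1 * ((2 * α * (2 * α - 1) / 4) ^ (1 - s₀))⁻¹
  have h1 : 0 < c₁ := wt_pos _ _
  have h2 : 0 < c₂ := mul_pos (mul_pos (by positivity) (wt_pos _ _)) (by positivity)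
  have h3 : 0 < c₃ := mul_pos (mul_pos (by positivity) (wt_pos _ _)) (by positivity)
  have h4 : 0 < c₄ := mul_pos (mul_pos (by positivity) (wt_pos _ _)) (by positivity)
  refine ⟨ENNReal.ofReal (c₁ + c₂ + c₃ + c₄), ENNReal.ofReal_ne_top, fun ξ x y => ?_⟩
  have hC : ENNReal.ofReal (c₁ + c₂ + c₃ + c₄) ≠ 0 := by
    rw [Ne, ENNReal.ofReal_eq_zero]; linarith
  have ne0 : ∀ r v, ewt r v ≠ 0 := fun r v => by
    rw [Ne, ewt, ENNReal.ofReal_eq_zero]; linarith [wt_pos r v]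
  by_cases hA : ξ - x = 0
  · rw [hA, sing_zero hθ, ENNReal.top_mul (ne0 _ _)]
    simp [ENNReal.mul_top hC]
  by_cases hB : x - y = 0
  · rw [hB, sing_zero hθ, ENNReal.top_mul (ne0 _ _)]
    simp [ENNReal.mul_top hC]
  have conv : ∀ (c X : ℝ) (Z : ℝ≥0∞), c ≤ c₁ + c₂ + c₃ + c₄ → 0 ≤ c → ENNReal.ofReal X ≤ Z →
      wt (s + a) ξ * ‖res α ξ x y‖ ≤ c * X →
      ewt (s + a) ξ * ‖res α ξ x y‖ₑ ≤ ENNReal.ofReal (c₁ + c₂ + c₃ + c₄) * Z := by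
    intro c X Z hc hc0 hX hle
    rw [ewt, ← ofReal_norm, ← ENNReal.ofReal_mul (wt_nonneg _ _)]
    refine (ENNReal.ofReal_le_ofReal hle).trans ?_
    rw [ENNReal.ofReal_mul hc0]
    exact mul_le_mul' (ENNReal.ofReal_le_ofReal hc) hX
  have hlow : ENNReal.ofReal (wt s x + wt s y + wt s (ξ - x + y)) =
      ewt s x + ewt s y + ewt s (ξ - x + y) := by
    rw [ENNReal.ofReal_add (add_nonneg (wt_nonneg _ _) (wt_nonneg _ _)) (wt_nonneg _ _),
      ENNReal.ofReal_add (wt_nonneg _ _) (wt_nonneg _ _)]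
    rfl
  -- Low output frequencies need no gain, as the output weight is bounded there. For `|ξ| ≥ 1` the
  -- four cases compare each difference with `|ξ|/4`.
  rcases le_total |ξ| 1 with hξ | hξ
  · refine conv c₁ (wt s x + wt s y + wt s (ξ - x + y)) _ (by linarith) h1.le ?_ ?_
    · rw [hlow]
      exact le_trans (le_trans le_self_add le_self_add) le_self_add
    · have e1 : wt (s + a) ξ ≤ c₁ := by
        have := wt_le_of_abs_le (r := s + a) (c := 1) (ξ := ξ) (η := 1) (by linarith) le_rfl
          (by simpa using hξ)
        simpa using this
      have e2 : 1 ≤ wt s x + wt s y + wt s (ξ - x + y) := by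
        linarith [one_le_wt hs x, wt_nonneg s y, wt_nonneg s (ξ - x + y)]
      exact mul_le_mul e1 ((norm_res_le_one α ξ x y).trans e2) (norm_nonneg _) h1.le
  rcases lt_or_ge |ξ - x| (|ξ| / 4) with hx | hx <;> rcases lt_or_ge |x - y| (|ξ| / 4) with hy | hy
  · refine conv c₄ _ _ (by linarith) h4.le ?_
      (smoothing_bound_resonant hα hα' hs ha ha' hs₀ hs₀' hξ hx hy hA hB)
    refine le_trans (le_of_eq ?_) le_add_self
    rw [resKernel, if_pos (by linarith), if_pos (by linarith), sing_of_ne_zero hA,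
      sing_of_ne_zero hB, ENNReal.ofReal_mul (by positivity), ENNReal.ofReal_mul (by positivity),
      ENNReal.ofReal_mul (by positivity),
      ENNReal.ofReal_mul (mul_nonneg (wt_nonneg _ _) (wt_nonneg _ _)),
      ENNReal.ofReal_mul (wt_nonneg _ _)]
    simp only [ewt]
    ring
  · refine conv c₃ _ _ (by linarith) h3.le ?_
      (smoothing_bound_left hα hα' hs hθ.le hθ' haθ hξ hy hx hA)
    rw [ENNReal.ofReal_mul (by positivity), ← sing_of_ne_zero hA]
    exact le_trans (le_trans le_add_self le_self_add) le_self_add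
  · have e1 : ξ - (ξ - x + y) = x - y := by ring
    have e2 : ξ - x + y - y = ξ - x := by ring
    have := smoothing_bound_left hα hα' hs hθ.le hθ' haθ (ξ := ξ) (x := ξ - x + y) (y := y) hξ
      (by rwa [e2]) (by rwa [e1]) (by rwa [e1])
    rw [e1, res_swap] at this
    refine conv c₃ _ _ (by linarith) h3.le ?_ this
    rw [ENNReal.ofReal_mul (by positivity), ← sing_of_ne_zero hB]
    exact le_trans le_add_self le_self_add
  · refine conv c₂ _ _ (by linarith) h2.le ?_
      (smoothing_bound_nonresonant hα hα' hs ha ha' hξ hy hx)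
    rw [hlow]
    exact le_trans (le_trans le_self_add le_self_add) le_self_add

/-- The factor with the weight `s` is kept in `L²`; the other two are put in `L¹`, which `H^{s₀}`
controls on the Fourier side. -/
theorem exists_normSq_posTri_ewt_one_le {s s₀ : ℝ} (hs₀ : 1 / 2 < s₀) :
    ∃ C : ℝ≥0∞, C ≠ ⊤ ∧ ∀ f g h : ℝ → ℝ≥0∞, Measurable f → Measurable g → Measurable h →
      normSq (posTri (fun _ _ _ => 1) (fun x => ewt s x * f x) g h) +
      normSq (posTri (fun _ _ _ => 1) f (fun x => ewt s x * g x) h) +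
      normSq (posTri (fun _ _ _ => 1) f g (fun x => ewt s x * h x)) ≤ C * tame s s₀ f g h := by
  obtain ⟨C, hC, H⟩ := exists_sq_lintegral_mul_lintegral_le hs₀
  refine ⟨C, hC, fun f g h hf hg hh => ?_⟩
  calc _ ≤ C * (wnorm s₀ h * wnorm s₀ g) * wnorm s f + C * (wnorm s₀ f * wnorm s₀ h) * wnorm s g +
        C * (wnorm s₀ f * wnorm s₀ g) * wnorm s h := by
        refine add_le_add (add_le_add ?_ ?_) ?_
        · refine (normSq_posTri_one_left_le (by fun_prop) hg hh).trans ?_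
          exact mul_le_mul' (H h g hh hg) le_rfl
        · refine (normSq_posTri_one_middle_le hf (by fun_prop) hh).trans ?_
          exact mul_le_mul' (H f h hf hh) le_rfl
        · refine (normSq_posTri_one_right_le hf hg (by fun_prop)).trans ?_
          exact mul_le_mul' (H f g hf hg) le_rfl
    _ = _ := by unfold tame; ring

/-- The algebra property of `H^s`, in tame form. -/
theorem exists_algebra_estimate {s s₀ : ℝ} (hs : 0 ≤ s) (hs₀ : 1 / 2 < s₀) :
    ∃ C : ℝ≥0∞, C ≠ ⊤ ∧ ∀ f g h : ℝ → ℝ≥0∞, Measurable f → Measurable g → Measurable h →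
      normSq (posTri (fun ξ _ _ => ewt s ξ) f g h) ≤ C * tame s s₀ f g h := by
  obtain ⟨C, hC, H⟩ := exists_normSq_posTri_ewt_one_le (s := s) hs₀
  refine ⟨ENNReal.ofReal (3 ^ s) ^ 2 * (4 * C), by finiteness, fun f g h hf hg hh => ?_⟩
  set T₁ := posTri (fun _ _ _ => 1) (fun x => ewt s x * f x) g h with hT₁
  set T₂ := posTri (fun _ _ _ => 1) f (fun x => ewt s x * g x) h with hT₂
  set T₃ := posTri (fun _ _ _ => 1) f g (fun x => ewt s x * h x) with hT₃
  have m₁ : Measurable T₁ := measurable_posTri (by fun_prop) (by fun_prop) hg hh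
  have m₂ : Measurable T₂ := measurable_posTri (by fun_prop) hf (by fun_prop) hh
  have m₃ : Measurable T₃ := measurable_posTri (by fun_prop) hf hg (by fun_prop)
  have hle : ∀ ξ, posTri (fun ξ _ _ => ewt s ξ) f g h ξ ≤
      ENNReal.ofReal (3 ^ s) * (T₁ ξ + T₂ ξ + T₃ ξ) := by
    intro ξ
    have e : T₁ ξ + T₂ ξ + T₃ ξ = ∫⁻ p : ℝ × ℝ,
        (ewt s p.1 + ewt s p.2 + ewt s (ξ - p.1 + p.2)) *
          (f p.1 * g p.2 * h (ξ - p.1 + p.2)) := by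
      simp only [hT₁, hT₂, hT₃, posTri]
      rw [← lintegral_add_left (by fun_prop), ← lintegral_add_left (by fun_prop)]
      exact lintegral_congr fun p => by ring
    rw [e, ← lintegral_const_mul _ (by fun_prop)]
    refine lintegral_mono fun p => ?_
    rw [← mul_assoc (ENNReal.ofReal _)]
    refine mul_le_mul' ?_ le_rfl
    simp only [ewt]
    rw [← ENNReal.ofReal_add (wt_nonneg _ _) (wt_nonneg _ _),
      ← ENNReal.ofReal_add (add_nonneg (wt_nonneg _ _) (wt_nonneg _ _)) (wt_nonneg _ _),
      ← ENNReal.ofReal_mul (by positivity)]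
    exact ENNReal.ofReal_le_ofReal (wt_le_sum hs ξ p.1 p.2)
  calc normSq (posTri (fun ξ _ _ => ewt s ξ) f g h)
      ≤ normSq fun ξ => ENNReal.ofReal (3 ^ s) * (T₁ ξ + T₂ ξ + T₃ ξ) := normSq_mono hle
    _ = ENNReal.ofReal (3 ^ s) ^ 2 * normSq fun ξ => T₁ ξ + T₂ ξ + T₃ ξ :=
        normSq_const_mul _ (by fun_prop)
    _ ≤ ENNReal.ofReal (3 ^ s) ^ 2 * (4 * (normSq T₁ + normSq T₂ + normSq T₃)) := by
        gcongr
        refine (normSq_add_le (by fun_prop)).trans ?_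
        calc _ ≤ 2 * (2 * (normSq T₁ + normSq T₂) + normSq T₃) := by
              gcongr; exact normSq_add_le m₁
          _ ≤ 2 * (2 * (normSq T₁ + normSq T₂) + 2 * normSq T₃) := by
              gcongr; exact le_mul_of_one_le_left' one_le_two
          _ = _ := by ring
    _ ≤ ENNReal.ofReal (3 ^ s) ^ 2 * (4 * (C * tame s s₀ f g h)) := by
        gcongr; exact H f g h hf hg hh
    _ = _ := by ring

/-- With `θ = a/(2α - 1)` the multiplier is dominated by six kernels: three constant ones, two
singular ones handled by Young's inequality, and the one for comparable frequencies handled by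
Cauchy-Schwarz. The strict inequality `a < 2α - 1` gives `θ < 1`, hence local integrability. -/
theorem exists_smoothing_estimate_aux {α s a s₀ : ℝ} (hα : 1 / 2 < α) (hα' : α ≤ 1) (hs : 0 ≤ s)
    (ha : 0 < a) (ha' : a < 2 * α - 1) (hs₀ : 1 / 2 < s₀) (hs₀' : s₀ ≤ 1) :
    ∃ C : ℝ≥0∞, C ≠ ⊤ ∧ ∀ f g h : ℝ → ℝ≥0∞, Measurable f → Measurable g → Measurable h →
      normSq (posTri (fun ξ x y => ewt (s + a) ξ * ‖res α ξ x y‖ₑ) f g h) ≤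
        C * tame s s₀ f g h := by
  set θ := a / (2 * α - 1) with hθdef
  have hθ : 0 < θ := div_pos ha (by linarith)
  have hθ' : θ < 1 := (div_lt_one (by linarith)).2 ha'
  have haθ : a = θ * (2 * α - 1) := by rw [hθdef, div_mul_cancel₀ _ (by linarith)]
  obtain ⟨C, hC, H⟩ := exists_ewt_mul_res_le hα hα' hs hθ hθ'.le haθ (by linarith) hs₀'
  obtain ⟨C₁, hC₁, H₁⟩ := exists_normSq_posTri_ewt_one_le (s := s) hs₀
  obtain ⟨C₂, hC₂, H₂⟩ := exists_sq_lintegral_sing_le hs₀ hθ hθ'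
  set C₃ := ENNReal.ofReal ((2 / (2 * s₀ - 1)) ^ 2) with hC₃
  refine ⟨C ^ 2 * (32 * (C₁ + C₂ + C₃)), by finiteness, fun f g h hf hg hh => ?_⟩
  set T₁ := posTri (fun _ _ _ => 1) (fun x => ewt s x * f x) g h with hT₁
  set T₂ := posTri (fun _ _ _ => 1) f (fun x => ewt s x * g x) h with hT₂
  set T₃ := posTri (fun _ _ _ => 1) f g (fun x => ewt s x * h x) with hT₃
  set T₄ := posTri (fun ξ x _ => sing θ (ξ - x)) (fun x => ewt s x * f x) g h with hT₄
  set T₅ := posTri (fun _ x y => sing θ (x - y)) f g (fun x => ewt s x * h x) with hT₅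
  set T₆ := posTri (resKernel s₀) (fun x => ewt s x * f x) (fun x => ewt s₀ x * g x)
    (fun x => ewt s₀ x * h x) with hT₆
  have m₁ : Measurable T₁ := measurable_posTri (by fun_prop) (by fun_prop) hg hh
  have m₂ : Measurable T₂ := measurable_posTri (by fun_prop) hf (by fun_prop) hh
  have m₃ : Measurable T₃ := measurable_posTri (by fun_prop) hf hg (by fun_prop)
  have m₄ : Measurable T₄ := measurable_posTri (by fun_prop) (by fun_prop) hg hh
  have m₅ : Measurable T₅ := measurable_posTri (by fun_prop) hf hg (by fun_prop)
  have m₆ : Measurable T₆ := measurable_posTri (measurable_resKernel s₀) (by fun_prop)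
    (by fun_prop) (by fun_prop)
  have hle : ∀ ξ, posTri (fun ξ x y => ewt (s + a) ξ * ‖res α ξ x y‖ₑ) f g h ξ ≤
      C * (T₁ ξ + T₂ ξ + T₃ ξ + T₄ ξ + T₅ ξ + T₆ ξ) := by
    intro ξ
    have mk : Measurable fun p : ℝ × ℝ => resKernel s₀ ξ p.1 p.2 :=
      (measurable_resKernel s₀).comp (measurable_prodMk_left (x := ξ))
    have e : T₁ ξ + T₂ ξ + T₃ ξ + T₄ ξ + T₅ ξ + T₆ ξ = ∫⁻ p : ℝ × ℝ,
        (ewt s p.1 + ewt s p.2 + ewt s (ξ - p.1 + p.2) + sing θ (ξ - p.1) * ewt s p.1 +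
        sing θ (p.1 - p.2) * ewt s (ξ - p.1 + p.2) +
        resKernel s₀ ξ p.1 p.2 * (ewt s p.1 * ewt s₀ p.2 * ewt s₀ (ξ - p.1 + p.2))) *
          (f p.1 * g p.2 * h (ξ - p.1 + p.2)) := by
      simp only [hT₁, hT₂, hT₃, hT₄, hT₅, hT₆, posTri]
      rw [← lintegral_add_left (by fun_prop), ← lintegral_add_left (by fun_prop),
        ← lintegral_add_left (by fun_prop), ← lintegral_add_left (by fun_prop),
        ← lintegral_add_left (by fun_prop)]
      exact lintegral_congr fun p => by ring
    rw [e, ← lintegral_const_mul _ (by fun_prop)]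
    refine lintegral_mono fun p => ?_
    rw [← mul_assoc C]
    exact mul_le_mul' (H ξ p.1 p.2) le_rfl
  have B₄ : normSq T₄ ≤ C₂ * tame s s₀ f g h := by
    refine (normSq_posTri_kernel_left_le (measurable_sing θ) (by fun_prop) hg hh).trans ?_
    calc _ ≤ C₂ * (wnorm s₀ h * wnorm s₀ g) * wnorm s f := mul_le_mul' (H₂ h g hh hg) le_rfl
      _ = C₂ * (wnorm s f * wnorm s₀ g * wnorm s₀ h) := by ring
      _ ≤ _ := by
        gcongr
        exact le_trans le_self_add le_self_add
  have B₅ : normSq T₅ ≤ C₂ * tame s s₀ f g h := by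
    refine (normSq_posTri_kernel_right_le (measurable_sing θ) hf hg (by fun_prop)).trans ?_
    calc _ ≤ C₂ * (wnorm s₀ f * wnorm s₀ g) * wnorm s h := mul_le_mul' (H₂ f g hf hg) le_rfl
      _ = C₂ * (wnorm s₀ f * wnorm s₀ g * wnorm s h) := by ring
      _ ≤ _ := by
        gcongr
        exact le_add_self
  have B₆ : normSq T₆ ≤ C₃ * tame s s₀ f g h := by
    refine (normSq_posTri_le_of_kernel_sq (measurable_resKernel s₀) (by fun_prop) (by fun_prop)
      (by fun_prop) (lintegral_resKernel_sq_le hs₀)).trans ?_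
    gcongr
    exact le_trans le_self_add le_self_add
  have add_le : ∀ F G : ℝ → ℝ≥0∞, Measurable F → normSq (fun x => F x + G x) ≤
      2 * normSq F + 2 * normSq G := fun F G hF =>
    (normSq_add_le hF).trans (le_of_eq (mul_add _ _ _))
  have up : ∀ x : ℝ≥0∞, x ≤ 2 * x := fun x => le_mul_of_one_le_left' one_le_two
  calc _ ≤ normSq fun ξ => C * (T₁ ξ + T₂ ξ + T₃ ξ + T₄ ξ + T₅ ξ + T₆ ξ) := normSq_mono hle
    _ = C ^ 2 * normSq fun ξ => T₁ ξ + T₂ ξ + T₃ ξ + T₄ ξ + T₅ ξ + T₆ ξ :=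
        normSq_const_mul _ (by fun_prop)
    _ ≤ C ^ 2 * (2 * (2 * (2 * (2 * (2 * normSq T₁ + 2 * normSq T₂) + 2 * normSq T₃) +
          2 * normSq T₄) + 2 * normSq T₅) + 2 * normSq T₆) := by
        gcongr
        refine (add_le _ _ (by fun_prop)).trans ?_
        gcongr
        refine (add_le _ _ (by fun_prop)).trans ?_
        gcongr
        refine (add_le _ _ (by fun_prop)).trans ?_
        gcongr
        refine (add_le _ _ (by fun_prop)).trans ?_
        gcongr
        exact add_le _ _ (by fun_prop)
    _ = C ^ 2 * (32 * (normSq T₁ + normSq T₂) + 16 * normSq T₃ + 8 * normSq T₄ +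
          4 * normSq T₅ + 2 * normSq T₆) := by ring
    _ ≤ C ^ 2 * (32 * (normSq T₁ + normSq T₂) + 32 * normSq T₃ + 16 * normSq T₄ +
          16 * normSq T₅ + 32 * normSq T₆) := by
        gcongr <;> norm_num
    _ = C ^ 2 * (32 * (normSq T₁ + normSq T₂ + normSq T₃) + 16 * (normSq T₄ +
          normSq T₅) + 32 * normSq T₆) := by ring
    _ ≤ C ^ 2 * (32 * (C₁ * tame s s₀ f g h) + 16 * (C₂ * tame s s₀ f g h +
          C₂ * tame s s₀ f g h) + 32 * (C₃ * tame s s₀ f g h)) := by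
        gcongr; exact H₁ f g h hf hg hh
    _ = _ := by ring

/-- The smoothing estimate: the multiplier `(1 + iΦ)⁻¹` gains `a < 2α - 1` derivatives. -/
theorem exists_smoothing_estimate {α s a s₀ : ℝ} (hα : 1 / 2 < α) (hα' : α ≤ 1) (hs : 0 ≤ s)
    (ha : 0 < a) (ha' : a < 2 * α - 1) (hs₀ : 1 / 2 < s₀) :
    ∃ C : ℝ≥0∞, C ≠ ⊤ ∧ ∀ f g h : ℝ → ℝ≥0∞, Measurable f → Measurable g → Measurable h →
      normSq (posTri (fun ξ x y => ewt (s + a) ξ * ‖res α ξ x y‖ₑ) f g h) ≤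
        C * tame s s₀ f g h := by
  -- The condition `s₀ ≤ 1` only served to make the exponent `1 - s₀` nonnegative; a larger `s₀`
  -- weakens the claim.
  obtain ⟨C, hC, H⟩ := exists_smoothing_estimate_aux (s₀ := min s₀ 1) hα hα' hs ha ha'
    (lt_min hs₀ (by norm_num)) (min_le_right _ _)
  refine ⟨C, hC, fun f g h hf hg hh => (H f g h hf hg hh).trans ?_⟩
  gcongr
  exact tame_mono (min_le_left _ _) f g h

end

noncomputable section

/-! ### Multiplication operators on `L²` -/

theorem measurable_coe (F : L2) : Measurable (F : ℝ → ℂ) := (Lp.stronglyMeasurable F).measurable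

attribute [fun_prop] measurable_coe

theorem normSq_enorm_eq_eLpNorm (f : ℝ → ℂ) :
    normSq (fun ξ => ‖f ξ‖ₑ) = eLpNorm f 2 volume ^ 2 := by
  rw [eLpNorm_eq_lintegral_rpow_enorm_toReal (by norm_num) (by norm_num), ← ENNReal.rpow_natCast,
    ← ENNReal.rpow_mul]
  simp [normSq]

theorem normSq_enorm (F : L2) : normSq (fun ξ => ‖F ξ‖ₑ) = ‖F‖ₑ ^ 2 := by
  rw [normSq_enorm_eq_eLpNorm, Lp.enorm_def]

theorem memLp_two_of_normSq_lt_top {f : ℝ → ℂ} (hf : AEStronglyMeasurable f)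
    (h : normSq (fun ξ => ‖f ξ‖ₑ) < ⊤) : MemLp f 2 := by
  refine ⟨hf, ?_⟩
  rw [normSq_enorm_eq_eLpNorm] at h
  by_contra hc
  rw [not_lt_top_iff] at hc
  simp [hc] at h

theorem enorm_sq_toLp {f : ℝ → ℂ} (hf : MemLp f 2) :
    ‖hf.toLp f‖ₑ ^ 2 = normSq (fun ξ => ‖f ξ‖ₑ) := by
  rw [normSq_enorm_eq_eLpNorm, Lp.enorm_toLp]

theorem norm_le_of_enorm_sq_le {E : Type*} [NormedAddCommGroup E] {F : E} {C : ℝ}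
    (hC : 0 ≤ C) (h : ‖F‖ₑ ^ 2 ≤ ENNReal.ofReal (C ^ 2)) : ‖F‖ ≤ C := by
  rw [← ofReal_norm, ← ENNReal.ofReal_pow (norm_nonneg _),
    ENNReal.ofReal_le_ofReal_iff (sq_nonneg C)] at h
  exact (sq_le_sq₀ (norm_nonneg _) hC).1 h

/-- A measurable multiplier of modulus at most one. -/
structure IsContr (m : ℝ → ℂ) : Prop where
  measurable : Measurable m
  norm_le : ∀ ξ, ‖m ξ‖ ≤ 1

theorem IsContr.mul {m n : ℝ → ℂ} (hm : IsContr m) (hn : IsContr n) :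
    IsContr fun ξ => m ξ * n ξ :=
  ⟨hm.measurable.mul hn.measurable, fun ξ => by
    rw [norm_mul]
    exact mul_le_one₀ (hm.norm_le ξ) (norm_nonneg _) (hn.norm_le ξ)⟩

theorem IsContr.memLp {m : ℝ → ℂ} (hm : IsContr m) (F : L2) :
    MemLp (fun ξ => m ξ * F ξ) 2 volume :=
  (Lp.memLp F).of_le (hm.measurable.aestronglyMeasurable.mul (Lp.memLp F).1)
    (Eventually.of_forall fun ξ => by
      rw [norm_mul]
      exact mul_le_of_le_one_left (norm_nonneg _) (hm.norm_le ξ))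

open Classical in
/-- Multiplication of an `L²` function by `m`, and `0` if the product is not in `L²`. -/
def pmul (m : ℝ → ℂ) (F : L2) : L2 :=
  if h : MemLp (fun ξ => m ξ * F ξ) 2 volume then h.toLp _ else 0

theorem pmul_eq_toLp {m : ℝ → ℂ} {F : L2} (h : MemLp (fun ξ => m ξ * F ξ) 2 volume) :
    pmul m F = h.toLp _ := dif_pos h

theorem coeFn_pmul {m : ℝ → ℂ} {F : L2} (h : MemLp (fun ξ => m ξ * F ξ) 2 volume) :
    pmul m F =ᵐ[volume] fun ξ => m ξ * F ξ := by
  rw [pmul_eq_toLp h]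
  exact h.coeFn_toLp

theorem IsContr.coeFn {m : ℝ → ℂ} (hm : IsContr m) (F : L2) :
    pmul m F =ᵐ[volume] fun ξ => m ξ * F ξ := coeFn_pmul (hm.memLp F)

theorem pmul_pmul {m n : ℝ → ℂ} {F : L2} (hn : MemLp (fun ξ => n ξ * F ξ) 2 volume)
    (hmn : MemLp (fun ξ => m ξ * n ξ * F ξ) 2 volume) :
    pmul m (pmul n F) = pmul (fun ξ => m ξ * n ξ) F := by
  have e : (fun ξ => m ξ * (pmul n F) ξ) =ᵐ[volume] fun ξ => m ξ * n ξ * F ξ := by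
    filter_upwards [coeFn_pmul hn] with ξ hξ
    rw [hξ, mul_assoc]
  have h2 : MemLp (fun ξ => m ξ * (pmul n F) ξ) 2 volume := hmn.ae_eq e.symm
  refine Lp.ext ?_
  filter_upwards [coeFn_pmul h2, coeFn_pmul hmn, e] with ξ h3 h4 h5
  rw [h3, h4, h5]

theorem IsContr.pmul_pmul {m n : ℝ → ℂ} (hm : IsContr m) (hn : IsContr n) (F : L2) :
    pmul m (pmul n F) = pmul (fun ξ => m ξ * n ξ) F :=
  FractionalNLS.pmul_pmul (hn.memLp F) ((hm.mul hn).memLp F)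

theorem pmul_eq_self {m : ℝ → ℂ} (hm : ∀ ξ, m ξ = 1) (F : L2) : pmul m F = F := by
  have hc : IsContr m := ⟨by simp only [funext hm, measurable_const], fun ξ => by simp [hm]⟩
  refine Lp.ext ?_
  filter_upwards [hc.coeFn F] with ξ h
  rw [h, hm, one_mul]

theorem IsContr.pmul_injective {m : ℝ → ℂ} (hm : IsContr m) (h0 : ∀ ξ, m ξ ≠ 0) :
    Function.Injective (pmul m) := by
  intro F G h
  refine Lp.ext ?_
  filter_upwards [hm.coeFn F, hm.coeFn G] with ξ h1 h2
  rw [h] at h1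
  exact mul_left_cancel₀ (h0 ξ) (h1.symm.trans h2)

theorem IsContr.pmul_add {m : ℝ → ℂ} (hm : IsContr m) (F G : L2) :
    pmul m (F + G) = pmul m F + pmul m G := by
  refine Lp.ext ?_
  filter_upwards [hm.coeFn (F + G), hm.coeFn F, hm.coeFn G, Lp.coeFn_add F G,
    Lp.coeFn_add (pmul m F) (pmul m G)] with ξ h1 h2 h3 h4 h5
  rw [h1, h4, h5, Pi.add_apply, Pi.add_apply, h2, h3, mul_add]

theorem IsContr.pmul_smul {m : ℝ → ℂ} (hm : IsContr m) (c : ℂ) (F : L2) :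
    pmul m (c • F) = c • pmul m F := by
  refine Lp.ext ?_
  filter_upwards [hm.coeFn (c • F), hm.coeFn F, Lp.coeFn_smul c F,
    Lp.coeFn_smul c (pmul m F)] with ξ h1 h2 h3 h4
  rw [h1, h3, h4, Pi.smul_apply, Pi.smul_apply, h2, smul_eq_mul, smul_eq_mul]
  ring

theorem IsContr.norm_pmul_le {m : ℝ → ℂ} (hm : IsContr m) (F : L2) : ‖pmul m F‖ ≤ ‖F‖ :=
  Lp.norm_le_norm_of_ae_le (by
    filter_upwards [hm.coeFn F] with ξ h
    rw [h, norm_mul]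
    exact mul_le_of_le_one_left (norm_nonneg _) (hm.norm_le ξ))

theorem norm_pmul_eq {m : ℝ → ℂ} (hm : Measurable m) (h1 : ∀ ξ, ‖m ξ‖ = 1) (F : L2) :
    ‖pmul m F‖ = ‖F‖ := by
  have hc : IsContr m := ⟨hm, fun ξ => (h1 ξ).le⟩
  refine le_antisymm (hc.norm_pmul_le F) (Lp.norm_le_norm_of_ae_le ?_)
  filter_upwards [hc.coeFn F] with ξ h
  rw [h, norm_mul, h1, one_mul]

/-- Multiplication by a contractive multiplier as a bounded operator. -/
def mulCLM (m : ℝ → ℂ) (hm : IsContr m) : L2 →L[ℂ] L2 :=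
  LinearMap.mkContinuous ⟨⟨pmul m, hm.pmul_add⟩, hm.pmul_smul⟩ 1
    fun F => by simpa using hm.norm_pmul_le F

@[simp]
theorem mulCLM_apply {m : ℝ → ℂ} (hm : IsContr m) (F : L2) : mulCLM m hm F = pmul m F := rfl

theorem IsContr.pmul_sub {m : ℝ → ℂ} (hm : IsContr m) (F G : L2) :
    pmul m (F - G) = pmul m F - pmul m G := (mulCLM m hm).map_sub F G

theorem IsContr.continuous {m : ℝ → ℂ} (hm : IsContr m) : Continuous (pmul m) :=
  (mulCLM m hm).continuous

theorem pmul_sub_mult {m n : ℝ → ℂ} (hm : IsContr m) (hn : IsContr n) (F : L2) :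
    ‖pmul m F - pmul n F‖ₑ ^ 2 = ∫⁻ ξ, (‖m ξ - n ξ‖ₑ * ‖F ξ‖ₑ) ^ 2 := by
  rw [← normSq_enorm]
  refine lintegral_congr_ae ?_
  filter_upwards [hm.coeFn F, hn.coeFn F, Lp.coeFn_sub (pmul m F) (pmul n F)] with ξ h1 h2 h3
  rw [h3, Pi.sub_apply, h1, h2, ← sub_mul, enorm_mul]

theorem tendsto_of_enorm_sq {ι E : Type*} [NormedAddCommGroup E] {l : Filter ι} {F : ι → E} {F₀ : E}
    (h : Tendsto (fun i => ‖F i - F₀‖ₑ ^ 2) l (𝓝 0)) : Tendsto F l (𝓝 F₀) := by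
  rw [tendsto_iff_norm_sub_tendsto_zero]
  have h2 := ((ENNReal.continuous_rpow_const (y := (1 / 2 : ℝ))).tendsto 0).comp h
  have h3 : Tendsto (fun i => ‖F i - F₀‖ₑ) l (𝓝 0) := by
    simp only [Function.comp_def, one_div] at h2
    rw [ENNReal.zero_rpow_of_pos (by norm_num)] at h2
    refine h2.congr fun i => ?_
    rw [← ENNReal.rpow_natCast, ← ENNReal.rpow_mul]
    norm_num
  have h4 := (ENNReal.tendsto_toReal ENNReal.zero_ne_top).comp h3
  simpa [Function.comp_def] using h4

theorem enorm_sub_le_two {z w : ℂ} (hz : ‖z‖ ≤ 1) (hw : ‖w‖ ≤ 1) : ‖z - w‖ₑ ≤ 2 := by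
  rw [← ofReal_norm]
  refine ENNReal.ofReal_le_of_le_toReal ?_
  simpa using (norm_sub_le z w).trans (by linarith)

/-- Dominated convergence with majorant `4|F|²`. Convergence is strong only, since `e^{itω}` is not
norm continuous in `t`. -/
theorem tendsto_pmul_mult {ι : Type*} {l : Filter ι} [l.IsCountablyGenerated] {m : ι → ℝ → ℂ}
    {m₀ : ℝ → ℂ} (hm : ∀ i, IsContr (m i)) (hm₀ : IsContr m₀)
    (h : ∀ ξ, Tendsto (fun i => m i ξ) l (𝓝 (m₀ ξ))) (F : L2) :
    Tendsto (fun i => pmul (m i) F) l (𝓝 (pmul m₀ F)) := by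
  refine tendsto_of_enorm_sq ?_
  simp only [pmul_sub_mult (hm _) hm₀]
  have hF : ∫⁻ ξ, (2 * ‖F ξ‖ₑ) ^ 2 ≠ ⊤ := by
    have := normSq_const_mul 2 (f := fun ξ => ‖F ξ‖ₑ) (by fun_prop)
    rw [normSq_enorm] at this
    rw [show ∫⁻ ξ, (2 * ‖F ξ‖ₑ) ^ 2 = 2 ^ 2 * ‖F‖ₑ ^ 2 from this]
    finiteness
  rw [show (0 : ℝ≥0∞) = ∫⁻ _ : ℝ, 0 by simp]
  have mm := fun i => (hm i).measurable
  have mm₀ := hm₀.measurable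
  refine tendsto_lintegral_filter_of_dominated_convergence (fun ξ => (2 * ‖F ξ‖ₑ) ^ 2)
    (Eventually.of_forall fun i => by have := mm i; fun_prop) (Eventually.of_forall fun i =>
      Eventually.of_forall fun ξ => ?_) hF (Eventually.of_forall fun ξ => ?_)
  · gcongr
    exact enorm_sub_le_two ((hm i).norm_le ξ) (hm₀.norm_le ξ)
  · have h1 : Tendsto (fun i => ‖m i ξ - m₀ ξ‖ₑ) l (𝓝 0) := by
      have := ((h ξ).sub_const (m₀ ξ)).enorm
      simpa using this
    have h2 : Tendsto (fun i => (‖m i ξ - m₀ ξ‖ₑ * ‖F ξ‖ₑ) ^ 2) l (𝓝 ((0 * ‖F ξ‖ₑ) ^ 2)) :=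
      ((ENNReal.continuous_pow 2).tendsto _).comp (ENNReal.Tendsto.mul_const h1 (Or.inr (by simp)))
    simpa using h2

theorem tendsto_pmul {ι : Type*} {l : Filter ι} [l.IsCountablyGenerated] {m : ι → ℝ → ℂ}
    {m₀ : ℝ → ℂ} (hm : ∀ i, IsContr (m i)) (hm₀ : IsContr m₀)
    (h : ∀ ξ, Tendsto (fun i => m i ξ) l (𝓝 (m₀ ξ))) {F : ι → L2} {F₀ : L2}
    (hF : Tendsto F l (𝓝 F₀)) :
    Tendsto (fun i => pmul (m i) (F i)) l (𝓝 (pmul m₀ F₀)) := by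
  have h1 : Tendsto (fun i => pmul (m i) (F i) - pmul (m i) F₀) l (𝓝 0) := by
    refine squeeze_zero_norm (fun i => ?_) (tendsto_iff_norm_sub_tendsto_zero.1 hF)
    rw [← (hm i).pmul_sub]
    exact (hm i).norm_pmul_le _
  simpa using h1.add (tendsto_pmul_mult hm hm₀ h F₀)

/-! ### Trilinear operators on `L²` -/

/-- The trilinear form `∫ m(ξ, ξ₁, ξ₂) f(ξ₁) conj(g(ξ₂)) h(ξ - ξ₁ + ξ₂) dξ₁ dξ₂`. -/
def tri (m : ℝ → ℝ → ℝ → ℂ) (f g h : ℝ → ℂ) (ξ : ℝ) : ℂ :=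
  ∫ p : ℝ × ℝ, m ξ p.1 p.2 * (f p.1 * starRingEnd ℂ (g p.2) * h (ξ - p.1 + p.2))

/-- The positive kernel `M` defines a bounded trilinear form on `L²`. -/
structure IsBddKernel (M : ℝ → ℝ → ℝ → ℝ≥0∞) (C : ℝ) : Prop where
  measurable : Measurable fun q : ℝ × ℝ × ℝ => M q.1 q.2.1 q.2.2
  nonneg : 0 ≤ C
  bound : ∀ f g h : ℝ → ℝ≥0∞, Measurable f → Measurable g → Measurable h →
    normSq (posTri M f g h) ≤ ENNReal.ofReal (C ^ 2) * (normSq f * normSq g * normSq h)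

/-- The complex kernel `m` is measurable and dominated by `M`. -/
structure IsDom (M : ℝ → ℝ → ℝ → ℝ≥0∞) (m : ℝ → ℝ → ℝ → ℂ) : Prop where
  measurable : Measurable fun q : ℝ × ℝ × ℝ => m q.1 q.2.1 q.2.2
  enorm_le : ∀ ξ x y, ‖m ξ x y‖ₑ ≤ M ξ x y

open Classical in
/-- The trilinear form as an element of `L²`. -/
def triL (m : ℝ → ℝ → ℝ → ℂ) (F G H : L2) : L2 :=
  if h : MemLp (tri m F G H) 2 volume then h.toLp _ else 0

/-- The majorant of the trilinear form. -/
def maj (M : ℝ → ℝ → ℝ → ℝ≥0∞) (F G H : L2) : ℝ → ℝ≥0∞ :=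
  posTri M (fun ξ => ‖F ξ‖ₑ) (fun ξ => ‖G ξ‖ₑ) (fun ξ => ‖H ξ‖ₑ)

variable {M : ℝ → ℝ → ℝ → ℝ≥0∞} {C : ℝ} {m m' : ℝ → ℝ → ℝ → ℂ}

theorem IsBddKernel.normSq_maj_le (hM : IsBddKernel M C) (F G H : L2) :
    normSq (maj M F G H) ≤ ENNReal.ofReal ((C * ‖F‖ * ‖G‖ * ‖H‖) ^ 2) := by
  refine (hM.bound _ _ _ (by fun_prop) (by fun_prop) (by fun_prop)).trans (le_of_eq ?_)
  rw [normSq_enorm, normSq_enorm, normSq_enorm, ← ofReal_norm, ← ofReal_norm, ← ofReal_norm,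
    ← ENNReal.ofReal_pow (norm_nonneg _), ← ENNReal.ofReal_pow (norm_nonneg _),
    ← ENNReal.ofReal_pow (norm_nonneg _), ← ENNReal.ofReal_mul (by positivity),
    ← ENNReal.ofReal_mul (by positivity), ← ENNReal.ofReal_mul (by positivity)]
  congr 1
  ring

theorem IsBddKernel.measurable_maj (hM : IsBddKernel M C) (F G H : L2) :
    Measurable (maj M F G H) :=
  measurable_posTri hM.measurable (by fun_prop) (by fun_prop) (by fun_prop)

theorem IsBddKernel.ae_maj_lt_top (hM : IsBddKernel M C) (F G H : L2) :
    ∀ᵐ ξ, maj M F G H ξ < ⊤ := by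
  have h := ae_lt_top ((hM.measurable_maj F G H).pow_const 2)
    ((hM.normSq_maj_le F G H).trans_lt ENNReal.ofReal_lt_top).ne
  filter_upwards [h] with ξ hξ
  by_contra hc
  rw [not_lt_top_iff] at hc
  simp [hc] at hξ

theorem measurable_tri_integrand (hm : Measurable fun q : ℝ × ℝ × ℝ => m q.1 q.2.1 q.2.2)
    {f g h : ℝ → ℂ} (hf : Measurable f) (hg : Measurable g) (hh : Measurable h) :
    Measurable fun q : ℝ × ℝ × ℝ =>
      m q.1 q.2.1 q.2.2 * (f q.2.1 * starRingEnd ℂ (g q.2.2) * h (q.1 - q.2.1 + q.2.2)) := by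
  have : Measurable (starRingEnd ℂ) := Complex.continuous_conj.measurable
  fun_prop

theorem measurable_tri (hm : Measurable fun q : ℝ × ℝ × ℝ => m q.1 q.2.1 q.2.2)
    {f g h : ℝ → ℂ} (hf : Measurable f) (hg : Measurable g) (hh : Measurable h) :
    Measurable (tri m f g h) :=
  (measurable_tri_integrand hm hf hg hh).stronglyMeasurable.integral_prod_right'.measurable

theorem lintegral_enorm_tri_integrand (m : ℝ → ℝ → ℝ → ℂ) (F G H : L2) (ξ : ℝ) :
    ∫⁻ p : ℝ × ℝ, ‖m ξ p.1 p.2 * (F p.1 * starRingEnd ℂ (G p.2) * H (ξ - p.1 + p.2))‖ₑ =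
      maj (fun ξ x y => ‖m ξ x y‖ₑ) F G H ξ := by
  refine lintegral_congr fun p => ?_
  rw [enorm_mul, enorm_mul, enorm_mul, RCLike.enorm_conj]

theorem enorm_tri_le (m : ℝ → ℝ → ℝ → ℂ) (F G H : L2) (ξ : ℝ) :
    ‖tri m F G H ξ‖ₑ ≤ maj (fun ξ x y => ‖m ξ x y‖ₑ) F G H ξ :=
  (enorm_integral_le_lintegral_enorm _).trans (lintegral_enorm_tri_integrand m F G H ξ).le

theorem maj_mono {M M' : ℝ → ℝ → ℝ → ℝ≥0∞} (h : ∀ ξ x y, M ξ x y ≤ M' ξ x y) (F G H : L2)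
    (ξ : ℝ) : maj M F G H ξ ≤ maj M' F G H ξ :=
  posTri_mono fun x y => mul_le_mul' (h ξ x y) le_rfl

theorem IsBddKernel.ae_integrable (hM : IsBddKernel M C) (hm : IsDom M m) (F G H : L2) :
    ∀ᵐ ξ, Integrable fun p : ℝ × ℝ =>
      m ξ p.1 p.2 * (F p.1 * starRingEnd ℂ (G p.2) * H (ξ - p.1 + p.2)) := by
  filter_upwards [hM.ae_maj_lt_top F G H] with ξ hξ
  refine ⟨((measurable_tri_integrand hm.measurable (measurable_coe F) (measurable_coe G)
    (measurable_coe H)).comp (measurable_prodMk_left (x := ξ))).aestronglyMeasurable, ?_⟩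
  rw [HasFiniteIntegral, lintegral_enorm_tri_integrand]
  exact (maj_mono hm.enorm_le F G H ξ).trans_lt hξ

theorem IsBddKernel.memLp (hM : IsBddKernel M C) (hm : IsDom M m) (F G H : L2) :
    MemLp (tri m F G H) 2 volume := by
  refine memLp_two_of_normSq_lt_top (measurable_tri hm.measurable (by fun_prop) (by fun_prop)
    (by fun_prop)).aestronglyMeasurable ?_
  exact (normSq_mono fun ξ => (enorm_tri_le m F G H ξ).trans
    (maj_mono hm.enorm_le F G H ξ)).trans_lt
    ((hM.normSq_maj_le F G H).trans_lt ENNReal.ofReal_lt_top)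

theorem IsBddKernel.coeFn (hM : IsBddKernel M C) (hm : IsDom M m) (F G H : L2) :
    triL m F G H =ᵐ[volume] tri m F G H := by
  rw [triL, dif_pos (hM.memLp hm F G H)]
  exact (hM.memLp hm F G H).coeFn_toLp

theorem enorm_sq_triL_le (m : ℝ → ℝ → ℝ → ℂ) (F G H : L2) :
    ‖triL m F G H‖ₑ ^ 2 ≤ normSq (maj (fun ξ x y => ‖m ξ x y‖ₑ) F G H) := by
  rw [triL]
  split_ifs with h
  · rw [enorm_sq_toLp]
    exact normSq_mono (enorm_tri_le m F G H)
  · simp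

theorem IsBddKernel.norm_triL_le (hM : IsBddKernel M C) (hm : IsDom M m) (F G H : L2) :
    ‖triL m F G H‖ ≤ C * ‖F‖ * ‖G‖ * ‖H‖ := by
  have := hM.nonneg
  refine norm_le_of_enorm_sq_le (by positivity) ?_
  exact (enorm_sq_triL_le m F G H).trans ((normSq_mono (maj_mono hm.enorm_le F G H)).trans
    (hM.normSq_maj_le F G H))

/-- Needed so that the form at a fixed `ξ` does not depend on the representative of its third
argument. -/
theorem volume_preimage_shear (ξ : ℝ) :
    Measure.QuasiMeasurePreserving (fun p : ℝ × ℝ => ξ - p.1 + p.2) volume volume := by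
  refine ⟨by fun_prop, Measure.AbsolutelyContinuous.mk fun s hs h0 => ?_⟩
  rw [Measure.map_apply (by fun_prop) hs, Measure.volume_eq_prod,
    Measure.measure_prod_null ((by fun_prop : Measurable fun p : ℝ × ℝ => ξ - p.1 + p.2) hs)]
  refine Eventually.of_forall fun x => ?_
  simp only [Pi.zero_apply]
  rw [← h0, ← measure_preimage_add volume (ξ - x) s]
  rfl

theorem tri_congr {f g h f' g' h' : ℝ → ℂ} (hf : f =ᵐ[volume] f') (hg : g =ᵐ[volume] g')
    (hh : h =ᵐ[volume] h') (m : ℝ → ℝ → ℝ → ℂ) (ξ : ℝ) : tri m f g h ξ = tri m f' g' h' ξ := by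
  refine integral_congr_ae ?_
  have h1 : ∀ᵐ p : ℝ × ℝ, f p.1 = f' p.1 :=
    (Measure.quasiMeasurePreserving_fst (μ := volume) (ν := volume)).ae hf
  have h2 : ∀ᵐ p : ℝ × ℝ, g p.2 = g' p.2 :=
    (Measure.quasiMeasurePreserving_snd (μ := volume) (ν := volume)).ae hg
  have h3 : ∀ᵐ p : ℝ × ℝ, h (ξ - p.1 + p.2) = h' (ξ - p.1 + p.2) :=
    (volume_preimage_shear ξ).ae hh
  filter_upwards [h1, h2, h3] with p e1 e2 e3
  rw [e1, e2, e3]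

theorem IsBddKernel.triL_add_left (hM : IsBddKernel M C) (hm : IsDom M m) (F F' G H : L2) :
    triL m (F + F') G H = triL m F G H + triL m F' G H := by
  refine Lp.ext ?_
  filter_upwards [hM.coeFn hm (F + F') G H, hM.coeFn hm F G H, hM.coeFn hm F' G H,
    Lp.coeFn_add (triL m F G H) (triL m F' G H), hM.ae_integrable hm F G H,
    hM.ae_integrable hm F' G H] with ξ h1 h2 h3 h4 h5 h6
  rw [h1, h4, Pi.add_apply, h2, h3,
    tri_congr (Lp.coeFn_add F F') (ae_eq_refl _) (ae_eq_refl _)]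
  simp only [tri]
  rw [← integral_add h5 h6]
  congr 1
  ext p
  rw [Pi.add_apply]
  ring

theorem IsBddKernel.triL_add_middle (hM : IsBddKernel M C) (hm : IsDom M m) (F G G' H : L2) :
    triL m F (G + G') H = triL m F G H + triL m F G' H := by
  refine Lp.ext ?_
  filter_upwards [hM.coeFn hm F (G + G') H, hM.coeFn hm F G H, hM.coeFn hm F G' H,
    Lp.coeFn_add (triL m F G H) (triL m F G' H), hM.ae_integrable hm F G H,
    hM.ae_integrable hm F G' H] with ξ h1 h2 h3 h4 h5 h6
  rw [h1, h4, Pi.add_apply, h2, h3,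
    tri_congr (ae_eq_refl _) (Lp.coeFn_add G G') (ae_eq_refl _)]
  simp only [tri]
  rw [← integral_add h5 h6]
  congr 1
  ext p
  rw [Pi.add_apply, map_add]
  ring

theorem IsBddKernel.triL_add_right (hM : IsBddKernel M C) (hm : IsDom M m) (F G H H' : L2) :
    triL m F G (H + H') = triL m F G H + triL m F G H' := by
  refine Lp.ext ?_
  filter_upwards [hM.coeFn hm F G (H + H'), hM.coeFn hm F G H, hM.coeFn hm F G H',
    Lp.coeFn_add (triL m F G H) (triL m F G H'), hM.ae_integrable hm F G H,
    hM.ae_integrable hm F G H'] with ξ h1 h2 h3 h4 h5 h6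
  rw [h1, h4, Pi.add_apply, h2, h3,
    tri_congr (ae_eq_refl _) (ae_eq_refl _) (Lp.coeFn_add H H')]
  simp only [tri]
  rw [← integral_add h5 h6]
  congr 1
  ext p
  rw [Pi.add_apply]
  ring

theorem IsBddKernel.triL_smul_left (hM : IsBddKernel M C) (hm : IsDom M m) (c : ℂ) (F G H : L2) :
    triL m (c • F) G H = c • triL m F G H := by
  refine Lp.ext ?_
  filter_upwards [hM.coeFn hm (c • F) G H, hM.coeFn hm F G H,
    Lp.coeFn_smul c (triL m F G H)] with ξ h1 h2 h3
  rw [h1, h3, Pi.smul_apply, h2,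
    tri_congr (Lp.coeFn_smul c F) (ae_eq_refl _) (ae_eq_refl _)]
  simp only [tri, smul_eq_mul]
  rw [← integral_const_mul]
  congr 1
  ext p
  rw [Pi.smul_apply, smul_eq_mul]
  ring

theorem IsBddKernel.triL_smul_middle (hM : IsBddKernel M C) (hm : IsDom M m) (c : ℂ)
    (F G H : L2) : triL m F (c • G) H = starRingEnd ℂ c • triL m F G H := by
  refine Lp.ext ?_
  filter_upwards [hM.coeFn hm F (c • G) H, hM.coeFn hm F G H,
    Lp.coeFn_smul (starRingEnd ℂ c) (triL m F G H)] with ξ h1 h2 h3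
  rw [h1, h3, Pi.smul_apply, h2,
    tri_congr (ae_eq_refl _) (Lp.coeFn_smul c G) (ae_eq_refl _)]
  simp only [tri, smul_eq_mul]
  rw [← integral_const_mul]
  congr 1
  ext p
  rw [Pi.smul_apply, smul_eq_mul, map_mul]
  ring

theorem IsBddKernel.triL_smul_right (hM : IsBddKernel M C) (hm : IsDom M m) (c : ℂ)
    (F G H : L2) : triL m F G (c • H) = c • triL m F G H := by
  refine Lp.ext ?_
  filter_upwards [hM.coeFn hm F G (c • H), hM.coeFn hm F G H,
    Lp.coeFn_smul c (triL m F G H)] with ξ h1 h2 h3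
  rw [h1, h3, Pi.smul_apply, h2,
    tri_congr (ae_eq_refl _) (ae_eq_refl _) (Lp.coeFn_smul c H)]
  simp only [tri, smul_eq_mul]
  rw [← integral_const_mul]
  congr 1
  ext p
  rw [Pi.smul_apply, smul_eq_mul]
  ring

theorem IsBddKernel.triL_sub_left (hM : IsBddKernel M C) (hm : IsDom M m) (F F' G H : L2) :
    triL m (F - F') G H = triL m F G H - triL m F' G H := by
  rw [eq_sub_iff_add_eq, ← hM.triL_add_left hm, sub_add_cancel]

theorem IsBddKernel.triL_sub_middle (hM : IsBddKernel M C) (hm : IsDom M m) (F G G' H : L2) :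
    triL m F (G - G') H = triL m F G H - triL m F G' H := by
  rw [eq_sub_iff_add_eq, ← hM.triL_add_middle hm, sub_add_cancel]

theorem IsBddKernel.triL_sub_right (hM : IsBddKernel M C) (hm : IsDom M m) (F G H H' : L2) :
    triL m F G (H - H') = triL m F G H - triL m F G H' := by
  rw [eq_sub_iff_add_eq, ← hM.triL_add_right hm, sub_add_cancel]

theorem IsBddKernel.triL_mult_sub (hM : IsBddKernel M C) (hm : IsDom M m) (hm' : IsDom M m')
    (F G H : L2) :
    triL m F G H - triL m' F G H =ᵐ[volume] tri (fun ξ x y => m ξ x y - m' ξ x y) F G H := by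
  filter_upwards [hM.coeFn hm F G H, hM.coeFn hm' F G H,
    Lp.coeFn_sub (triL m F G H) (triL m' F G H), hM.ae_integrable hm F G H,
    hM.ae_integrable hm' F G H] with ξ h1 h2 h3 h4 h5
  rw [h3, Pi.sub_apply, h1, h2]
  simp only [tri]
  rw [← integral_sub h4 h5]
  congr 1
  ext p
  ring

/-- Dominated convergence twice: in `(ξ₁, ξ₂)` at almost every `ξ`, where the majorant is finite,
and then in `ξ`, with the square-integrable majorant. -/
theorem IsBddKernel.tendsto_triL_mult {ι : Type*} {l : Filter ι} [l.IsCountablyGenerated]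
    (hM : IsBddKernel M C) {m : ι → ℝ → ℝ → ℝ → ℂ} {m₀ : ℝ → ℝ → ℝ → ℂ}
    (hm : ∀ i, IsDom M (m i)) (hm₀ : IsDom M m₀)
    (h : ∀ ξ x y, Tendsto (fun i => m i ξ x y) l (𝓝 (m₀ ξ x y))) (F G H : L2) :
    Tendsto (fun i => triL (m i) F G H) l (𝓝 (triL m₀ F G H)) := by
  refine tendsto_of_enorm_sq ?_
  set d : ι → ℝ → ℝ≥0∞ := fun i => maj (fun ξ x y => ‖m i ξ x y - m₀ ξ x y‖ₑ) F G H with hd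
  have hdm : ∀ i, Measurable (d i) := fun i =>
    measurable_posTri ((hm i).measurable.sub hm₀.measurable).enorm (by fun_prop) (by fun_prop)
      (by fun_prop)
  have hbd : ∀ i ξ x y, ‖m i ξ x y - m₀ ξ x y‖ₑ ≤ 2 * M ξ x y := fun i ξ x y => by
    rw [two_mul]
    exact enorm_sub_le.trans (add_le_add ((hm i).enorm_le ξ x y) (hm₀.enorm_le ξ x y))
  have hdle : ∀ i ξ, d i ξ ≤ 2 * maj M F G H ξ := fun i ξ => by
    refine (maj_mono (hbd i) F G H ξ).trans (le_of_eq ?_)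
    rw [maj, maj, posTri, posTri, ← lintegral_const_mul' _ _ (by simp)]
    exact lintegral_congr fun p => by ring
  have hdlim : ∀ᵐ ξ, Tendsto (fun i => d i ξ) l (𝓝 0) := by
    filter_upwards [hM.ae_maj_lt_top F G H] with ξ hξ
    rw [show (0 : ℝ≥0∞) = ∫⁻ _ : ℝ × ℝ, 0 by simp]
    refine tendsto_lintegral_filter_of_dominated_convergence
      (fun p => 2 * (M ξ p.1 p.2 * (‖F p.1‖ₑ * ‖G p.2‖ₑ * ‖H (ξ - p.1 + p.2)‖ₑ)))
      (Eventually.of_forall fun i => ?_) (Eventually.of_forall fun i =>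
      Eventually.of_forall fun p => ?_) ?_ (Eventually.of_forall fun p => ?_)
    · exact (measurable_posTri_integrand (M := fun ξ x y => ‖m i ξ x y - m₀ ξ x y‖ₑ)
        ((hm i).measurable.sub hm₀.measurable).enorm (measurable_coe F).enorm
        (measurable_coe G).enorm (measurable_coe H).enorm).comp
        (measurable_prodMk_left (x := ξ))
    · rw [← mul_assoc 2]
      exact mul_le_mul' (hbd i ξ p.1 p.2) le_rfl
    · rw [lintegral_const_mul' _ _ (by simp)]
      exact ENNReal.mul_ne_top (by simp) hξ.ne
    · have h1 : Tendsto (fun i => ‖m i ξ p.1 p.2 - m₀ ξ p.1 p.2‖ₑ) l (𝓝 0) := by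
        have := ((h ξ p.1 p.2).sub_const (m₀ ξ p.1 p.2)).enorm
        simpa using this
      have := ENNReal.Tendsto.mul_const h1
        (b := ‖F p.1‖ₑ * ‖G p.2‖ₑ * ‖H (ξ - p.1 + p.2)‖ₑ) (Or.inr (by finiteness))
      simpa using this
  have hsq : Tendsto (fun i => normSq (d i)) l (𝓝 0) := by
    rw [show (0 : ℝ≥0∞) = ∫⁻ _ : ℝ, 0 by simp]
    refine tendsto_lintegral_filter_of_dominated_convergence
      (fun ξ => (2 * maj M F G H ξ) ^ 2) (Eventually.of_forall fun i => (hdm i).pow_const 2)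
      (Eventually.of_forall fun i => Eventually.of_forall fun ξ => by gcongr; exact hdle i ξ) ?_ ?_
    · have := normSq_const_mul 2 (hM.measurable_maj F G H)
      rw [show ∫⁻ ξ, (2 * maj M F G H ξ) ^ 2 = 2 ^ 2 * normSq (maj M F G H) from this]
      exact ENNReal.mul_ne_top (by simp)
        ((hM.normSq_maj_le F G H).trans_lt ENNReal.ofReal_lt_top).ne
    · filter_upwards [hdlim] with ξ hξ
      have := ((ENNReal.continuous_pow 2).tendsto _).comp hξ
      simpa [Function.comp_def] using this
  refine tendsto_of_tendsto_of_tendsto_of_le_of_le tendsto_const_nhds hsq (fun i => bot_le)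
    fun i => ?_
  rw [← normSq_enorm]
  refine lintegral_mono_ae ?_
  filter_upwards [hM.triL_mult_sub (hm i) hm₀ F G H] with ξ hξ
  have h3 : ‖(triL (m i) F G H - triL m₀ F G H : L2) ξ‖ₑ ≤ d i ξ := by
    rw [hξ]
    exact enorm_tri_le _ F G H ξ
  gcongr

theorem IsBddKernel.triL_sub_triL (hM : IsBddKernel M C) (hm : IsDom M m) (F F' G G' H H' : L2) :
    triL m F G H - triL m F' G' H' =
      triL m (F - F') G H + triL m F' (G - G') H + triL m F' G' (H - H') := by
  rw [hM.triL_sub_left hm, hM.triL_sub_middle hm, hM.triL_sub_right hm]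
  abel

theorem IsBddKernel.tendsto_triL {ι : Type*} {l : Filter ι} [l.IsCountablyGenerated]
    (hM : IsBddKernel M C) {m : ι → ℝ → ℝ → ℝ → ℂ} {m₀ : ℝ → ℝ → ℝ → ℂ}
    (hm : ∀ i, IsDom M (m i)) (hm₀ : IsDom M m₀)
    (h : ∀ ξ x y, Tendsto (fun i => m i ξ x y) l (𝓝 (m₀ ξ x y))) {F G H : ι → L2} {F₀ G₀ H₀ : L2}
    (hF : Tendsto F l (𝓝 F₀)) (hG : Tendsto G l (𝓝 G₀)) (hH : Tendsto H l (𝓝 H₀)) :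
    Tendsto (fun i => triL (m i) (F i) (G i) (H i)) l (𝓝 (triL m₀ F₀ G₀ H₀)) := by
  have dF := tendsto_iff_norm_sub_tendsto_zero.1 hF
  have dG := tendsto_iff_norm_sub_tendsto_zero.1 hG
  have dH := tendsto_iff_norm_sub_tendsto_zero.1 hH
  have h1 : Tendsto (fun i => triL (m i) (F i) (G i) (H i) - triL (m i) F₀ G₀ H₀) l (𝓝 0) := by
    refine squeeze_zero_norm (a := fun i => C * ‖F i - F₀‖ * ‖G i‖ * ‖H i‖ +
      C * ‖F₀‖ * ‖G i - G₀‖ * ‖H i‖ + C * ‖F₀‖ * ‖G₀‖ * ‖H i - H₀‖) (fun i => ?_) ?_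
    · rw [hM.triL_sub_triL (hm i)]
      refine norm_add₃_le.trans ?_
      gcongr <;> exact hM.norm_triL_le (hm i) _ _ _
    · have := (((dF.const_mul C).mul hG.norm).mul hH.norm).add
        ((((dG.const_mul (C * ‖F₀‖)).mul hH.norm)).add (dH.const_mul (C * ‖F₀‖ * ‖G₀‖)))
      simp only [mul_zero, zero_mul, add_zero] at this
      refine this.congr fun i => ?_
      ring
  simpa using h1.add (hM.tendsto_triL_mult hm hm₀ h F₀ G₀ H₀)

/-- Differentiation of a time-dependent trilinear form along a differentiable curve. -/
theorem IsBddKernel.hasDerivAt_triL (hM : IsBddKernel M C) {m : ℝ → ℝ → ℝ → ℝ → ℂ}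
    {m' : ℝ → ℝ → ℝ → ℂ} {t : ℝ} (hm : ∀ τ, IsDom M (m τ)) (hm' : IsDom M m')
    (hq : ∀ τ, IsDom M fun ξ x y => ((τ⁻¹ : ℝ) : ℂ) * (m (t + τ) ξ x y - m t ξ x y))
    (hd : ∀ ξ x y, HasDerivAt (fun τ => m τ ξ x y) (m' ξ x y) t)
    {V : ℝ → L2} {V' : L2} (hV : HasDerivAt V V' t) :
    HasDerivAt (fun τ => triL (m τ) (V τ) (V τ) (V τ))
      (triL m' (V t) (V t) (V t) + (triL (m t) V' (V t) (V t) + triL (m t) (V t) V' (V t) +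
        triL (m t) (V t) (V t) V')) t := by
  rw [hasDerivAt_iff_tendsto_slope_zero]
  have hVs := hasDerivAt_iff_tendsto_slope_zero.1 hV
  have hVc : Tendsto (fun τ : ℝ => V (t + τ)) (𝓝[≠] 0) (𝓝 (V t)) := by
    have h1 : Tendsto (fun τ : ℝ => t + τ) (𝓝[≠] 0) (𝓝 t) := by
      have : Tendsto (fun τ : ℝ => t + τ) (𝓝 0) (𝓝 (t + 0)) :=
        (continuous_const_add t).tendsto 0
      rw [add_zero] at this
      exact this.mono_left nhdsWithin_le_nhds
    exact hV.continuousAt.tendsto.comp h1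
  have hds : ∀ ξ x y, Tendsto (fun τ : ℝ => ((τ⁻¹ : ℝ) : ℂ) * (m (t + τ) ξ x y - m t ξ x y))
      (𝓝[≠] 0) (𝓝 (m' ξ x y)) := fun ξ x y => by
    have := hasDerivAt_iff_tendsto_slope_zero.1 (hd ξ x y)
    refine this.congr fun τ => ?_
    rw [Complex.real_smul]
  have hc : ∀ ξ x y, Tendsto (fun _ : ℝ => m t ξ x y) (𝓝[≠] 0) (𝓝 (m t ξ x y)) :=
    fun ξ x y => tendsto_const_nhds
  -- The difference quotient telescopes into that of the kernel, evaluated at `V (t + τ)`, and three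
  -- terms in which one argument is the difference quotient of `V`.
  have L1 := hM.tendsto_triL hq hm' hds hVc hVc hVc
  have L2 := hM.tendsto_triL (fun _ : ℝ => hm t) (hm t) hc hVs hVc hVc
  have L3 := hM.tendsto_triL (fun _ : ℝ => hm t) (hm t) hc
    (tendsto_const_nhds (x := V t)) hVs hVc
  have L4 := hM.tendsto_triL (fun _ : ℝ => hm t) (hm t) hc
    (tendsto_const_nhds (x := V t)) (tendsto_const_nhds (x := V t)) hVs
  refine (L1.add ((L2.add L3).add L4)).congr fun τ => ?_
  have hr : ∀ W : FractionalNLS.L2, (τ⁻¹ : ℝ) • W = ((τ⁻¹ : ℝ) : ℂ) • W := fun W =>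
    (Complex.coe_smul _ _).symm
  have e1 : triL (fun ξ x y => ((τ⁻¹ : ℝ) : ℂ) * (m (t + τ) ξ x y - m t ξ x y))
      (V (t + τ)) (V (t + τ)) (V (t + τ)) = ((τ⁻¹ : ℝ) : ℂ) •
        (triL (m (t + τ)) (V (t + τ)) (V (t + τ)) (V (t + τ)) -
          triL (m t) (V (t + τ)) (V (t + τ)) (V (t + τ))) := by
    refine Lp.ext ?_
    filter_upwards [hM.coeFn (hq τ) (V (t + τ)) (V (t + τ)) (V (t + τ)),
      Lp.coeFn_smul ((τ⁻¹ : ℝ) : ℂ) (triL (m (t + τ)) (V (t + τ)) (V (t + τ)) (V (t + τ)) -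
          triL (m t) (V (t + τ)) (V (t + τ)) (V (t + τ))),
      hM.triL_mult_sub (hm (t + τ)) (hm t) (V (t + τ)) (V (t + τ)) (V (t + τ))] with ξ h1 h2 h3
    rw [h1, h2, Pi.smul_apply, h3, smul_eq_mul]
    simp only [tri]
    rw [← integral_const_mul]
    congr 1
    ext p
    ring
  rw [e1, hr, hr, hM.triL_smul_left (hm t), hM.triL_smul_middle (hm t),
    hM.triL_smul_right (hm t), Complex.conj_ofReal, ← smul_add, ← smul_add, ← smul_add,
    ← hM.triL_sub_triL (hm t)]
  congr 1
  abel

end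

noncomputable section

/-! ### The Fourier transform of products -/

/-- On `L¹ ∩ L²` the inverse Fourier transform of `L²` is given by the Fourier integral. -/
theorem coeFn_fourierInv_of_integrable (F : L2) (hF : Integrable (F : ℝ → ℂ)) :
    ((𝓕⁻ F : L2) : ℝ → ℂ) =ᵐ[volume] 𝓕⁻ (F : ℝ → ℂ) := by
  have hcont : Continuous (𝓕⁻ (F : ℝ → ℂ)) := by
    rw [Real.fourierInv_eq_fourier_comp_neg]
    exact VectorFourier.fourierIntegral_continuous Real.continuous_fourierChar
      (by fun_prop) hF.comp_neg
  -- Both functions are tested against smooth compactly supported functions. The `L²` transform is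
  -- also the distributional one, and Fubini moves the Fourier integral onto the test function.
  refine ae_eq_of_integral_contDiff_smul_eq
    ((Lp.memLp (𝓕⁻ F : L2)).locallyIntegrable (by norm_num)) hcont.locallyIntegrable ?_
  intro g hg hgc
  have hgc' : HasCompactSupport (fun x => (g x : ℂ)) := hgc.comp_left (g := Complex.ofReal) rfl
  have hg' : ContDiff ℝ (⊤ : ℕ∞) (fun x => (g x : ℂ)) := Complex.ofRealCLM.contDiff.comp hg
  set φ := hgc'.toSchwartzMap hg' with hφ
  have h1 := congrArg (fun T => T φ) (Lp.fourierInv_toTemperedDistribution_eq F)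
  simp only [TemperedDistribution.fourierInv_apply, Lp.toTemperedDistribution_apply] at h1
  have h2 : ∫ x, g x • (𝓕⁻ F : L2) x = ∫ x, φ x • (𝓕⁻ F : L2) x := by
    refine integral_congr_ae (Eventually.of_forall fun x => ?_)
    simp [hφ]
  have h3 : ∫ x, g x • 𝓕⁻ (F : ℝ → ℂ) x = ∫ x, φ x • 𝓕⁻ (F : ℝ → ℂ) x := by
    refine integral_congr_ae (Eventually.of_forall fun x => ?_)
    simp [hφ]
  rw [h2, h3, ← h1]
  have h4 := VectorFourier.integral_fourierIntegral_smul_eq_flip (e := Real.fourierChar)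
    (μ := (volume : Measure ℝ)) (ν := (volume : Measure ℝ)) (L := -(innerₗ ℝ))
    (f := (φ : ℝ → ℂ)) (g := (F : ℝ → ℂ)) Real.continuous_fourierChar
    (by simp only [LinearMap.neg_apply]; fun_prop) φ.integrable hF
  have e1 : ∀ x, VectorFourier.fourierIntegral Real.fourierChar volume (-(innerₗ ℝ)) (φ : ℝ → ℂ) x =
      (𝓕⁻ φ : SchwartzMap ℝ ℂ) x := fun x => by
    rw [SchwartzMap.fourierInv_coe, Real.fourierInv_eq]
    simp [VectorFourier.fourierIntegral]
  have e2 : ∀ x, VectorFourier.fourierIntegral Real.fourierChar volume (-(innerₗ ℝ)).flip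
      (F : ℝ → ℂ) x = 𝓕⁻ (F : ℝ → ℂ) x := fun x => by
    rw [Real.fourierInv_eq]
    simp [VectorFourier.fourierIntegral, mul_comm]
  simp only [e1, e2] at h4
  exact h4

/-- The kernel `1`. -/
def oneKer : ℝ → ℝ → ℝ → ℂ := fun _ _ _ => 1

theorem measurable_oneKer : Measurable fun q : ℝ × ℝ × ℝ => oneKer q.1 q.2.1 q.2.2 :=
  measurable_const

theorem lintegral_enorm_lt_top {F : L2} (hF : Integrable (F : ℝ → ℂ)) : ∫⁻ x, ‖F x‖ₑ < ⊤ :=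
  hF.hasFiniteIntegral

theorem normSq_maj_one_lt_top {F G : L2} (H : L2) (hF : Integrable (F : ℝ → ℂ))
    (hG : Integrable (G : ℝ → ℂ)) : normSq (maj (fun _ _ _ => 1) F G H) < ⊤ := by
  refine (normSq_posTri_one_right_le (by fun_prop) (by fun_prop) (by fun_prop)).trans_lt ?_
  rw [normSq_enorm]
  have := lintegral_enorm_lt_top hF
  have := lintegral_enorm_lt_top hG
  finiteness

theorem memLp_tri_one {F G : L2} (H : L2) (hF : Integrable (F : ℝ → ℂ))
    (hG : Integrable (G : ℝ → ℂ)) : MemLp (tri oneKer F G H) 2 volume := by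
  refine memLp_two_of_normSq_lt_top (measurable_tri measurable_oneKer (by fun_prop) (by fun_prop)
    (by fun_prop)).aestronglyMeasurable ((normSq_mono fun ξ => ?_).trans_lt
      (normSq_maj_one_lt_top H hF hG))
  refine (enorm_tri_le oneKer F G H ξ).trans (maj_mono (fun _ _ _ => ?_) F G H ξ)
  simp [oneKer]

theorem ae_integrable_tri_one {F G : L2} (H : L2) (hF : Integrable (F : ℝ → ℂ))
    (hG : Integrable (G : ℝ → ℂ)) :
    ∀ᵐ ξ, Integrable fun p : ℝ × ℝ => F p.1 * starRingEnd ℂ (G p.2) * H (ξ - p.1 + p.2) := by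
  have hm : Measurable (maj (fun _ _ _ => 1) F G H) :=
    measurable_posTri measurable_const (by fun_prop) (by fun_prop) (by fun_prop)
  have h := ae_lt_top (hm.pow_const 2) (normSq_maj_one_lt_top H hF hG).ne
  filter_upwards [h] with ξ hξ
  have hc : Measurable (starRingEnd ℂ) := Complex.continuous_conj.measurable
  refine ⟨(by fun_prop : Measurable _).aestronglyMeasurable, ?_⟩
  have e := lintegral_enorm_tri_integrand oneKer F G H ξ
  simp only [oneKer, one_mul, enorm_one] at e
  rw [HasFiniteIntegral, e]
  by_contra hc
  rw [not_lt_top_iff] at hc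
  simp [hc] at hξ

-- Reflecting `ξ₂` exhibits an iterated convolution. Fubini requires the double integral to converge
-- absolutely, which is known for almost every `ξ`.
open scoped Convolution in
theorem tri_one_ae_eq_convolution {F G : L2} (H : L2) (hF : Integrable (F : ℝ → ℂ))
    (hG : Integrable (G : ℝ → ℂ)) :
    tri oneKer F G H =ᵐ[volume] (F : ℝ → ℂ) ⋆[ContinuousLinearMap.mul ℂ ℂ]
      ((fun η => starRingEnd ℂ (G (-η))) ⋆[ContinuousLinearMap.mul ℂ ℂ] (H : ℝ → ℂ)) := by
  filter_upwards [ae_integrable_tri_one H hF hG] with ξ hξ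
  simp only [tri, oneKer, one_mul]
  rw [Measure.volume_eq_prod, integral_prod _ (by rwa [← Measure.volume_eq_prod]),
    convolution_def]
  refine integral_congr_ae (Eventually.of_forall fun x => ?_)
  simp only [ContinuousLinearMap.mul_apply', convolution_def]
  rw [← integral_const_mul]
  rw [← integral_neg_eq_self]
  refine integral_congr_ae (Eventually.of_forall fun y => ?_)
  simp only
  rw [show ξ - x + -y = ξ - x - y by ring]
  ring

open scoped Convolution in
theorem integrable_tri_one {F G H : L2} (hF : Integrable (F : ℝ → ℂ))
    (hG : Integrable (G : ℝ → ℂ)) (hH : Integrable (H : ℝ → ℂ)) :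
    Integrable (tri oneKer F G H) := by
  have hG' : Integrable fun η => starRingEnd ℂ (G (-η)) :=
    (RCLike.conjCLE (K := ℂ)).toContinuousLinearMap.integrable_comp hG.comp_neg
  exact (hF.integrable_convolution _ (hG'.integrable_convolution _ hH)).congr
    (tri_one_ae_eq_convolution H hF hG).symm

open scoped Convolution in
theorem fourierInv_tri_one {F G H : L2} (hF : Integrable (F : ℝ → ℂ))
    (hG : Integrable (G : ℝ → ℂ)) (hH : Integrable (H : ℝ → ℂ)) (x : ℝ) :
    𝓕⁻ (tri oneKer F G H) x =
      𝓕⁻ (F : ℝ → ℂ) x * starRingEnd ℂ (𝓕⁻ (G : ℝ → ℂ) x) * 𝓕⁻ (H : ℝ → ℂ) x := by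
  have hG' : Integrable fun η => starRingEnd ℂ (G (-η)) :=
    (RCLike.conjCLE (K := ℂ)).toContinuousLinearMap.integrable_comp hG.comp_neg
  rw [Real.fourierInv_congr_ae (tri_one_ae_eq_convolution H hF hG), Real.fourierInv_eq_fourier_neg,
    Real.fourier_mul_convolution_eq hF (hG'.integrable_convolution _ hH),
    Real.fourier_mul_convolution_eq hG' hH, ← Real.fourierInv_eq_fourier_neg,
    ← Real.fourierInv_eq_fourier_neg (H : ℝ → ℂ)]
  have : 𝓕 (fun η => starRingEnd ℂ (G (-η))) (-x) = starRingEnd ℂ (𝓕⁻ (G : ℝ → ℂ) x) := by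
    rw [Real.fourier_eq, Real.fourierInv_eq, ← integral_conj, ← integral_neg_eq_self]
    refine integral_congr_ae (Eventually.of_forall fun η => ?_)
    simp only [inner_neg_neg, neg_neg, Circle.smul_def, smul_eq_mul, map_mul]
    rw [AddChar.map_neg_eq_inv, Circle.coe_inv_eq_conj]
  rw [this]
  ring

/-- The product `f ḡ h` of functions with integrable Fourier transforms has the Fourier transform
given by the trilinear convolution. -/
theorem fourier_mul_conj_mul {f g h : L2} (hf : Integrable ((𝓕 f : L2) : ℝ → ℂ))
    (hg : Integrable ((𝓕 g : L2) : ℝ → ℂ)) (hh : Integrable ((𝓕 h : L2) : ℝ → ℂ)) :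
    ((𝓕⁻ ((memLp_tri_one (𝓕 h : L2) hf hg).toLp _ : L2) : L2) : ℝ → ℂ) =ᵐ[volume]
      fun x => f x * starRingEnd ℂ (g x) * h x := by
  have inv : ∀ k : L2, Integrable ((𝓕 k : L2) : ℝ → ℂ) →
      (k : ℝ → ℂ) =ᵐ[volume] 𝓕⁻ ((𝓕 k : L2) : ℝ → ℂ) := fun k hk => by
    have := coeFn_fourierInv_of_integrable (𝓕 k) hk
    rwa [fourierInv_fourier_eq] at this
  have ht := (memLp_tri_one (𝓕 h : L2) hf hg).coeFn_toLp
  have h1 := coeFn_fourierInv_of_integrable ((memLp_tri_one (𝓕 h : L2) hf hg).toLp _)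
    ((integrable_tri_one hf hg hh).congr ht.symm)
  filter_upwards [h1, inv f hf, inv g hg, inv h hh] with x e1 e2 e3 e4
  rw [e1, Real.fourierInv_congr_ae ht, fourierInv_tri_one hf hg hh, ← e2, ← e3, ← e4]

theorem norm_coe_le_of_integrable {f : L2} (hf : Integrable ((𝓕 f : L2) : ℝ → ℂ)) :
    ∀ᵐ x, ‖f x‖ ≤ ∫ ξ, ‖(𝓕 f : L2) ξ‖ := by
  have := coeFn_fourierInv_of_integrable (𝓕 f) hf
  rw [fourierInv_fourier_eq] at this
  filter_upwards [this] with x hx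
  rw [hx, Real.fourierInv_eq]
  refine (norm_integral_le_integral_norm _).trans (le_of_eq ?_)
  simp [Circle.norm_smul]

/-- The Fourier transform of the cubic nonlinearity. -/
theorem fourier_cubic {f : L2} (hf : Integrable ((𝓕 f : L2) : ℝ → ℂ)) :
    (𝓕 (cubic f) : L2) = (memLp_tri_one (𝓕 f : L2) hf hf).toLp _ := by
  set T : L2 := (memLp_tri_one (𝓕 f : L2) hf hf).toLp _ with hT
  have h1 : ((𝓕⁻ T : L2) : ℝ → ℂ) =ᵐ[volume] fun x => ((‖f x‖ ^ 2 : ℝ) : ℂ) * f x := by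
    filter_upwards [fourier_mul_conj_mul hf hf hf] with x hx
    rw [hx, Complex.mul_conj, Complex.normSq_eq_norm_sq]
  have h2 : MemLp (fun x => ((‖f x‖ ^ 2 : ℝ) : ℂ) * f x) 2 (volume : Measure ℝ) :=
    (Lp.memLp (𝓕⁻ T : L2)).ae_eq h1
  have h3 : cubic f = 𝓕⁻ T := by
    rw [cubic, dif_pos h2]
    exact Lp.ext (h2.coeFn_toLp.trans h1.symm)
  rw [h3, fourier_fourierInv_eq]

end

noncomputable section

/-! ### Sobolev spaces on the Fourier side -/

/-- The Sobolev weight as a complex multiplier. -/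
def wtc (r ξ : ℝ) : ℂ := (wt r ξ : ℂ)

theorem measurable_wtc (r : ℝ) : Measurable (wtc r) := by unfold wtc; fun_prop

attribute [fun_prop] measurable_wtc

theorem norm_wtc (r ξ : ℝ) : ‖wtc r ξ‖ = wt r ξ := by
  rw [wtc, Complex.norm_real, Real.norm_of_nonneg (wt_nonneg _ _)]

theorem enorm_wtc (r ξ : ℝ) : ‖wtc r ξ‖ₑ = ewt r ξ := by
  rw [← ofReal_norm, norm_wtc, ewt]

theorem wtc_ne_zero (r ξ : ℝ) : wtc r ξ ≠ 0 := by
  rw [← norm_ne_zero_iff, norm_wtc]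
  exact (wt_pos _ _).ne'

theorem wtc_mul_wtc (r r' ξ : ℝ) : wtc r ξ * wtc r' ξ = wtc (r + r') ξ := by
  rw [wtc, wtc, wtc, ← wt_mul_wt, Complex.ofReal_mul]

@[simp]
theorem wtc_zero (ξ : ℝ) : wtc 0 ξ = 1 := by simp [wtc]

theorem isContr_wtc {r : ℝ} (hr : r ≤ 0) : IsContr (wtc r) :=
  ⟨measurable_wtc r, fun ξ => by rw [norm_wtc]; exact wt_le_one hr ξ⟩

theorem isContr_propagatorSymbol (α t : ℝ) : IsContr (propagatorSymbol α t) :=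
  ⟨measurable_propagatorSymbol α t, fun ξ => (norm_propagatorSymbol α t ξ).le⟩

theorem propagatorSymbol_add (α t t' ξ : ℝ) :
    propagatorSymbol α (t + t') ξ = propagatorSymbol α t ξ * propagatorSymbol α t' ξ := by
  simp only [propagatorSymbol]
  rw [← Complex.exp_add]
  congr 1
  push_cast
  ring

@[simp]
theorem propagatorSymbol_zero (α ξ : ℝ) : propagatorSymbol α 0 ξ = 1 := by simp [propagatorSymbol]

theorem propagatorSymbol_neg_mul (α t ξ : ℝ) :
    propagatorSymbol α (-t) ξ * propagatorSymbol α t ξ = 1 := by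
  rw [← propagatorSymbol_add]; simp

theorem propagatorSymbol_ne_zero (α t ξ : ℝ) : propagatorSymbol α t ξ ≠ 0 := Complex.exp_ne_zero _

theorem conj_propagatorSymbol (α t ξ : ℝ) :
    starRingEnd ℂ (propagatorSymbol α t ξ) = propagatorSymbol α (-t) ξ := by
  simp only [propagatorSymbol]
  rw [← Complex.exp_conj, map_mul, Complex.conj_I, Complex.conj_ofReal]
  congr 1
  push_cast
  ring

theorem continuous_propagatorSymbol_time (α ξ : ℝ) :
    Continuous fun t => propagatorSymbol α t ξ := by
  unfold propagatorSymbol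
  fun_prop

/-- The function `⟨ξ⟩^r f̂`, whose `L²` norm is the `H^r` norm of `f`. -/
def lift (r : ℝ) (f : L2) : L2 := pmul (wtc r) (𝓕 f)

theorem sobolevENorm_eq (r : ℝ) (f : L2) :
    sobolevENorm r f = eLpNorm (fun ξ => wtc r ξ * (𝓕 f : L2) ξ) 2 volume := rfl

theorem memH_iff (r : ℝ) (f : L2) :
    MemH r f ↔ MemLp (fun ξ => wtc r ξ * (𝓕 f : L2) ξ) 2 volume := by
  rw [MemH, sobolevENorm_eq]
  exact ⟨fun h => ⟨(by fun_prop : Measurable _).aestronglyMeasurable, h⟩, fun h => h.2⟩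

theorem norm_lift {r : ℝ} {f : L2} (h : MemH r f) : ‖lift r f‖ = sobolevNorm r f := by
  rw [memH_iff] at h
  rw [lift, pmul_eq_toLp h, Lp.norm_toLp]
  rfl

theorem MemH.sub {r : ℝ} {f g : L2} (hf : MemH r f) (hg : MemH r g) : MemH r (f - g) := by
  rw [memH_iff] at *
  refine (hf.sub hg).ae_eq ?_
  have : (𝓕 (f - g) : L2) = 𝓕 f - 𝓕 g := (Lp.fourierTransformₗᵢ ℝ ℂ).map_sub f g
  rw [this]
  filter_upwards [Lp.coeFn_sub (𝓕 f : L2) (𝓕 g)] with ξ h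
  rw [h, Pi.sub_apply, Pi.sub_apply, mul_sub]

theorem lift_sub {r : ℝ} {f g : L2} (hf : MemH r f) (hg : MemH r g) :
    lift r (f - g) = lift r f - lift r g := by
  have hs := hf.sub hg
  rw [memH_iff] at *
  have : (𝓕 (f - g) : L2) = 𝓕 f - 𝓕 g := (Lp.fourierTransformₗᵢ ℝ ℂ).map_sub f g
  refine Lp.ext ?_
  simp only [lift]
  filter_upwards [coeFn_pmul hf, coeFn_pmul hg, coeFn_pmul hs, Lp.coeFn_sub (𝓕 f : L2) (𝓕 g),
    Lp.coeFn_sub (pmul (wtc r) (𝓕 f)) (pmul (wtc r) (𝓕 g))] with ξ h1 h2 h3 h4 h5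
  rw [h3, h5, Pi.sub_apply, h1, h2, this, h4, Pi.sub_apply, mul_sub]

theorem MemH.mono {r r' : ℝ} {f : L2} (h : MemH r' f) (hr : r ≤ r') : MemH r f := by
  refine lt_of_le_of_lt (eLpNorm_mono fun ξ => ?_) h
  change ‖wtc r ξ * _‖ ≤ ‖wtc r' ξ * _‖
  rw [norm_mul, norm_mul, norm_wtc, norm_wtc]
  exact mul_le_mul_of_nonneg_right (wt_mono hr ξ) (norm_nonneg _)

theorem sobolevNorm_mono {r r' : ℝ} {f : L2} (h : MemH r' f) (hr : r ≤ r') :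
    sobolevNorm r f ≤ sobolevNorm r' f := by
  refine ENNReal.toReal_mono h.ne (eLpNorm_mono fun ξ => ?_)
  change ‖wtc r ξ * _‖ ≤ ‖wtc r' ξ * _‖
  rw [norm_mul, norm_mul, norm_wtc, norm_wtc]
  exact mul_le_mul_of_nonneg_right (wt_mono hr ξ) (norm_nonneg _)

theorem sobolevNorm_nonneg (r : ℝ) (f : L2) : 0 ≤ sobolevNorm r f := ENNReal.toReal_nonneg

/-- A certificate of regularity: an explicit `L²` function proves membership and computes the norm.
The gain to `H^{s+a}` is established in this way. -/
theorem memH_and_lift_eq {r : ℝ} (hr : 0 ≤ r) {f F : L2} (h : (𝓕 f : L2) = pmul (wtc (-r)) F) :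
    MemH r f ∧ lift r f = F := by
  have hc := isContr_wtc (r := -r) (by linarith)
  have e : (fun ξ => wtc r ξ * (𝓕 f : L2) ξ) =ᵐ[volume] F := by
    rw [h]
    filter_upwards [hc.coeFn F] with ξ hξ
    rw [hξ, ← mul_assoc, wtc_mul_wtc]
    simp
  have hm : MemLp (fun ξ => wtc r ξ * (𝓕 f : L2) ξ) 2 volume := (Lp.memLp F).ae_eq e.symm
  refine ⟨(memH_iff r f).2 hm, Lp.ext ?_⟩
  rw [lift]
  exact (coeFn_pmul hm).trans e

theorem pmul_lift {r r' : ℝ} {f : L2} (hf : MemH r f) (hr : r' ≤ r) :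
    pmul (wtc (r' - r)) (lift r f) = lift r' f := by
  rw [lift, lift, pmul_pmul ((memH_iff r f).1 hf)]
  · congr 1
    ext ξ
    rw [wtc_mul_wtc, sub_add_cancel]
  · have := (memH_iff r' f).1 (hf.mono hr)
    simpa only [wtc_mul_wtc, sub_add_cancel] using this

theorem fourier_eq_pmul_lift {r : ℝ} (hr : 0 ≤ r) {f : L2} (hf : MemH r f) :
    (𝓕 f : L2) = pmul (wtc (-r)) (lift r f) := by
  have := pmul_lift hf hr
  rw [zero_sub] at this
  rw [this, lift, pmul_eq_self wtc_zero]

/-- Continuity in `H^r` becomes ordinary continuity of an `L²`-valued curve. -/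
theorem continuousInH_iff {r : ℝ} {I : Set ℝ} {w : ℝ → L2} :
    ContinuousInH r I w ↔
      (∀ t ∈ I, MemH r (w t)) ∧ ContinuousOn (fun t => lift r (w t)) I := by
  refine and_congr_right fun hw => forall₂_congr fun t₀ ht₀ => ?_
  rw [ContinuousWithinAt, tendsto_iff_norm_sub_tendsto_zero (f := fun t => lift r (w t))]
  refine tendsto_congr' ?_
  filter_upwards [self_mem_nhdsWithin] with t ht
  rw [← lift_sub (hw t ht) (hw t₀ ht₀), norm_lift ((hw t ht).sub (hw t₀ ht₀))]

theorem ContinuousInH.mono_exponent {r r' : ℝ} {I : Set ℝ} {w : ℝ → L2} (h : ContinuousInH r' I w)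
    (hr : r ≤ r') : ContinuousInH r I w := by
  rw [continuousInH_iff] at *
  refine ⟨fun t ht => (h.1 t ht).mono hr, ?_⟩
  refine ((isContr_wtc (r := r - r') (by linarith)).continuous.comp_continuousOn h.2).congr ?_
  intro t ht
  exact (pmul_lift (h.1 t ht) hr).symm

/-- The function with profile `V` at time `t`: its Fourier transform is
`⟨ξ⟩^{-s} e^{it|2πξ|^{2α}} V(ξ)`. -/
def state (α s t : ℝ) (V : L2) : L2 := 𝓕⁻ (pmul (wtc (-s)) (pmul (propagatorSymbol α t) V))

theorem fourier_state (α s t : ℝ) (V : L2) :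
    (𝓕 (state α s t V) : L2) = pmul (wtc (-s)) (pmul (propagatorSymbol α t) V) :=
  fourier_fourierInv_eq _

/-- `state` as a bounded operator. -/
def stateCLM (α s t : ℝ) (hs : 0 ≤ s) : L2 →L[ℂ] L2 :=
  ((Lp.fourierTransformₗᵢ ℝ ℂ).symm.toContinuousLinearEquiv : L2 →L[ℂ] L2) ∘L
    mulCLM (wtc (-s)) (isContr_wtc (by linarith)) ∘L
    mulCLM (propagatorSymbol α t) (isContr_propagatorSymbol α t)

theorem stateCLM_apply (α t : ℝ) {s : ℝ} (hs : 0 ≤ s) (V : L2) :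
    stateCLM α s t hs V = state α s t V := rfl

theorem state_injective (α t : ℝ) {s : ℝ} (hs : 0 ≤ s) : Function.Injective (state α s t) := by
  intro V W h
  have h2 := congrArg (fun f : L2 => (𝓕 f : L2)) h
  simp only [fourier_state] at h2
  exact (isContr_propagatorSymbol α t).pmul_injective (propagatorSymbol_ne_zero α t)
    ((isContr_wtc (r := -s) (by linarith)).pmul_injective (wtc_ne_zero (-s)) h2)

theorem memH_state (α t : ℝ) {s : ℝ} (hs : 0 ≤ s) (V : L2) : MemH s (state α s t V) :=
  (memH_and_lift_eq hs (fourier_state α s t V)).1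

theorem lift_state (α t : ℝ) {s : ℝ} (hs : 0 ≤ s) (V : L2) :
    lift s (state α s t V) = pmul (propagatorSymbol α t) V :=
  (memH_and_lift_eq hs (fourier_state α s t V)).2

theorem sobolevNorm_state (α t : ℝ) {s : ℝ} (hs : 0 ≤ s) (V : L2) :
    sobolevNorm s (state α s t V) = ‖V‖ := by
  rw [← norm_lift (memH_state α t hs V), lift_state α t hs,
    norm_pmul_eq (measurable_propagatorSymbol α t) (norm_propagatorSymbol α t)]

theorem pmul_comm {m n : ℝ → ℂ} (hm : IsContr m) (hn : IsContr n) (F : L2) :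
    pmul m (pmul n F) = pmul n (pmul m F) := by
  rw [hm.pmul_pmul hn, hn.pmul_pmul hm]
  simp only [mul_comm]

theorem sobolevNorm_state_low (α t : ℝ) {s s₀ : ℝ} (hs : 0 ≤ s) (h : s₀ ≤ s) (V : L2) :
    sobolevNorm s₀ (state α s t V) = ‖pmul (wtc (s₀ - s)) V‖ := by
  have hm := memH_state α t hs V
  rw [← norm_lift (hm.mono h), ← pmul_lift hm h, lift_state α t hs,
    pmul_comm (isContr_wtc (by linarith)) (isContr_propagatorSymbol α t),
    norm_pmul_eq (measurable_propagatorSymbol α t) (norm_propagatorSymbol α t)]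

/-- The profile at time `t` of a function in `H^s`. -/
def profile (α s t : ℝ) (f : L2) : L2 := pmul (propagatorSymbol α (-t)) (lift s f)

theorem propagatorSymbol_pmul_neg (α t : ℝ) (F : L2) :
    pmul (propagatorSymbol α t) (pmul (propagatorSymbol α (-t)) F) = F := by
  rw [(isContr_propagatorSymbol α t).pmul_pmul (isContr_propagatorSymbol α (-t))]
  refine pmul_eq_self (fun ξ => ?_) F
  rw [mul_comm, propagatorSymbol_neg_mul]

theorem state_profile (α t : ℝ) {s : ℝ} (hs : 0 ≤ s) {f : L2} (hf : MemH s f) :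
    state α s t (profile α s t f) = f := by
  rw [state, profile, propagatorSymbol_pmul_neg, ← fourier_eq_pmul_lift hs hf,
    fourierInv_fourier_eq]

theorem fourier_propagator (α t : ℝ) (f : L2) :
    (𝓕 (propagator α t f) : L2) = pmul (propagatorSymbol α t) (𝓕 f) := by
  rw [propagator, fourier_fourierInv_eq, pmul_eq_toLp]

theorem propagator_eq_state (α t : ℝ) {s : ℝ} (hs : 0 ≤ s) {f : L2} (hf : MemH s f) :
    propagator α t f = state α s t (lift s f) := by
  have : (𝓕 (propagator α t f) : L2) = 𝓕 (state α s t (lift s f)) := by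
    rw [fourier_propagator, fourier_state, fourier_eq_pmul_lift hs hf,
      pmul_comm (isContr_wtc (by linarith)) (isContr_propagatorSymbol α t)]
  exact (Lp.fourierTransformₗᵢ ℝ ℂ).injective this

theorem integrable_pmul_wtc {s : ℝ} (hs : 1 / 2 < s) (F : L2) :
    Integrable (pmul (wtc (-s)) F : ℝ → ℂ) := by
  have hc := isContr_wtc (r := -s) (by linarith)
  refine ⟨(measurable_coe _).aestronglyMeasurable, ?_⟩
  have h := sq_lintegral_le_ewt (r := s) (g := fun ξ => ‖(pmul (wtc (-s)) F) ξ‖ₑ) (by fun_prop)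
  have e : normSq (fun ξ => ewt s ξ * ‖(pmul (wtc (-s)) F) ξ‖ₑ) = ‖F‖ₑ ^ 2 := by
    rw [← normSq_enorm]
    refine lintegral_congr_ae ?_
    filter_upwards [hc.coeFn F] with ξ hξ
    rw [hξ, enorm_mul, enorm_wtc, ← mul_assoc, ewt_mul_ewt]
    simp
  rw [e] at h
  have h2 := lintegral_ewt_lt_top (r := -2 * s) (by linarith)
  rw [HasFiniteIntegral]
  by_contra hc
  rw [not_lt_top_iff] at hc
  rw [hc] at h
  have : (⊤ : ℝ≥0∞) ^ 2 < ⊤ := h.trans_lt (by finiteness)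
  simp at this

theorem integrable_fourier_of_memH {s : ℝ} (hs : 1 / 2 < s) {f : L2} (hf : MemH s f) :
    Integrable ((𝓕 f : L2) : ℝ → ℂ) := by
  rw [fourier_eq_pmul_lift (by linarith) hf]
  exact integrable_pmul_wtc hs _

/-! ### The weighted kernels -/

/-- The weighted majorant kernel `⟨ξ⟩^r K ⟨ξ₁⟩^{-s} ⟨ξ₂⟩^{-s} ⟨ξ₃⟩^{-s}`. -/
def wKer (r s : ℝ) (K : ℝ → ℝ → ℝ → ℝ≥0∞) (ξ x y : ℝ) : ℝ≥0∞ :=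
  ewt r ξ * K ξ x y * (ewt (-s) x * ewt (-s) y * ewt (-s) (ξ - x + y))

theorem posTri_wKer (r s : ℝ) (K : ℝ → ℝ → ℝ → ℝ≥0∞) (f g h : ℝ → ℝ≥0∞) :
    posTri (wKer r s K) f g h = posTri (fun ξ x y => ewt r ξ * K ξ x y)
      (fun x => ewt (-s) x * f x) (fun x => ewt (-s) x * g x) (fun x => ewt (-s) x * h x) := by
  ext ξ
  refine lintegral_congr fun p => ?_
  simp only [wKer]
  ring

theorem wnorm_ewt_neg (s s₀ : ℝ) (f : ℝ → ℝ≥0∞) :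
    wnorm s₀ (fun x => ewt (-s) x * f x) = normSq fun x => ewt (s₀ - s) x * f x := by
  unfold wnorm
  simp only [← mul_assoc, ewt_mul_ewt, sub_eq_add_neg]

theorem wnorm_ewt_neg_self (s : ℝ) (f : ℝ → ℝ≥0∞) :
    wnorm s (fun x => ewt (-s) x * f x) = normSq f := by
  rw [wnorm_ewt_neg]; simp

/-- For `s₀ = s` the input weights cancel and the three tame terms coincide, whence the factor `3`.
-/
theorem isBddKernel_wKer {r s : ℝ} {K : ℝ → ℝ → ℝ → ℝ≥0∞}
    (hK : Measurable fun q : ℝ × ℝ × ℝ => K q.1 q.2.1 q.2.2) {C : ℝ≥0∞} (hC : C ≠ ⊤)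
    (H : ∀ f g h : ℝ → ℝ≥0∞, Measurable f → Measurable g → Measurable h →
      normSq (posTri (fun ξ x y => ewt r ξ * K ξ x y) f g h) ≤ C * tame s s f g h) :
    IsBddKernel (wKer r s K) (Real.sqrt (C.toReal * 3)) where
  measurable := by unfold wKer; fun_prop
  nonneg := Real.sqrt_nonneg _
  bound f g h hf hg hh := by
    rw [posTri_wKer]
    refine (H _ _ _ (by fun_prop) (by fun_prop) (by fun_prop)).trans (le_of_eq ?_)
    rw [tame, wnorm_ewt_neg_self, wnorm_ewt_neg_self, wnorm_ewt_neg_self,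
      Real.sq_sqrt (by positivity), ENNReal.ofReal_mul ENNReal.toReal_nonneg,
      ENNReal.ofReal_toReal hC]
    simp only [ENNReal.ofReal_ofNat]
    ring

/-- The size of a profile in the lower norm. -/
def low (s s₀ : ℝ) (F : L2) : ℝ := ‖pmul (wtc (s₀ - s)) F‖

theorem low_nonneg (s s₀ : ℝ) (F : L2) : 0 ≤ low s s₀ F := norm_nonneg _

theorem ofReal_low_sq {s s₀ : ℝ} (h : s₀ ≤ s) (F : L2) :
    normSq (fun ξ => ewt (s₀ - s) ξ * ‖F ξ‖ₑ) = ENNReal.ofReal (low s s₀ F ^ 2) := by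
  rw [low, ENNReal.ofReal_pow (norm_nonneg _), ofReal_norm, ← normSq_enorm]
  refine lintegral_congr_ae ?_
  filter_upwards [(isContr_wtc (r := s₀ - s) (by linarith)).coeFn F] with ξ hξ
  rw [hξ, enorm_mul, enorm_wtc]

theorem sq_sum_le {a b c : ℝ} (ha : 0 ≤ a) (hb : 0 ≤ b) (hc : 0 ≤ c) :
    a ^ 2 + b ^ 2 + c ^ 2 ≤ (a + b + c) ^ 2 := by
  nlinarith [mul_nonneg ha hb, mul_nonneg hb hc, mul_nonneg ha hc]

theorem norm_triL_le_tame {r s s₀ : ℝ} {K : ℝ → ℝ → ℝ → ℝ≥0∞} {C : ℝ≥0∞} (hC : C ≠ ⊤)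
    (hs₀ : s₀ ≤ s)
    (H : ∀ f g h : ℝ → ℝ≥0∞, Measurable f → Measurable g → Measurable h →
      normSq (posTri (fun ξ x y => ewt r ξ * K ξ x y) f g h) ≤ C * tame s s₀ f g h)
    {m : ℝ → ℝ → ℝ → ℂ} (hm : ∀ ξ x y, ‖m ξ x y‖ₑ ≤ wKer r s K ξ x y) (F G J : L2) :
    ‖triL m F G J‖ ≤ Real.sqrt C.toReal * (‖F‖ * low s s₀ G * low s s₀ J +
      low s s₀ F * ‖G‖ * low s s₀ J + low s s₀ F * low s s₀ G * ‖J‖) := by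
  have nF := low_nonneg s s₀ F
  have nG := low_nonneg s s₀ G
  have nJ := low_nonneg s s₀ J
  refine norm_le_of_enorm_sq_le (by positivity) ?_
  refine (enorm_sq_triL_le m F G J).trans ((normSq_mono (maj_mono hm F G J)).trans ?_)
  rw [maj, posTri_wKer]
  refine (H _ _ _ (by fun_prop) (by fun_prop) (by fun_prop)).trans ?_
  rw [tame, wnorm_ewt_neg_self, wnorm_ewt_neg_self, wnorm_ewt_neg_self, wnorm_ewt_neg,
    wnorm_ewt_neg, wnorm_ewt_neg, ofReal_low_sq hs₀, ofReal_low_sq hs₀, ofReal_low_sq hs₀,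
    normSq_enorm, normSq_enorm, normSq_enorm, ← ofReal_norm, ← ofReal_norm, ← ofReal_norm,
    ← ENNReal.ofReal_pow (norm_nonneg _), ← ENNReal.ofReal_pow (norm_nonneg _),
    ← ENNReal.ofReal_pow (norm_nonneg _)]
  nth_rw 1 [← ENNReal.ofReal_toReal hC]
  rw [← ENNReal.ofReal_mul (by positivity), ← ENNReal.ofReal_mul (by positivity),
    ← ENNReal.ofReal_mul (by positivity), ← ENNReal.ofReal_mul (by positivity),
    ← ENNReal.ofReal_mul (by positivity), ← ENNReal.ofReal_mul (by positivity),
    ← ENNReal.ofReal_add (by positivity) (by positivity),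
    ← ENNReal.ofReal_add (by positivity) (by positivity),
    ← ENNReal.ofReal_mul (by positivity), mul_pow, Real.sq_sqrt ENNReal.toReal_nonneg]
  refine ENNReal.ofReal_le_ofReal (mul_le_mul_of_nonneg_left ?_ ENNReal.toReal_nonneg)
  simp only [← mul_pow]
  exact sq_sum_le (by positivity) (by positivity) (by positivity)

end

noncomputable section

/-! ### The equation for the profile -/

/-- The oscillating factor `e^{-itΦ}`. -/
def osc (α t ξ x y : ℝ) : ℂ := Complex.exp (Complex.I * ((-(t * phase α ξ x y) : ℝ) : ℂ))

theorem norm_osc (α t ξ x y : ℝ) : ‖osc α t ξ x y‖ = 1 := by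
  rw [osc, mul_comm, Complex.norm_exp_ofReal_mul_I]

theorem measurable_osc (α t : ℝ) : Measurable fun q : ℝ × ℝ × ℝ => osc α t q.1 q.2.1 q.2.2 := by
  unfold osc
  have := measurable_phase α
  fun_prop

theorem osc_eq (α t ξ x y : ℝ) : osc α t ξ x y = propagatorSymbol α (-t) ξ *
    (propagatorSymbol α t x * starRingEnd ℂ (propagatorSymbol α t y) *
      propagatorSymbol α t (ξ - x + y)) := by
  rw [conj_propagatorSymbol]
  simp only [osc, propagatorSymbol, ← Complex.exp_add, phase, disp]
  congr 1
  push_cast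
  ring

theorem hasDerivAt_osc (α t ξ x y : ℝ) :
    HasDerivAt (fun τ => osc α τ ξ x y) (-(Complex.I * (phase α ξ x y : ℂ)) * osc α t ξ x y) t := by
  have h1 : HasDerivAt (fun τ : ℝ => Complex.I * ((-(τ * phase α ξ x y) : ℝ) : ℂ))
      (-(Complex.I * (phase α ξ x y : ℂ))) t := by
    have h2 : HasDerivAt (fun τ : ℝ => -(τ * phase α ξ x y)) (-(1 * phase α ξ x y)) t :=
      ((hasDerivAt_id t).mul_const _).neg
    refine (h2.ofReal_comp.const_mul Complex.I).congr_deriv ?_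
    push_cast
    ring
  refine h1.cexp.congr_deriv ?_
  simp only [osc]
  ring

theorem norm_osc_sub_le (α t τ ξ x y : ℝ) :
    ‖osc α (t + τ) ξ x y - osc α t ξ x y‖ ≤ |τ| * |phase α ξ x y| := by
  have e : osc α (t + τ) ξ x y - osc α t ξ x y = osc α t ξ x y *
      (Complex.exp (Complex.I * ((-(τ * phase α ξ x y) : ℝ) : ℂ)) - 1) := by
    simp only [osc, mul_sub, ← Complex.exp_add, mul_one]
    congr 2
    push_cast
    ring
  rw [e, norm_mul, norm_osc, one_mul]
  refine (Real.norm_exp_I_mul_ofReal_sub_one_le).trans (le_of_eq ?_)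
  rw [Real.norm_eq_abs, abs_neg, abs_mul]

theorem continuous_osc_time (α ξ x y : ℝ) : Continuous fun t => osc α t ξ x y := by
  unfold osc
  fun_prop

/-- The weight `⟨ξ⟩^r ⟨ξ₁⟩^{-s} ⟨ξ₂⟩^{-s} ⟨ξ₃⟩^{-s}`. -/
def wKerC (r s ξ x y : ℝ) : ℂ := wtc r ξ * (wtc (-s) x * wtc (-s) y * wtc (-s) (ξ - x + y))

theorem measurable_wKerC (r s : ℝ) :
    Measurable fun q : ℝ × ℝ × ℝ => wKerC r s q.1 q.2.1 q.2.2 := by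
  unfold wKerC; fun_prop

theorem enorm_wKerC (r s ξ x y : ℝ) : ‖wKerC r s ξ x y‖ₑ = wKer r s (fun _ _ _ => 1) ξ x y := by
  simp only [wKerC, wKer, enorm_mul, enorm_wtc, mul_one]

theorem enorm_le_one_of_norm {z : ℂ} (h : ‖z‖ ≤ 1) : ‖z‖ₑ ≤ 1 := by
  rw [← ofReal_norm]
  exact ENNReal.ofReal_le_one.2 h

/-- The kernel of the nonlinearity in the profile variable. -/
def nlKer (α s t ξ x y : ℝ) : ℂ := wKerC s s ξ x y * osc α t ξ x y

/-- The kernel of the normal form, with values in `H^{r}`. -/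
def nfKer (α r s t ξ x y : ℝ) : ℂ := wKerC r s ξ x y * osc α t ξ x y * res α ξ x y

theorem isDom_of_norm_le_one {r s : ℝ} {k : ℝ → ℝ → ℝ → ℂ}
    (hk : Measurable fun q : ℝ × ℝ × ℝ => k q.1 q.2.1 q.2.2) (h : ∀ ξ x y, ‖k ξ x y‖ ≤ 1) :
    IsDom (wKer r s fun _ _ _ => 1) fun ξ x y => wKerC r s ξ x y * k ξ x y :=
  ⟨(measurable_wKerC r s).mul hk, fun ξ x y => by
    rw [enorm_mul, enorm_wKerC]
    exact mul_le_of_le_one_right' (enorm_le_one_of_norm (h ξ x y))⟩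

theorem isDom_nlKer (α s t : ℝ) : IsDom (wKer s s fun _ _ _ => 1) (nlKer α s t) :=
  isDom_of_norm_le_one (measurable_osc α t) fun ξ x y => (norm_osc α t ξ x y).le

theorem isDom_nfKer (α r s t : ℝ) : IsDom (wKer r s fun _ _ _ => 1) (nfKer α r s t) := by
  have := isDom_of_norm_le_one (r := r) (s := s) (k := fun ξ x y => osc α t ξ x y * res α ξ x y)
    ((measurable_osc α t).mul (measurable_res α)) fun ξ x y => by
      rw [norm_mul, norm_osc, one_mul]
      exact norm_res_le_one α ξ x y
  have e : nfKer α r s t = fun ξ x y => wKerC r s ξ x y * (osc α t ξ x y * res α ξ x y) := by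
    ext ξ x y
    rw [nfKer, mul_assoc]
  rwa [e]

theorem isDom_nfKer_res (α r s t : ℝ) :
    IsDom (wKer r s fun ξ x y => ‖res α ξ x y‖ₑ) (nfKer α r s t) := by
  refine ⟨((measurable_wKerC r s).mul (measurable_osc α t)).mul (measurable_res α),
    fun ξ x y => ?_⟩
  have h1 : ‖osc α t ξ x y‖ₑ = 1 := by rw [← ofReal_norm, norm_osc, ENNReal.ofReal_one]
  rw [nfKer, enorm_mul, enorm_mul, enorm_wKerC, h1, wKer, wKer]
  refine le_of_eq ?_
  ring

/-- The difference quotients of `e^{-itΦ}` are at most `|Φ|`, and `|Φ| |1 + iΦ|⁻¹ ≤ 1`. This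
domination, uniform in `τ` although `Φ` is unbounded, permits differentiation under the trilinear
form. At `τ = 0` the quotient is `0` by the convention for the inverse. -/
theorem isDom_nfKer_slope (α r s t τ : ℝ) : IsDom (wKer r s fun _ _ _ => 1)
    fun ξ x y => ((τ⁻¹ : ℝ) : ℂ) * (nfKer α r s (t + τ) ξ x y - nfKer α r s t ξ x y) := by
  have := isDom_of_norm_le_one (r := r) (s := s) (k := fun ξ x y => ((τ⁻¹ : ℝ) : ℂ) *
      (osc α (t + τ) ξ x y - osc α t ξ x y) * res α ξ x y)
    (((measurable_osc α (t + τ)).sub (measurable_osc α t)).const_mul _ |>.mul (measurable_res α))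
    fun ξ x y => by
      rw [norm_mul, norm_mul, Complex.norm_real, Real.norm_eq_abs, abs_inv]
      have h1 := norm_osc_sub_le α t τ ξ x y
      have h2 := norm_res_mul_rpow_le zero_le_one le_rfl (abs_nonneg _)
        (le_refl |phase α ξ x y|)
      rw [Real.rpow_one] at h2
      rcases eq_or_ne τ 0 with h0 | h0
      · simp [h0]
      · have h3 : 0 < |τ| := abs_pos.2 h0
        calc |τ|⁻¹ * ‖osc α (t + τ) ξ x y - osc α t ξ x y‖ * ‖res α ξ x y‖
            ≤ |τ|⁻¹ * (|τ| * |phase α ξ x y|) * ‖res α ξ x y‖ := by gcongr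
          _ = ‖res α ξ x y‖ * |phase α ξ x y| := by field_simp
          _ ≤ 1 := h2
  convert this using 4 with ξ x y
  simp only [nfKer]
  ring

theorem one_add_I_mul_ne_zero (φ : ℝ) : (1 + Complex.I * (φ : ℂ)) ≠ 0 := by
  intro h
  have := one_le_norm_one_add_I_mul φ
  rw [h, norm_zero] at this
  linarith

/-- The identity behind the normal form: `-iΦ(1 + iΦ)⁻¹ = (1 + iΦ)⁻¹ - 1`. -/
theorem hasDerivAt_nfKer (α s t ξ x y : ℝ) :
    HasDerivAt (fun τ => nfKer α s s τ ξ x y) (nfKer α s s t ξ x y - nlKer α s t ξ x y) t := by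
  have h := ((hasDerivAt_osc α t ξ x y).const_mul (wKerC s s ξ x y)).mul_const (res α ξ x y)
  refine h.congr_deriv ?_
  simp only [nfKer, nlKer, res]
  have := one_add_I_mul_ne_zero (phase α ξ x y)
  field_simp
  ring

theorem continuous_nlKer_time (α s ξ x y : ℝ) : Continuous fun t => nlKer α s t ξ x y :=
  continuous_const.mul (continuous_osc_time α ξ x y)

theorem continuous_nfKer_time (α r s ξ x y : ℝ) : Continuous fun t => nfKer α r s t ξ x y :=
  (continuous_const.mul (continuous_osc_time α ξ x y)).mul continuous_const

theorem exists_isBddKernel_algebra {s : ℝ} (hs : 1 / 2 < s) :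
    ∃ C, IsBddKernel (wKer s s fun _ _ _ => 1) C := by
  obtain ⟨C, hC, H⟩ := exists_algebra_estimate (s := s) (by linarith) hs
  exact ⟨_, isBddKernel_wKer measurable_const hC (by simpa only [mul_one] using H)⟩

theorem exists_isBddKernel_smoothing {α s a : ℝ} (hα : 1 / 2 < α) (hα' : α ≤ 1) (hs : 1 / 2 < s)
    (ha : 0 < a) (ha' : a < 2 * α - 1) :
    ∃ C, IsBddKernel (wKer (s + a) s fun ξ x y => ‖res α ξ x y‖ₑ) C := by
  obtain ⟨C, hC, H⟩ := exists_smoothing_estimate (s := s) hα hα' (by linarith) ha ha' hs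
  exact ⟨_, isBddKernel_wKer (measurable_res α).enorm hC H⟩

/-- The right-hand side of the profile equation. -/
def nl (σ α s t : ℝ) (V : L2) : L2 := -(Complex.I * (σ : ℂ)) • triL (nlKer α s t) V V V

/-- `V` solves the profile equation `V' = nl(t, V)` in integral form. -/
structure IsFlow (σ α s : ℝ) (V₀ : L2) (I : Set ℝ) (V : ℝ → L2) : Prop where
  ordConnected : I.OrdConnected
  zero_mem : (0 : ℝ) ∈ I
  continuousOn : ContinuousOn V I
  integral_eq : ∀ t ∈ I, V t = V₀ + ∫ t' in (0 : ℝ)..t, nl σ α s t' (V t')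

theorem continuousOn_triL_of_isBddKernel {M : ℝ → ℝ → ℝ → ℝ≥0∞} {C : ℝ} (hM : IsBddKernel M C)
    {m : ℝ → ℝ → ℝ → ℝ → ℂ} (hm : ∀ t, IsDom M (m t)) (hc : ∀ ξ x y, Continuous fun t => m t ξ x y)
    {I : Set ℝ} {F G H : ℝ → L2} (hF : ContinuousOn F I) (hG : ContinuousOn G I)
    (hH : ContinuousOn H I) : ContinuousOn (fun t => triL (m t) (F t) (G t) (H t)) I :=
  fun t ht => hM.tendsto_triL hm (hm t)
    (fun ξ x y => ((hc ξ x y).tendsto t).mono_left nhdsWithin_le_nhds) (hF t ht) (hG t ht) (hH t ht)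

theorem continuousOn_triL_nlKer {α s : ℝ} (hs : 1 / 2 < s) {I : Set ℝ} {V : ℝ → L2}
    (hV : ContinuousOn V I) :
    ContinuousOn (fun t => triL (nlKer α s t) (V t) (V t) (V t)) I := by
  obtain ⟨C, hM⟩ := exists_isBddKernel_algebra hs
  exact continuousOn_triL_of_isBddKernel hM (isDom_nlKer α s) (continuous_nlKer_time α s) hV hV hV

theorem continuousOn_nl (σ α : ℝ) {s : ℝ} (hs : 1 / 2 < s) {I : Set ℝ} {V : ℝ → L2}
    (hV : ContinuousOn V I) : ContinuousOn (fun t => nl σ α s t (V t)) I :=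
  fun t ht => ((continuousOn_triL_nlKer hs hV) t ht).const_smul (-(Complex.I * (σ : ℂ)))

/-- The nonlinearity, transported to the profile variable. -/
theorem propagator_cubic_state {α s : ℝ} (hs : 1 / 2 < s) (t t' : ℝ) (V : L2) :
    propagator α (t - t') (cubic (state α s t' V)) =
      state α s t (triL (nlKer α s t') V V V) := by
  obtain ⟨C, hM⟩ := exists_isBddKernel_algebra hs
  have hw := isContr_wtc (r := -s) (by linarith)
  have hp := isContr_propagatorSymbol α
  have hInt := integrable_fourier_of_memH hs (memH_state α t' (by linarith) V)
  have hst : ((𝓕 (state α s t' V) : L2) : ℝ → ℂ) =ᵐ[volume]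
      fun ξ => wtc (-s) ξ * (propagatorSymbol α t' ξ * V ξ) := by
    rw [fourier_state]
    filter_upwards [hw.coeFn (pmul (propagatorSymbol α t') V), (hp t').coeFn V] with ξ h1 h2
    rw [h1, h2]
  have key : (𝓕 (propagator α (t - t') (cubic (state α s t' V))) : L2) =
      𝓕 (state α s t (triL (nlKer α s t') V V V)) := by
    rw [fourier_propagator, fourier_state, fourier_cubic hInt]
    refine Lp.ext ?_
    filter_upwards
      [(hp (t - t')).coeFn ((memLp_tri_one (𝓕 (state α s t' V) : L2) hInt hInt).toLp _),
      (memLp_tri_one (𝓕 (state α s t' V) : L2) hInt hInt).coeFn_toLp,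
      hw.coeFn (pmul (propagatorSymbol α t) (triL (nlKer α s t') V V V)),
      (hp t).coeFn (triL (nlKer α s t') V V V),
      hM.coeFn (isDom_nlKer α s t') V V V] with ξ h1 h2 h3 h4 h5
    rw [h1, h2, h3, h4, h5, tri_congr hst hst hst]
    simp only [tri]
    rw [← integral_const_mul, ← integral_const_mul, ← integral_const_mul]
    congr 1
    ext p
    simp only [oneKer, nlKer, wKerC, osc_eq, map_mul]
    rw [show t - t' = t + -t' by ring, propagatorSymbol_add]
    have e1 : starRingEnd ℂ (wtc (-s) p.2) = wtc (-s) p.2 := Complex.conj_ofReal _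
    have e2 : wtc (-s) ξ * wtc s ξ = 1 := by rw [wtc_mul_wtc]; simp
    rw [e1]
    linear_combination (-(propagatorSymbol α t ξ * propagatorSymbol α (-t') ξ *
      (wtc (-s) p.1 * wtc (-s) p.2 * wtc (-s) (ξ - p.1 + p.2)) *
      (propagatorSymbol α t' p.1 * starRingEnd ℂ (propagatorSymbol α t' p.2) *
      propagatorSymbol α t' (ξ - p.1 + p.2)) *
      (V p.1 * starRingEnd ℂ (V p.2) * V (ξ - p.1 + p.2)))) * e2
  exact (Lp.fourierTransformₗᵢ ℝ ℂ).injective key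

/-- Duhamel's formula in the profile variable. -/
theorem duhamel_state {σ α s : ℝ} (hs : 1 / 2 < s) {I : Set ℝ} (hI : I.OrdConnected)
    (h0 : (0 : ℝ) ∈ I) {V : ℝ → L2} (hV : ContinuousOn V I) {u₀ : L2} (hu₀ : MemH s u₀)
    {u : ℝ → L2} (hu : ∀ t ∈ I, u t = state α s t (V t)) {t : ℝ} (ht : t ∈ I) :
    propagator α t u₀ - (Complex.I * (σ : ℂ)) •
      ∫ t' in (0 : ℝ)..t, propagator α (t - t') (cubic (u t')) =
    state α s t (lift s u₀ + ∫ t' in (0 : ℝ)..t, nl σ α s t' (V t')) := by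
  have hs0 : 0 ≤ s := by linarith
  have hsub := hI.uIcc_subset h0 ht
  have hInt : IntervalIntegrable (fun t' => triL (nlKer α s t') (V t') (V t') (V t')) volume 0 t :=
    ((continuousOn_triL_nlKer hs hV).mono hsub).intervalIntegrable
  have e1 : ∫ t' in (0 : ℝ)..t, propagator α (t - t') (cubic (u t')) =
      ∫ t' in (0 : ℝ)..t, stateCLM α s t hs0 (triL (nlKer α s t') (V t') (V t') (V t')) := by
    refine intervalIntegral.integral_congr fun t' ht' => ?_
    rw [hu t' (hsub ht'), propagator_cubic_state hs, stateCLM_apply]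
  rw [e1, ContinuousLinearMap.intervalIntegral_comp_comm _ hInt, propagator_eq_state α t hs0 hu₀,
    ← stateCLM_apply α t hs0, ← stateCLM_apply α t hs0, map_add]
  simp only [nl]
  rw [intervalIntegral.integral_smul, map_smul, neg_smul, sub_eq_add_neg]

/-- Duhamel's formula at time `t` is the image of the profile equation under the map `state α s t`,
which is injective. -/
theorem IsSolution.isFlow {σ α s : ℝ} (hs : 1 / 2 < s) {u₀ : L2} {I : Set ℝ} {u : ℝ → L2}
    (h : IsSolution σ α s u₀ I u) :
    IsFlow σ α s (lift s u₀) I (fun t => profile α s t (u t)) := by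
  have hs0 : 0 ≤ s := by linarith
  obtain ⟨hmem, hcont⟩ := continuousInH_iff.1 h.continuous
  have hVc : ContinuousOn (fun t => profile α s t (u t)) I := fun t ht =>
    tendsto_pmul (fun τ => isContr_propagatorSymbol α (-τ)) (isContr_propagatorSymbol α (-t))
      (fun ξ => (((continuous_propagatorSymbol_time α ξ).comp continuous_neg).tendsto t).mono_left
        nhdsWithin_le_nhds) (hcont t ht)
  have hu : ∀ t ∈ I, u t = state α s t (profile α s t (u t)) := fun t ht =>
    (state_profile α t hs0 (hmem t ht)).symm
  refine ⟨h.ordConnected, h.zero_mem, hVc, fun t ht => ?_⟩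
  refine state_injective α t hs0 ?_
  rw [← duhamel_state hs h.ordConnected h.zero_mem hVc h.data_mem hu ht, ← h.duhamel t ht,
    state_profile α t hs0 (hmem t ht)]

theorem IsFlow.isSolution {σ α s : ℝ} (hs : 1 / 2 < s) {u₀ : L2} (hu₀ : MemH s u₀) {I : Set ℝ}
    {V : ℝ → L2} (h : IsFlow σ α s (lift s u₀) I V) :
    IsSolution σ α s u₀ I (fun t => state α s t (V t)) := by
  have hs0 : 0 ≤ s := by linarith
  refine ⟨h.ordConnected, h.zero_mem, hu₀, continuousInH_iff.2 ⟨fun t _ => memH_state α t hs0 _,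
    ?_⟩, fun t ht => ?_⟩
  · simp only [lift_state α _ hs0]
    exact fun t ht => tendsto_pmul (isContr_propagatorSymbol α) (isContr_propagatorSymbol α t)
      (fun ξ => ((continuous_propagatorSymbol_time α ξ).tendsto t).mono_left
        nhdsWithin_le_nhds) (h.continuousOn t ht)
  · rw [duhamel_state hs h.ordConnected h.zero_mem h.continuousOn hu₀ (fun _ _ => rfl) ht,
      ← h.integral_eq t ht]

theorem IsFlow.zero_eq {σ α s : ℝ} {V₀ : L2} {I : Set ℝ} {V : ℝ → L2} (h : IsFlow σ α s V₀ I V) :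
    V 0 = V₀ := by
  simpa using h.integral_eq 0 h.zero_mem

/-- Unlike the solution, the profile is differentiable at full regularity: its equation involves no
unbounded operator. -/
theorem IsFlow.hasDerivAt {σ α s : ℝ} (hs : 1 / 2 < s) {V₀ : L2} {I : Set ℝ} {V : ℝ → L2}
    (h : IsFlow σ α s V₀ I V) {t : ℝ} (ht : I ∈ 𝓝 t) :
    HasDerivAt V (nl σ α s t (V t)) t := by
  have hn := continuousOn_nl σ α hs h.continuousOn
  have htI := mem_of_mem_nhds ht
  have hmeas : StronglyMeasurableAtFilter (fun τ => nl σ α s τ (V τ)) (𝓝 t) volume := by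
    refine ⟨interior I, interior_mem_nhds.2 ht, ?_⟩
    exact (hn.mono interior_subset).aestronglyMeasurable isOpen_interior.measurableSet
  have h1 := intervalIntegral.integral_hasDerivAt_right
    ((hn.mono (h.ordConnected.uIcc_subset h.zero_mem htI)).intervalIntegrable) hmeas
    (hn.continuousAt ht)
  have h2 := h1.const_add V₀
  refine h2.congr_of_eventuallyEq ?_
  filter_upwards [ht] with τ hτ
  exact h.integral_eq τ hτ

end

noncomputable section

/-! ### The normal form -/

theorem continuousOn_primitive_of_ordConnected {E : Type*} [NormedAddCommGroup E] [NormedSpace ℝ E]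
    {I : Set ℝ} (hI : I.OrdConnected) {a : ℝ} (ha : a ∈ I) {f : ℝ → E} (hf : ContinuousOn f I) :
    ContinuousOn (fun t => ∫ x in a..t, f x) I := by
  intro t₀ ht₀
  have hInt : ∀ x ∈ I, ∀ y ∈ I, IntervalIntegrable f volume x y := fun x hx y hy =>
    (hf.mono (hI.uIcc_subset hx hy)).intervalIntegrable
  rw [ContinuousWithinAt, tendsto_iff_norm_sub_tendsto_zero]
  have hb : ∀ᶠ x in 𝓝[I] t₀, ‖f x‖ < ‖f t₀‖ + 1 :=
    (hf t₀ ht₀).norm.eventually (gt_mem_nhds (by linarith))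
  obtain ⟨δ, hδ, hball⟩ := Metric.mem_nhdsWithin_iff.1 hb
  have hlim : Tendsto (fun t => (‖f t₀‖ + 1) * |t - t₀|) (𝓝[I] t₀) (𝓝 0) := by
    have : Continuous fun t => (‖f t₀‖ + 1) * |t - t₀| := by fun_prop
    have h := (this.tendsto t₀).mono_left (nhdsWithin_le_nhds (s := I))
    simpa using h
  refine squeeze_zero' (Eventually.of_forall fun t => norm_nonneg _) ?_ hlim
  filter_upwards [self_mem_nhdsWithin,
    mem_nhdsWithin_of_mem_nhds (Metric.ball_mem_nhds t₀ hδ)] with t ht hdist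
  rw [intervalIntegral.integral_interval_sub_left (hInt a ha t ht) (hInt a ha t₀ ht₀)]
  refine intervalIntegral.norm_integral_le_of_norm_le_const fun x hx => ?_
  have hx' := Set.uIoc_subset_uIcc hx
  refine (hball ⟨?_, hI.uIcc_subset ht₀ ht hx'⟩).le
  rw [Metric.mem_ball, Real.dist_eq] at *
  exact (Set.abs_sub_left_of_mem_uIcc hx').trans_lt hdist

/-- The cubic term of the normal form. -/
def nfTerm (α r s t : ℝ) (V : L2) : L2 := triL (nfKer α r s t) V V V

/-- The quintic term of the normal form. -/
def nfQuintic (σ α r s t : ℝ) (V : L2) : L2 :=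
  triL (nfKer α r s t) (nl σ α s t V) V V + triL (nfKer α r s t) V (nl σ α s t V) V +
    triL (nfKer α r s t) V V (nl σ α s t V)

/-- The time derivative of the normal form kernel stays bounded by the weights, as `(1 + iΦ)⁻¹ - 1 =
-iΦ(1 + iΦ)⁻¹` has modulus at most one. -/
theorem isDom_nfKer_sub_nlKer (α s t : ℝ) : IsDom (wKer s s fun _ _ _ => 1)
    fun ξ x y => nfKer α s s t ξ x y - nlKer α s t ξ x y := by
  have := isDom_of_norm_le_one (r := s) (s := s)
    (k := fun ξ x y => osc α t ξ x y * (res α ξ x y - 1))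
    ((measurable_osc α t).mul ((measurable_res α).sub_const 1)) fun ξ x y => by
      rw [norm_mul, norm_osc, one_mul]
      have h2 := norm_res_mul_rpow_le zero_le_one le_rfl (abs_nonneg _)
        (le_refl |phase α ξ x y|)
      rw [Real.rpow_one] at h2
      have e : res α ξ x y - 1 = -(Complex.I * (phase α ξ x y : ℂ)) * res α ξ x y := by
        have := one_add_I_mul_ne_zero (phase α ξ x y)
        simp only [res]
        field_simp
        ring
      rw [e, norm_mul, norm_neg, norm_mul, Complex.norm_I, one_mul, Complex.norm_real,
        Real.norm_eq_abs, mul_comm]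
      exact h2
  convert this using 4 with ξ x y
  simp only [nfKer, nlKer]
  ring

theorem IsFlow.hasDerivAt_nfTerm {σ α s : ℝ} (hs : 1 / 2 < s) {V₀ : L2} {I : Set ℝ} {V : ℝ → L2}
    (h : IsFlow σ α s V₀ I V) {t : ℝ} (ht : I ∈ 𝓝 t) :
    HasDerivAt (fun τ => nfTerm α s s τ (V τ))
      (nfTerm α s s t (V t) - triL (nlKer α s t) (V t) (V t) (V t) +
        nfQuintic σ α s s t (V t)) t := by
  obtain ⟨C, hM⟩ := exists_isBddKernel_algebra hs
  have hd := hM.hasDerivAt_triL (isDom_nfKer α s s) (isDom_nfKer_sub_nlKer α s t)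
    (isDom_nfKer_slope α s s t) (hasDerivAt_nfKer α s t) (h.hasDerivAt hs ht)
  have e : triL (fun ξ x y => nfKer α s s t ξ x y - nlKer α s t ξ x y) (V t) (V t) (V t) =
      nfTerm α s s t (V t) - triL (nlKer α s t) (V t) (V t) (V t) :=
    Lp.ext ((hM.coeFn (isDom_nfKer_sub_nlKer α s t) _ _ _).trans
      (hM.triL_mult_sub (isDom_nfKer α s s t) (isDom_nlKer α s t) _ _ _).symm)
  rw [e] at hd
  exact hd

theorem continuousOn_nfTerm {M : ℝ → ℝ → ℝ → ℝ≥0∞} {C : ℝ} (hM : IsBddKernel M C) {α r s : ℝ}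
    (hD : ∀ t, IsDom M (nfKer α r s t)) {I : Set ℝ} {V : ℝ → L2} (hV : ContinuousOn V I) :
    ContinuousOn (fun t => nfTerm α r s t (V t)) I :=
  continuousOn_triL_of_isBddKernel hM hD (continuous_nfKer_time α r s) hV hV hV

theorem continuousOn_nfQuintic {M : ℝ → ℝ → ℝ → ℝ≥0∞} {C : ℝ} (hM : IsBddKernel M C) (σ : ℝ)
    {α r s : ℝ} (hs : 1 / 2 < s) (hD : ∀ t, IsDom M (nfKer α r s t)) {I : Set ℝ} {V : ℝ → L2}
    (hV : ContinuousOn V I) : ContinuousOn (fun t => nfQuintic σ α r s t (V t)) I := by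
  have hn := continuousOn_nl σ α hs hV
  have hc := continuous_nfKer_time α r s
  exact ((continuousOn_triL_of_isBddKernel hM hD hc hn hV hV).add
    (continuousOn_triL_of_isBddKernel hM hD hc hV hn hV)).add
    (continuousOn_triL_of_isBddKernel hM hD hc hV hV hn)

theorem mem_nhds_of_mem_Ioo_min_max {I : Set ℝ} (hI : I.OrdConnected) {a b x : ℝ} (ha : a ∈ I)
    (hb : b ∈ I) (hx : x ∈ Set.Ioo (min a b) (max a b)) : I ∈ 𝓝 x :=
  mem_of_superset (isOpen_Ioo.mem_nhds hx)
    (Set.Ioo_subset_Icc_self.trans (hI.uIcc_subset ha hb))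

/-- The normal form transformation of the profile equation. -/
theorem IsFlow.normal_form {σ α s : ℝ} (hs : 1 / 2 < s) {V₀ : L2} {I : Set ℝ} {V : ℝ → L2}
    (h : IsFlow σ α s V₀ I V) {t : ℝ} (ht : t ∈ I) :
    V t - V₀ = -(Complex.I * (σ : ℂ)) •
      ((∫ τ in (0 : ℝ)..t, (nfTerm α s s τ (V τ) + nfQuintic σ α s s τ (V τ))) -
        (nfTerm α s s t (V t) - nfTerm α s s 0 (V 0))) := by
  obtain ⟨C, hM⟩ := exists_isBddKernel_algebra hs
  have hsub := h.ordConnected.uIcc_subset h.zero_mem ht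
  have cB := (continuousOn_nfTerm hM (isDom_nfKer α s s) h.continuousOn).mono hsub
  have cQ := (continuousOn_nfQuintic hM σ hs (isDom_nfKer α s s) h.continuousOn).mono hsub
  have cN := (continuousOn_triL_nlKer (α := α) hs h.continuousOn).mono hsub
  -- The derivative is available in the interior of the interval only; continuity up to the
  -- endpoints suffices.
  have hFTC := intervalIntegral.integral_eq_sub_of_hasDeriv_right cB
    (fun x hx => (h.hasDerivAt_nfTerm hs (mem_nhds_of_mem_Ioo_min_max h.ordConnected h.zero_mem ht
      hx)).hasDerivWithinAt) ((cB.sub cN).add cQ).intervalIntegrable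
  have i1 : IntervalIntegrable (fun τ => nfTerm α s s τ (V τ) + nfQuintic σ α s s τ (V τ))
      volume 0 t := (cB.add cQ).intervalIntegrable
  have i2 : IntervalIntegrable (fun τ => nfTerm α s s τ (V τ) -
      triL (nlKer α s τ) (V τ) (V τ) (V τ) + nfQuintic σ α s s τ (V τ)) volume 0 t :=
    ((cB.sub cN).add cQ).intervalIntegrable
  rw [← hFTC, ← intervalIntegral.integral_sub i1 i2, h.integral_eq t ht, add_sub_cancel_left]
  simp only [nl]
  rw [intervalIntegral.integral_smul]
  congr 1
  refine intervalIntegral.integral_congr fun τ _ => ?_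
  abel

theorem pmul_triL_nfKer {α s a t : ℝ} (ha : 0 ≤ a) {C C' : ℝ} {M : ℝ → ℝ → ℝ → ℝ≥0∞}
    (hM : IsBddKernel M C) (hD : IsDom M (nfKer α (s + a) s t))
    (hM' : IsBddKernel (wKer s s fun _ _ _ => 1) C') (F G H : L2) :
    pmul (wtc (-a)) (triL (nfKer α (s + a) s t) F G H) = triL (nfKer α s s t) F G H := by
  refine Lp.ext ?_
  filter_upwards [(isContr_wtc (r := -a) (by linarith)).coeFn (triL (nfKer α (s + a) s t) F G H),
    hM.coeFn hD F G H, hM'.coeFn (isDom_nfKer α s s t) F G H] with ξ h1 h2 h3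
  rw [h1, h2, h3, tri, tri, ← integral_const_mul]
  congr 1
  ext p
  simp only [nfKer, wKerC]
  have e : wtc (-a) ξ * wtc (s + a) ξ = wtc s ξ := by rw [wtc_mul_wtc]; ring_nf
  rw [← e]
  ring

/-- The smoother part of the profile. -/
def smoothPart (σ α s a : ℝ) (V : ℝ → L2) (t : ℝ) : L2 := -(Complex.I * (σ : ℂ)) •
  ((∫ τ in (0 : ℝ)..t, (nfTerm α (s + a) s τ (V τ) + nfQuintic σ α (s + a) s τ (V τ))) -
    (nfTerm α (s + a) s t (V t) - nfTerm α (s + a) s 0 (V 0)))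

/-- Time is differentiated at the level of `H^s`, where the differentiated kernel is bounded. In the
resulting identity every term contains `(1 + iΦ)⁻¹`, so it also makes sense with output weight `s +
a`; multiplication by `⟨ξ⟩^{-a}` compares the two versions term by term. -/
theorem IsFlow.pmul_smoothPart {σ α s a : ℝ} (hα : 1 / 2 < α) (hα' : α ≤ 1) (hs : 1 / 2 < s)
    (ha : 0 < a) (ha' : a < 2 * α - 1) {V₀ : L2} {I : Set ℝ} {V : ℝ → L2}
    (h : IsFlow σ α s V₀ I V) {t : ℝ} (ht : t ∈ I) :
    pmul (wtc (-a)) (smoothPart σ α s a V t) = V t - V₀ := by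
  obtain ⟨C', hM'⟩ := exists_isBddKernel_algebra hs
  obtain ⟨C, hM⟩ := exists_isBddKernel_smoothing hα hα' hs ha ha'
  have hD := isDom_nfKer_res α (s + a) s
  have hsub := h.ordConnected.uIcc_subset h.zero_mem ht
  have cB := (continuousOn_nfTerm hM hD h.continuousOn).mono hsub
  have cQ := (continuousOn_nfQuintic hM σ hs hD h.continuousOn).mono hsub
  have hc := isContr_wtc (r := -a) (by linarith)
  have hB : ∀ τ W, pmul (wtc (-a)) (nfTerm α (s + a) s τ W) = nfTerm α s s τ W := fun τ W =>
    pmul_triL_nfKer ha.le hM (hD τ) hM' _ _ _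
  have hQ : ∀ τ W, pmul (wtc (-a)) (nfQuintic σ α (s + a) s τ W) = nfQuintic σ α s s τ W := by
    intro τ W
    simp only [nfQuintic, hc.pmul_add, pmul_triL_nfKer ha.le hM (hD τ) hM']
  rw [smoothPart, hc.pmul_smul, hc.pmul_sub, hc.pmul_sub, hB, hB, h.normal_form hs ht]
  congr 2
  have i1 : IntervalIntegrable (fun τ => nfTerm α (s + a) s τ (V τ) +
      nfQuintic σ α (s + a) s τ (V τ)) volume 0 t := (cB.add cQ).intervalIntegrable
  rw [← mulCLM_apply hc, ← ContinuousLinearMap.intervalIntegral_comp_comm _ i1]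
  refine intervalIntegral.integral_congr fun τ _ => ?_
  simp only [mulCLM_apply, hc.pmul_add, hB, hQ]

theorem IsFlow.continuousOn_smoothPart {σ α s a : ℝ} (hα : 1 / 2 < α) (hα' : α ≤ 1)
    (hs : 1 / 2 < s) (ha : 0 < a) (ha' : a < 2 * α - 1) {V₀ : L2} {I : Set ℝ} {V : ℝ → L2}
    (h : IsFlow σ α s V₀ I V) : ContinuousOn (smoothPart σ α s a V) I := by
  obtain ⟨C, hM⟩ := exists_isBddKernel_smoothing hα hα' hs ha ha'
  have hD := isDom_nfKer_res α (s + a) s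
  have cB := continuousOn_nfTerm hM hD h.continuousOn
  have cQ := continuousOn_nfQuintic hM σ hs hD h.continuousOn
  have := ((continuousOn_primitive_of_ordConnected h.ordConnected h.zero_mem (cB.add cQ)).sub
    (cB.sub (continuousOn_const (c := nfTerm α (s + a) s 0 (V 0))))).const_smul
    (-(Complex.I * (σ : ℂ)))
  exact this

/-- The difference between a solution and the linear evolution, in the profile variable. -/
theorem memH_and_lift_sub_propagator {σ α s a : ℝ} (hα : 1 / 2 < α) (hα' : α ≤ 1) (hs : 1 / 2 < s)
    (ha : 0 < a) (ha' : a < 2 * α - 1) {u₀ : L2} {I : Set ℝ} {u : ℝ → L2}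
    (h : IsSolution σ α s u₀ I u) {t : ℝ} (ht : t ∈ I) :
    MemH (s + a) (u t - propagator α t u₀) ∧ lift (s + a) (u t - propagator α t u₀) =
      pmul (propagatorSymbol α t) (smoothPart σ α s a (fun τ => profile α s τ (u τ)) t) := by
  have hs0 : 0 ≤ s := by linarith
  have hf := h.isFlow hs
  refine memH_and_lift_eq (by linarith) ?_
  have hp := isContr_propagatorSymbol α t
  have ca := isContr_wtc (r := -a) (by linarith)
  have cs := isContr_wtc (r := -s) (by linarith)
  have e1 : u t - propagator α t u₀ =
      state α s t (profile α s t (u t) - lift s u₀) := by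
    rw [← stateCLM_apply α t hs0, map_sub, stateCLM_apply, stateCLM_apply,
      state_profile α t hs0 (h.continuous.1 t ht), propagator_eq_state α t hs0 h.data_mem]
  rw [e1, fourier_state, ← hf.pmul_smoothPart hα hα' hs ha ha' ht, pmul_comm hp ca,
    cs.pmul_pmul ca]
  congr 1
  ext ξ
  rw [wtc_mul_wtc]
  ring_nf

theorem continuousInH_sub_propagator {σ α s a : ℝ} (hα : 1 / 2 < α) (hα' : α ≤ 1) (hs : 1 / 2 < s)
    (ha : 0 < a) (ha' : a < 2 * α - 1) {u₀ : L2} {I : Set ℝ} {u : ℝ → L2}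
    (h : IsSolution σ α s u₀ I u) :
    ContinuousInH (s + a) I (fun t => u t - propagator α t u₀) := by
  have key := fun t (ht : t ∈ I) => memH_and_lift_sub_propagator hα hα' hs ha ha' h ht
  refine continuousInH_iff.2 ⟨fun t ht => (key t ht).1, ?_⟩
  have hW := (h.isFlow hs).continuousOn_smoothPart hα hα' hs ha ha'
  have : ContinuousOn (fun t => pmul (propagatorSymbol α t)
      (smoothPart σ α s a (fun τ => profile α s τ (u τ)) t)) I := fun t ht =>
    tendsto_pmul (isContr_propagatorSymbol α) (isContr_propagatorSymbol α t)
      (fun ξ => ((continuous_propagatorSymbol_time α ξ).tendsto t).mono_left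
        nhdsWithin_le_nhds) (hW t ht)
  exact this.congr fun t ht => (key t ht).2

/-! ### The quantitative bound -/

/-- The nonlinearity does not depend on the exponent that defines the profile, so its lower norm may
be estimated by the algebra property of `H^{s₀}`. -/
theorem pmul_triL_nlKer {α s s₀ : ℝ} (hs₀ : 1 / 2 < s₀) (h : s₀ ≤ s) (t : ℝ) (F G H : L2) :
    pmul (wtc (s₀ - s)) (triL (nlKer α s t) F G H) = triL (nlKer α s₀ t)
      (pmul (wtc (s₀ - s)) F) (pmul (wtc (s₀ - s)) G) (pmul (wtc (s₀ - s)) H) := by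
  obtain ⟨C, hM⟩ := exists_isBddKernel_algebra (s := s) (by linarith)
  obtain ⟨C', hM'⟩ := exists_isBddKernel_algebra hs₀
  have hc := isContr_wtc (r := s₀ - s) (by linarith)
  refine Lp.ext ?_
  filter_upwards [hc.coeFn (triL (nlKer α s t) F G H), hM.coeFn (isDom_nlKer α s t) F G H,
    hM'.coeFn (isDom_nlKer α s₀ t) (pmul (wtc (s₀ - s)) F) (pmul (wtc (s₀ - s)) G)
      (pmul (wtc (s₀ - s)) H)] with ξ h1 h2 h3
  rw [h1, h2, h3, tri_congr (hc.coeFn F) (hc.coeFn G) (hc.coeFn H), tri, tri, ← integral_const_mul]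
  congr 1
  ext p
  simp only [nlKer, wKerC, map_mul]
  have e0 : starRingEnd ℂ (wtc (s₀ - s) p.2) = wtc (s₀ - s) p.2 := Complex.conj_ofReal _
  have e1 : wtc (s₀ - s) ξ * wtc s ξ = wtc s₀ ξ := by rw [wtc_mul_wtc]; ring_nf
  have e2 : ∀ z, wtc (-s) z = wtc (-s₀) z * wtc (s₀ - s) z := fun z => by
    rw [wtc_mul_wtc]; ring_nf
  rw [e0, ← e1, e2 p.1, e2 p.2, e2 (ξ - p.1 + p.2)]
  ring

theorem norm_I_mul_sign {σ : ℝ} (hσ : σ = 1 ∨ σ = -1) : ‖-(Complex.I * (σ : ℂ))‖ = 1 := by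
  rcases hσ with rfl | rfl <;> simp

theorem norm_nl {σ : ℝ} (hσ : σ = 1 ∨ σ = -1) (α s t : ℝ) (V : L2) :
    ‖nl σ α s t V‖ = ‖triL (nlKer α s t) V V V‖ := by
  rw [nl, norm_smul, norm_I_mul_sign hσ, one_mul]

theorem exists_norm_nl_le {s s₀ : ℝ} (hs₀ : 1 / 2 < s₀) (h : s₀ ≤ s) :
    ∃ C, 0 ≤ C ∧ ∀ α σ : ℝ, (σ = 1 ∨ σ = -1) → ∀ t V,
      ‖nl σ α s t V‖ ≤ C * (‖V‖ * low s s₀ V ^ 2) := by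
  obtain ⟨C, hC, H⟩ := exists_algebra_estimate (s := s) (by linarith) hs₀
  refine ⟨3 * Real.sqrt C.toReal, by positivity, fun α σ hσ t V => ?_⟩
  rw [norm_nl hσ]
  refine (norm_triL_le_tame hC h (by simpa only [mul_one] using H)
    (isDom_nlKer α s t).enorm_le V V V).trans (le_of_eq ?_)
  ring

theorem exists_low_nl_le {s s₀ : ℝ} (hs₀ : 1 / 2 < s₀) (h : s₀ ≤ s) :
    ∃ C, 0 ≤ C ∧ ∀ α σ : ℝ, (σ = 1 ∨ σ = -1) → ∀ t V,
      low s s₀ (nl σ α s t V) ≤ C * low s s₀ V ^ 3 := by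
  obtain ⟨C, hM⟩ := exists_isBddKernel_algebra hs₀
  refine ⟨C, hM.nonneg, fun α σ hσ t V => ?_⟩
  rw [low, nl, (isContr_wtc (by linarith)).pmul_smul, norm_smul, norm_I_mul_sign hσ, one_mul,
    pmul_triL_nlKer hs₀ h]
  refine (hM.norm_triL_le (isDom_nlKer α s₀ t) _ _ _).trans (le_of_eq ?_)
  rw [low]
  ring

theorem continuousOn_low {s s₀ : ℝ} (h : s₀ ≤ s) {I : Set ℝ} {V : ℝ → L2}
    (hV : ContinuousOn V I) : ContinuousOn (fun t => low s s₀ (V t)) I :=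
  ((isContr_wtc (r := s₀ - s) (by linarith)).continuous.comp_continuousOn hV).norm

/-- The tame smoothing estimate applied to the boundary terms, the cubic integral and the quintic
integral. -/
theorem exists_norm_smoothPart_le {α s a s₀ : ℝ} (hα : 1 / 2 < α) (hα' : α ≤ 1)
    (hs₀ : 1 / 2 < s₀) (h : s₀ ≤ s) (ha : 0 < a) (ha' : a < 2 * α - 1) :
    ∃ C, 0 ≤ C ∧ ∀ σ : ℝ, (σ = 1 ∨ σ = -1) → ∀ V₀ I V, IsFlow σ α s V₀ I V → ∀ t ∈ I,
      ‖smoothPart σ α s a V t‖ ≤ C * (‖V 0‖ * low s s₀ (V 0) ^ 2 +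
        ‖V t‖ * low s s₀ (V t) ^ 2 +
        |∫ τ in (0 : ℝ)..t, ‖V τ‖ * (low s s₀ (V τ) ^ 2 + low s s₀ (V τ) ^ 4)|) := by
  have hs : 1 / 2 < s := by linarith
  obtain ⟨C₀, hC₀, H⟩ := exists_smoothing_estimate (s := s) hα hα' (by linarith) ha ha' hs₀
  obtain ⟨C₂, hC₂, H₂⟩ := exists_norm_nl_le hs₀ h
  obtain ⟨C₃, hC₃, H₃⟩ := exists_low_nl_le hs₀ h
  set C₁ := Real.sqrt C₀.toReal
  have hC₁ : 0 ≤ C₁ := Real.sqrt_nonneg _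
  have T : ∀ t F G J, ‖triL (nfKer α (s + a) s t) F G J‖ ≤ C₁ * (‖F‖ * low s s₀ G * low s s₀ J +
      low s s₀ F * ‖G‖ * low s s₀ J + low s s₀ F * low s s₀ G * ‖J‖) := fun t F G J =>
    norm_triL_le_tame hC₀ h H (isDom_nfKer_res α (s + a) s t).enorm_le F G J
  have hB : ∀ t V, ‖nfTerm α (s + a) s t V‖ ≤ 3 * C₁ * (‖V‖ * low s s₀ V ^ 2) := fun t V =>
    (T t V V V).trans (le_of_eq (by ring))
  have hQ : ∀ σ : ℝ, (σ = 1 ∨ σ = -1) → ∀ t V, ‖nfQuintic σ α (s + a) s t V‖ ≤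
      3 * C₁ * (C₂ + 2 * C₃) * (‖V‖ * low s s₀ V ^ 4) := by
    intro σ hσ t V
    have hN := H₂ α σ hσ t V
    have hL := H₃ α σ hσ t V
    have nV := low_nonneg s s₀ V
    have nN := low_nonneg s s₀ (nl σ α s t V)
    set N := nl σ α s t V
    -- In the quintic term the high norm falls either on the inner nonlinearity, bounded tamely, or
    -- on an outer factor, and then the inner one costs only the cube of the low norm.
    have key : ‖N‖ * low s s₀ V ^ 2 + 2 * (low s s₀ N * ‖V‖ * low s s₀ V) ≤
        (C₂ + 2 * C₃) * (‖V‖ * low s s₀ V ^ 4) := by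
      calc _ ≤ (C₂ * (‖V‖ * low s s₀ V ^ 2)) * low s s₀ V ^ 2 +
            2 * ((C₃ * low s s₀ V ^ 3) * ‖V‖ * low s s₀ V) := by gcongr
        _ = _ := by ring
    calc _ ≤ ‖triL (nfKer α (s + a) s t) N V V‖ + ‖triL (nfKer α (s + a) s t) V N V‖ +
          ‖triL (nfKer α (s + a) s t) V V N‖ := norm_add₃_le
      _ ≤ _ := add_le_add (add_le_add (T t N V V) (T t V N V)) (T t V V N)
      _ = 3 * C₁ * (‖N‖ * low s s₀ V ^ 2 + 2 * (low s s₀ N * ‖V‖ * low s s₀ V)) := by ring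
      _ ≤ 3 * C₁ * ((C₂ + 2 * C₃) * (‖V‖ * low s s₀ V ^ 4)) := by gcongr
      _ = _ := by ring
  set D := 3 * C₁ * (1 + C₂ + 2 * C₃) with hD
  have hD0 : 0 ≤ D := by positivity
  refine ⟨D, hD0, fun σ hσ V₀ I V hV t ht => ?_⟩
  have hsub := hV.ordConnected.uIcc_subset hV.zero_mem ht
  have hVc := hV.continuousOn.mono hsub
  have hlow := continuousOn_low h hVc
  have hInt : ‖∫ τ in (0 : ℝ)..t, (nfTerm α (s + a) s τ (V τ) + nfQuintic σ α (s + a) s τ (V τ))‖ ≤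
      D * |∫ τ in (0 : ℝ)..t, ‖V τ‖ * (low s s₀ (V τ) ^ 2 + low s s₀ (V τ) ^ 4)| := by
    have h1 : IntervalIntegrable (fun τ => D * (‖V τ‖ * (low s s₀ (V τ) ^ 2 +
        low s s₀ (V τ) ^ 4))) volume 0 t :=
      (continuousOn_const.mul (hVc.norm.mul ((hlow.pow 2).add (hlow.pow 4)))).intervalIntegrable
    refine (intervalIntegral.norm_integral_le_abs_of_norm_le (Eventually.of_forall fun τ => ?_)
      h1).trans (le_of_eq ?_)
    · have nV := low_nonneg s s₀ (V τ)
      calc _ ≤ ‖nfTerm α (s + a) s τ (V τ)‖ + ‖nfQuintic σ α (s + a) s τ (V τ)‖ := norm_add_le _ _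
        _ ≤ 3 * C₁ * (‖V τ‖ * low s s₀ (V τ) ^ 2) +
            3 * C₁ * (C₂ + 2 * C₃) * (‖V τ‖ * low s s₀ (V τ) ^ 4) :=
            add_le_add (hB _ _) (hQ σ hσ _ _)
        _ ≤ D * (‖V τ‖ * low s s₀ (V τ) ^ 2) + D * (‖V τ‖ * low s s₀ (V τ) ^ 4) := by
            gcongr
            · rw [hD]; nlinarith [mul_nonneg hC₁ hC₂, mul_nonneg hC₁ hC₃]
            · rw [hD]; gcongr; linarith
        _ = _ := by ring
    · rw [intervalIntegral.integral_const_mul, abs_mul, abs_of_nonneg hD0]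
  have h3D : 3 * C₁ ≤ D := by rw [hD]; nlinarith [mul_nonneg hC₁ hC₂, mul_nonneg hC₁ hC₃]
  have hB' : ∀ τ W, ‖nfTerm α (s + a) s τ W‖ ≤ D * (‖W‖ * low s s₀ W ^ 2) := fun τ W =>
    (hB τ W).trans (mul_le_mul_of_nonneg_right h3D
      (mul_nonneg (norm_nonneg _) (sq_nonneg _)))
  rw [smoothPart, norm_smul, norm_I_mul_sign hσ, one_mul]
  refine (norm_sub_le _ _).trans ((add_le_add hInt ((norm_sub_le _ _).trans
    (add_le_add (hB' t (V t)) (hB' 0 (V 0))))).trans (le_of_eq ?_))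
  ring

theorem exists_sobolevNorm_sub_propagator_le {α s a s₀ : ℝ} (hα : 1 / 2 < α) (hα' : α ≤ 1)
    (hs₀ : 1 / 2 < s₀) (h : s₀ ≤ s) (ha : 0 < a) (ha' : a < 2 * α - 1) :
    ∃ C, 0 ≤ C ∧ ∀ σ : ℝ, (σ = 1 ∨ σ = -1) → ∀ (u₀ : L2) (I : Set ℝ) (u : ℝ → L2),
      IsSolution σ α s u₀ I u → ∀ t ∈ I,
      sobolevNorm (s + a) (u t - propagator α t u₀) ≤
        C * (sobolevNorm s u₀ * sobolevNorm s₀ u₀ ^ 2 + sobolevNorm s (u t) *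
          sobolevNorm s₀ (u t) ^ 2 +
          |∫ τ in (0 : ℝ)..t, sobolevNorm s (u τ) *
            (sobolevNorm s₀ (u τ) ^ 2 + sobolevNorm s₀ (u τ) ^ 4)|) := by
  obtain ⟨C, hC, H⟩ := exists_norm_smoothPart_le hα hα' hs₀ h ha ha'
  have hs : 1 / 2 < s := by linarith
  have hs0 : 0 ≤ s := by linarith
  refine ⟨C, hC, fun σ hσ u₀ I u hu t ht => ?_⟩
  have hf := hu.isFlow hs
  obtain ⟨hm, hl⟩ := memH_and_lift_sub_propagator hα hα' hs ha ha' hu ht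
  rw [← norm_lift hm, hl,
    norm_pmul_eq (measurable_propagatorSymbol α t) (norm_propagatorSymbol α t)]
  refine (H σ hσ _ I _ hf t ht).trans (le_of_eq ?_)
  have e1 : ∀ τ ∈ I, ‖profile α s τ (u τ)‖ = sobolevNorm s (u τ) := fun τ hτ => by
    rw [← sobolevNorm_state α τ hs0, state_profile α τ hs0 (hu.continuous.1 τ hτ)]
  have e2 : ∀ τ ∈ I, low s s₀ (profile α s τ (u τ)) = sobolevNorm s₀ (u τ) := fun τ hτ => by
    rw [low, ← sobolevNorm_state_low α τ hs0 h, state_profile α τ hs0 (hu.continuous.1 τ hτ)]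
  have e3 : profile α s 0 (u 0) = lift s u₀ := hf.zero_eq
  have e4 : low s s₀ (lift s u₀) = sobolevNorm s₀ u₀ := by
    rw [low, pmul_lift hu.data_mem h, norm_lift (hu.data_mem.mono h)]
  rw [e1 t ht, e2 t ht, e3, e4, norm_lift hu.data_mem]
  congr 3
  refine intervalIntegral.integral_congr fun τ hτ => ?_
  have hτ' := hu.ordConnected.uIcc_subset hu.zero_mem ht hτ
  simp only [e1 τ hτ', e2 τ hτ']

end

noncomputable section

/-! ### Conservation laws -/

theorem inner_pmul_left {m n : ℝ → ℂ} (hm : IsContr m) (hn : IsContr n)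
    (h : ∀ ξ, starRingEnd ℂ (m ξ) = n ξ) (F G : L2) :
    inner ℂ (pmul m F) G = inner ℂ F (pmul n G) := by
  rw [L2.inner_def, L2.inner_def]
  refine integral_congr_ae ?_
  filter_upwards [hm.coeFn F, hn.coeFn G] with ξ h1 h2
  rw [h1, h2, RCLike.inner_apply, RCLike.inner_apply, map_mul, h]
  ring

theorem conj_wtc (r ξ : ℝ) : starRingEnd ℂ (wtc r ξ) = wtc r ξ := Complex.conj_ofReal _

/-- The function with `⟨ξ⟩^s û = W`. -/
def unlift (s : ℝ) (W : L2) : L2 := 𝓕⁻ (pmul (wtc (-s)) W)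

theorem fourier_unlift (s : ℝ) (W : L2) : (𝓕 (unlift s W) : L2) = pmul (wtc (-s)) W :=
  fourier_fourierInv_eq _

theorem isDom_wKerC (r s : ℝ) : IsDom (wKer r s fun _ _ _ => 1) (wKerC r s) :=
  ⟨measurable_wKerC r s, fun ξ x y => (enorm_wKerC r s ξ x y).le⟩

/-- The function `f ḡ h` in the variable `⟨ξ⟩^s û`. -/
theorem unlift_triL {s : ℝ} (hs : 1 / 2 < s) (F G H : L2) :
    (unlift s (triL (wKerC s s) F G H) : ℝ → ℂ) =ᵐ[volume]
      fun x => unlift s F x * starRingEnd ℂ (unlift s G x) * unlift s H x := by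
  obtain ⟨C, hM⟩ := exists_isBddKernel_algebra hs
  have hw := isContr_wtc (r := -s) (by linarith)
  have hi : ∀ W, Integrable ((𝓕 (unlift s W) : L2) : ℝ → ℂ) := fun W => by
    rw [fourier_unlift]
    exact integrable_pmul_wtc hs W
  have h := fourier_mul_conj_mul (hi F) (hi G) (hi H)
  have e : pmul (wtc (-s)) (triL (wKerC s s) F G H) =
      (memLp_tri_one (𝓕 (unlift s H) : L2) (hi F) (hi G)).toLp _ := by
    refine Lp.ext ?_
    have hco : ∀ W, ((𝓕 (unlift s W) : L2) : ℝ → ℂ) =ᵐ[volume] fun ξ => wtc (-s) ξ * W ξ :=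
      fun W => by rw [fourier_unlift]; exact hw.coeFn W
    filter_upwards [(memLp_tri_one (𝓕 (unlift s H) : L2) (hi F) (hi G)).coeFn_toLp,
      hw.coeFn (triL (wKerC s s) F G H), hM.coeFn (isDom_wKerC s s) F G H] with ξ h1 h2 h3
    rw [h1, h2, h3, tri_congr (hco F) (hco G) (hco H)]
    simp only [tri]
    rw [← integral_const_mul]
    congr 1
    ext p
    have e2 : wtc (-s) ξ * wtc s ξ = 1 := by rw [wtc_mul_wtc]; simp
    simp only [oneKer, wKerC, map_mul, conj_wtc]
    linear_combination ((wtc (-s) p.1 * wtc (-s) p.2 * wtc (-s) (ξ - p.1 + p.2)) *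
      (F p.1 * starRingEnd ℂ (G p.2) * H (ξ - p.1 + p.2))) * e2
  rw [← e] at h
  exact h

/-- The pairing of `f` with `g h̄ k`, in the variable `⟨ξ⟩^s û`. -/
theorem inner_pmul_triL {s : ℝ} (hs : 1 / 2 < s) (F G H K : L2) :
    inner ℂ (pmul (wtc (-(2 * s))) F) (triL (wKerC s s) G H K) =
      ∫ x, starRingEnd ℂ (unlift s F x) *
        (unlift s G x * starRingEnd ℂ (unlift s H x) * unlift s K x) := by
  have hw := isContr_wtc (r := -s) (by linarith)
  have e1 : pmul (wtc (-(2 * s))) F = pmul (wtc (-s)) (pmul (wtc (-s)) F) := by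
    rw [hw.pmul_pmul hw]
    congr 1
    ext ξ
    rw [wtc_mul_wtc]
    ring_nf
  rw [e1, inner_pmul_left hw hw (conj_wtc (-s)), ← fourier_unlift, ← fourier_unlift]
  have := (Lp.fourierTransformₗᵢ ℝ ℂ).inner_map_map (unlift s F)
    (unlift s (triL (wKerC s s) G H K))
  refine Eq.trans this ?_
  rw [L2.inner_def]
  refine integral_congr_ae ?_
  filter_upwards [unlift_triL hs G H K] with x hx
  rw [hx, RCLike.inner_apply]
  ring

/-- The potential energy `∫ |u|⁴`. -/
def quartic (s : ℝ) (W : L2) : ℝ := ∫ x, ‖unlift s W x‖ ^ 4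

theorem quartic_nonneg (s : ℝ) (W : L2) : 0 ≤ quartic s W :=
  integral_nonneg fun x => by positivity

theorem inner_pmul_triL_self {s : ℝ} (hs : 1 / 2 < s) (W : L2) :
    inner ℂ (pmul (wtc (-(2 * s))) W) (triL (wKerC s s) W W W) = (quartic s W : ℂ) := by
  rw [inner_pmul_triL hs, quartic, ← integral_complex_ofReal]
  congr 1
  ext x
  have := Complex.mul_conj' (unlift s W x)
  push_cast
  linear_combination (unlift s W x * starRingEnd ℂ (unlift s W x) + ‖unlift s W x‖ ^ 2) * this

/-- Polarization of the quartic functional. -/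
theorem quartic_sub {s : ℝ} (hs : 1 / 2 < s) (Z W : L2) :
    quartic s Z - quartic s W = (inner ℂ (pmul (wtc (-(2 * s))) Z - pmul (wtc (-(2 * s))) W)
      (triL (wKerC s s) Z Z Z + triL (wKerC s s) Z Z W + triL (wKerC s s) W W Z +
        triL (wKerC s s) W W W)).re := by
  -- The pointwise identity is `|z|⁴ - |w|⁴ = Re ((z̄ - w̄)(z + w)) (|z|² + |w|²)`. The mixed terms
  -- cancel after taking real parts.
  have e1 : ∀ F G H K : L2, (∫ x, starRingEnd ℂ (unlift s F x) *
        (unlift s G x * starRingEnd ℂ (unlift s H x) * unlift s K x)).re =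
      (∫ x, starRingEnd ℂ (unlift s K x) *
        (unlift s H x * starRingEnd ℂ (unlift s G x) * unlift s F x)).re := fun F G H K => by
    rw [← Complex.conj_re, ← integral_conj]
    congr 2
    ext x
    simp only [map_mul, Complex.conj_conj]
    ring
  have e2 : (∫ x, starRingEnd ℂ (unlift s Z x) *
        (unlift s W x * starRingEnd ℂ (unlift s W x) * unlift s Z x)) =
      ∫ x, starRingEnd ℂ (unlift s W x) *
        (unlift s Z x * starRingEnd ℂ (unlift s Z x) * unlift s W x) := by
    congr 1
    ext x
    ring
  have hself := fun W => congrArg Complex.re (inner_pmul_triL_self hs W)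
  simp only [inner_pmul_triL hs, Complex.ofReal_re] at hself
  rw [inner_sub_left]
  simp only [inner_add_right, inner_pmul_triL hs, Complex.sub_re, Complex.add_re]
  rw [hself, hself, e2, e1 W Z Z Z, e1 W W W Z]
  ring

/-- The multiplier of the kinetic energy. -/
def kinMult (α ξ : ℝ) : ℂ := ((|2 * Real.pi * ξ| ^ α * wt (-α) ξ : ℝ) : ℂ)

/-- The dispersion relation, normalized by `⟨ξ⟩^{-2α}`. -/
def dispMult (α ξ : ℝ) : ℂ := ((disp α ξ * wt (-(2 * α)) ξ : ℝ) : ℂ)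

theorem abs_rpow_mul_wt_le_one {r : ℝ} (hr : 0 ≤ r) (ξ : ℝ) :
    |2 * Real.pi * ξ| ^ r * wt (-r) ξ ≤ 1 := by
  calc _ ≤ wt r ξ * wt (-r) ξ :=
        mul_le_mul_of_nonneg_right (abs_rpow_le_wt hr ξ) (wt_nonneg _ _)
    _ = 1 := wt_mul_wt_neg r ξ

theorem isContr_kinMult {α : ℝ} (hα : 0 ≤ α) : IsContr (kinMult α) :=
  ⟨by unfold kinMult; fun_prop, fun ξ => by
    have := wt_nonneg (-α) ξ
    rw [kinMult, Complex.norm_real, Real.norm_of_nonneg (by positivity)]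
    exact abs_rpow_mul_wt_le_one hα ξ⟩

theorem isContr_dispMult {α : ℝ} (hα : 0 ≤ α) : IsContr (dispMult α) :=
  ⟨by unfold dispMult; fun_prop, fun ξ => by
    have := wt_nonneg (-(2 * α)) ξ
    rw [dispMult, disp, Complex.norm_real, Real.norm_of_nonneg (by positivity)]
    exact abs_rpow_mul_wt_le_one (by positivity) ξ⟩

theorem kinMult_mul_self {α : ℝ} (hα : 0 ≤ α) (ξ : ℝ) :
    kinMult α ξ * kinMult α ξ = dispMult α ξ := by
  have e : |2 * Real.pi * ξ| ^ (2 * α) = |2 * Real.pi * ξ| ^ α * |2 * Real.pi * ξ| ^ α := by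
    rw [two_mul α, Real.rpow_add_of_nonneg (abs_nonneg _) hα hα]
  have e2 : wt (-(2 * α)) ξ = wt (-α) ξ * wt (-α) ξ := by
    rw [wt_mul_wt]; ring_nf
  rw [kinMult, dispMult, disp, e, e2]
  push_cast
  ring

theorem hasDerivAt_propagatorSymbol (α t ξ : ℝ) : HasDerivAt (fun τ => propagatorSymbol α τ ξ)
    (Complex.I * (disp α ξ : ℂ) * propagatorSymbol α t ξ) t := by
  have h1 : HasDerivAt (fun τ : ℝ => Complex.I * ((τ * disp α ξ : ℝ) : ℂ))
      (Complex.I * (disp α ξ : ℂ)) t := by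
    have h2 : HasDerivAt (fun τ : ℝ => τ * disp α ξ) (1 * disp α ξ) t :=
      (hasDerivAt_id t).mul_const _
    rw [one_mul] at h2
    exact h2.ofReal_comp.const_mul Complex.I
  refine h1.cexp.congr_deriv ?_
  simp only [propagatorSymbol, disp]
  ring

theorem disp_nonneg (α ξ : ℝ) : 0 ≤ disp α ξ := by unfold disp; positivity

theorem norm_propagatorSymbol_sub_le (α t τ ξ : ℝ) :
    ‖propagatorSymbol α (t + τ) ξ - propagatorSymbol α t ξ‖ ≤ |τ| * disp α ξ := by
  have e : propagatorSymbol α (t + τ) ξ - propagatorSymbol α t ξ = propagatorSymbol α t ξ *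
      (Complex.exp (Complex.I * ((τ * disp α ξ : ℝ) : ℂ)) - 1) := by
    rw [propagatorSymbol_add, mul_sub, mul_one]
    rfl
  rw [e, norm_mul, norm_propagatorSymbol, one_mul]
  refine (Real.norm_exp_I_mul_ofReal_sub_one_le).trans (le_of_eq ?_)
  rw [Real.norm_eq_abs, abs_mul, abs_of_nonneg (disp_nonneg α ξ)]

/-- `⟨ξ⟩^{-2α} e^{itω} V` is differentiable in `L²`. -/
theorem hasDerivAt_pmul_propagatorSymbol {α : ℝ} (hα : 0 ≤ α) {V : ℝ → L2} {V' : L2} {t : ℝ}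
    (hV : HasDerivAt V V' t) :
    HasDerivAt (fun τ => pmul (wtc (-(2 * α))) (pmul (propagatorSymbol α τ) (V τ)))
      (Complex.I • pmul (dispMult α) (pmul (propagatorSymbol α t) (V t)) +
        pmul (wtc (-(2 * α))) (pmul (propagatorSymbol α t) V')) t := by
  have hw := isContr_wtc (r := -(2 * α)) (by linarith)
  have hp := isContr_propagatorSymbol α
  have hd := isContr_dispMult hα
  rw [hasDerivAt_iff_tendsto_slope_zero]
  have hVs := hasDerivAt_iff_tendsto_slope_zero.1 hV
  have hVc : Tendsto (fun τ : ℝ => V (t + τ)) (𝓝[≠] 0) (𝓝 (V t)) := by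
    have h1 : Tendsto (fun τ : ℝ => t + τ) (𝓝[≠] 0) (𝓝 t) := by
      have : Tendsto (fun τ : ℝ => t + τ) (𝓝 0) (𝓝 (t + 0)) :=
        (continuous_const_add t).tendsto 0
      rw [add_zero] at this
      exact this.mono_left nhdsWithin_le_nhds
    exact hV.continuousAt.tendsto.comp h1
  -- The difference quotient of `e^{itω}` is at most `ω`, which `⟨ξ⟩^{-2α}` compensates.
  have hq : ∀ τ : ℝ, IsContr fun ξ => ((τ⁻¹ : ℝ) : ℂ) *
      (wtc (-(2 * α)) ξ * propagatorSymbol α (t + τ) ξ -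
        wtc (-(2 * α)) ξ * propagatorSymbol α t ξ) := fun τ => by
    refine ⟨measurable_const.mul (((measurable_wtc _).mul (measurable_propagatorSymbol _ _)).sub
      ((measurable_wtc _).mul (measurable_propagatorSymbol _ _))), fun ξ => ?_⟩
    rw [← mul_sub, norm_mul, norm_mul, norm_wtc, Complex.norm_real, Real.norm_eq_abs, abs_inv]
    rcases eq_or_ne τ 0 with h0 | h0
    · simp [h0]
    · have h3 : 0 < |τ| := abs_pos.2 h0
      have := wt_nonneg (-(2 * α)) ξ
      calc _ ≤ |τ|⁻¹ * (wt (-(2 * α)) ξ * (|τ| * disp α ξ)) := by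
            gcongr
            exact norm_propagatorSymbol_sub_le α t τ ξ
        _ = disp α ξ * wt (-(2 * α)) ξ := by field_simp
        _ ≤ 1 := abs_rpow_mul_wt_le_one (by positivity) ξ
  have hds : ∀ ξ, Tendsto (fun τ : ℝ => ((τ⁻¹ : ℝ) : ℂ) *
      (wtc (-(2 * α)) ξ * propagatorSymbol α (t + τ) ξ -
        wtc (-(2 * α)) ξ * propagatorSymbol α t ξ))
      (𝓝[≠] 0) (𝓝 (Complex.I * (dispMult α ξ * propagatorSymbol α t ξ))) := fun ξ => by
    have := hasDerivAt_iff_tendsto_slope_zero.1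
      ((hasDerivAt_propagatorSymbol α t ξ).const_mul (wtc (-(2 * α)) ξ))
    have e : wtc (-(2 * α)) ξ * (Complex.I * (disp α ξ : ℂ) * propagatorSymbol α t ξ) =
        Complex.I * (dispMult α ξ * propagatorSymbol α t ξ) := by
      rw [wtc, dispMult]; push_cast; ring
    rw [e] at this
    refine this.congr fun τ => ?_
    rw [Complex.real_smul]
  have hI : IsContr fun ξ => Complex.I * (dispMult α ξ * propagatorSymbol α t ξ) := by
    refine ⟨measurable_const.mul (hd.mul (hp t)).measurable, fun ξ => ?_⟩
    rw [norm_mul, Complex.norm_I, one_mul]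
    exact (hd.mul (hp t)).norm_le ξ
  have L1 := tendsto_pmul hq hI hds hVc
  have L2 := ((hw.continuous.comp (hp t).continuous).tendsto V').comp hVs
  have eI : pmul (fun ξ => Complex.I * (dispMult α ξ * propagatorSymbol α t ξ)) (V t) =
      Complex.I • pmul (dispMult α) (pmul (propagatorSymbol α t) (V t)) := by
    rw [hd.pmul_pmul (hp t)]
    refine Lp.ext ?_
    filter_upwards [hI.coeFn (V t), (hd.mul (hp t)).coeFn (V t), Lp.coeFn_smul Complex.I
      (pmul (fun ξ => dispMult α ξ * propagatorSymbol α t ξ) (V t))] with ξ h1 h2 h3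
    rw [h1, h3, Pi.smul_apply, h2, smul_eq_mul]
    ring
  rw [eI] at L1
  refine (L1.add L2).congr fun τ => ?_
  have hr : ∀ W : FractionalNLS.L2, (τ⁻¹ : ℝ) • W = ((τ⁻¹ : ℝ) : ℂ) • W := fun W =>
    (Complex.coe_smul _ _).symm
  have e1 : pmul (fun ξ => ((τ⁻¹ : ℝ) : ℂ) * (wtc (-(2 * α)) ξ * propagatorSymbol α (t + τ) ξ -
        wtc (-(2 * α)) ξ * propagatorSymbol α t ξ)) (V (t + τ)) =
      ((τ⁻¹ : ℝ) : ℂ) • (pmul (wtc (-(2 * α))) (pmul (propagatorSymbol α (t + τ)) (V (t + τ))) -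
        pmul (wtc (-(2 * α))) (pmul (propagatorSymbol α t) (V (t + τ)))) := by
    rw [hw.pmul_pmul (hp _), hw.pmul_pmul (hp _)]
    refine Lp.ext ?_
    filter_upwards [(hq τ).coeFn (V (t + τ)), (hw.mul (hp (t + τ))).coeFn (V (t + τ)),
      (hw.mul (hp t)).coeFn (V (t + τ)),
      Lp.coeFn_sub (pmul (fun ξ => wtc (-(2 * α)) ξ * propagatorSymbol α (t + τ) ξ) (V (t + τ)))
        (pmul (fun ξ => wtc (-(2 * α)) ξ * propagatorSymbol α t ξ) (V (t + τ))),
      Lp.coeFn_smul ((τ⁻¹ : ℝ) : ℂ)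
        (pmul (fun ξ => wtc (-(2 * α)) ξ * propagatorSymbol α (t + τ) ξ) (V (t + τ)) -
        pmul (fun ξ => wtc (-(2 * α)) ξ * propagatorSymbol α t ξ) (V (t + τ)))]
      with ξ h1 h2 h3 h4 h5
    rw [h1, h5, Pi.smul_apply, h4, Pi.sub_apply, h2, h3, smul_eq_mul]
    ring
  simp only [Function.comp_apply]
  rw [e1, hr, hr, (hp t).pmul_smul, hw.pmul_smul, (hp t).pmul_sub, hw.pmul_sub, ← smul_add]
  congr 1
  abel

theorem pmul_triL_nlKer_eq {s : ℝ} (hs : 1 / 2 < s) (α t : ℝ) (F G H : L2) :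
    pmul (propagatorSymbol α t) (triL (nlKer α s t) F G H) =
      triL (wKerC s s) (pmul (propagatorSymbol α t) F) (pmul (propagatorSymbol α t) G)
        (pmul (propagatorSymbol α t) H) := by
  obtain ⟨C, hM⟩ := exists_isBddKernel_algebra hs
  have hp := isContr_propagatorSymbol α t
  refine Lp.ext ?_
  filter_upwards [hp.coeFn (triL (nlKer α s t) F G H), hM.coeFn (isDom_nlKer α s t) F G H,
    hM.coeFn (isDom_wKerC s s) (pmul (propagatorSymbol α t) F) (pmul (propagatorSymbol α t) G)
      (pmul (propagatorSymbol α t) H)] with ξ h1 h2 h3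
  rw [h1, h2, h3, tri_congr (hp.coeFn F) (hp.coeFn G) (hp.coeFn H), tri, tri, ← integral_const_mul]
  congr 1
  ext p
  have e := propagatorSymbol_neg_mul α t ξ
  simp only [nlKer, osc_eq, map_mul]
  linear_combination (wKerC s s ξ p.1 p.2 * (propagatorSymbol α t p.1 *
    starRingEnd ℂ (propagatorSymbol α t p.2) * propagatorSymbol α t (ξ - p.1 + p.2)) *
    (F p.1 * starRingEnd ℂ (G p.2) * H (ξ - p.1 + p.2))) * e

theorem IsFlow.continuousOn_pmul {σ α s : ℝ} {V₀ : L2} {I : Set ℝ} {V : ℝ → L2}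
    (h : IsFlow σ α s V₀ I V) :
    ContinuousOn (fun t => pmul (propagatorSymbol α t) (V t)) I := fun t ht =>
  tendsto_pmul (isContr_propagatorSymbol α) (isContr_propagatorSymbol α t)
    (fun ξ => ((continuous_propagatorSymbol_time α ξ).tendsto t).mono_left nhdsWithin_le_nhds)
    (h.continuousOn t ht)

theorem continuousOn_triL_wKerC {s : ℝ} (hs : 1 / 2 < s) {I : Set ℝ} {F G H : ℝ → L2}
    (hF : ContinuousOn F I) (hG : ContinuousOn G I) (hH : ContinuousOn H I) :
    ContinuousOn (fun t => triL (wKerC s s) (F t) (G t) (H t)) I := by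
  obtain ⟨C, hM⟩ := exists_isBddKernel_algebra hs
  exact continuousOn_triL_of_isBddKernel hM (fun _ => isDom_wKerC s s)
    (fun _ _ _ => continuous_const) hF hG hH

/-- The solution lies in `H^α` but is differentiated in time only in `H^{-α}`. That is enough:
polarization writes the increment of `∫|u|⁴` as the increment of `u` in `H^{-α}` paired with a
factor continuous in `H^α`. -/
theorem IsFlow.hasDerivAt_quartic {σ α : ℝ} (hα : 1 / 2 < α) {V₀ : L2} {I : Set ℝ} {V : ℝ → L2}
    (h : IsFlow σ α α V₀ I V) {t : ℝ} (ht : I ∈ 𝓝 t) :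
    HasDerivAt (fun τ => quartic α (pmul (propagatorSymbol α τ) (V τ)))
      (4 * (inner ℂ (pmul (dispMult α) (pmul (propagatorSymbol α t) (V t)))
        (triL (wKerC α α) (pmul (propagatorSymbol α t) (V t)) (pmul (propagatorSymbol α t) (V t))
          (pmul (propagatorSymbol α t) (V t)))).im) t := by
  have hα0 : 0 ≤ α := by linarith
  have hV := h.hasDerivAt hα ht
  have hX := hasDerivAt_pmul_propagatorSymbol hα0 hV
  set W : ℝ → L2 := fun τ => pmul (propagatorSymbol α τ) (V τ) with hW
  have hWc : ContinuousOn W I := h.continuousOn_pmul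
  have cc : ContinuousOn (fun _ : ℝ => W t) I := continuousOn_const
  have hK : ContinuousOn (fun τ => triL (wKerC α α) (W τ) (W τ) (W τ) +
      triL (wKerC α α) (W τ) (W τ) (W t) + triL (wKerC α α) (W t) (W t) (W τ) +
        triL (wKerC α α) (W t) (W t) (W t)) I :=
    (((continuousOn_triL_wKerC hα hWc hWc hWc).add (continuousOn_triL_wKerC hα hWc hWc cc)).add
      (continuousOn_triL_wKerC hα cc cc hWc)).add (continuousOn_triL_wKerC hα cc cc cc)
  have hK' := (hK.continuousAt ht).tendsto.mono_left (nhdsWithin_le_nhds (s := {t}ᶜ))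
  have hXs := hasDerivAt_iff_tendsto_slope.1 hX
  rw [hasDerivAt_iff_tendsto_slope]
  have hl := (Complex.continuous_re.tendsto _).comp (hXs.inner (𝕜 := ℂ) hK')
  have e1 : pmul (propagatorSymbol α t) (nl σ α α t (V t)) =
      -(Complex.I * (σ : ℂ)) • triL (wKerC α α) (W t) (W t) (W t) := by
    rw [nl, (isContr_propagatorSymbol α t).pmul_smul, pmul_triL_nlKer_eq hα]
  have hw := isContr_wtc (r := -(2 * α)) (by linarith)
  have e2 : (inner ℂ (Complex.I • pmul (dispMult α) (W t) +
      pmul (wtc (-(2 * α))) (pmul (propagatorSymbol α t) (nl σ α α t (V t))))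
      (triL (wKerC α α) (W t) (W t) (W t) +
      triL (wKerC α α) (W t) (W t) (W t) + triL (wKerC α α) (W t) (W t) (W t) +
        triL (wKerC α α) (W t) (W t) (W t))).re =
      4 * (inner ℂ (pmul (dispMult α) (W t)) (triL (wKerC α α) (W t) (W t) (W t))).im := by
    rw [e1, hw.pmul_smul]
    set T := triL (wKerC α α) (W t) (W t) (W t)
    -- This pairing is real, so the nonlinear part of the time derivative, which carries the factor
    -- `iσ`, contributes nothing.
    have hT : (inner ℂ (pmul (wtc (-(2 * α))) T) T).im = 0 := by
      have h1 := inner_conj_symm (𝕜 := ℂ) (pmul (wtc (-(2 * α))) T) T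
      rw [← inner_pmul_left hw hw (conj_wtc _)] at h1
      exact Complex.conj_eq_iff_im.1 h1
    simp only [inner_add_left, inner_add_right, inner_smul_left, Complex.add_re, Complex.mul_re,
      map_neg, map_mul, Complex.conj_I, Complex.conj_ofReal, Complex.neg_re, Complex.neg_im,
      Complex.mul_im, Complex.I_re, Complex.I_im, Complex.ofReal_re, Complex.ofReal_im, hT]
    ring
  rw [e2] at hl
  refine hl.congr fun τ => ?_
  have hr : ∀ (c : ℝ) (Y : FractionalNLS.L2), c • Y = (c : ℂ) • Y := fun c Y =>
    (Complex.coe_smul c Y).symm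
  simp only [Function.comp_apply, slope_def_module]
  rw [quartic_sub hα, hr, inner_smul_left, Complex.conj_ofReal, Complex.re_ofReal_mul, smul_eq_mul]

/-- The mass in the profile variable. -/
def mass (α : ℝ) (V : L2) : ℝ := ‖pmul (wtc (-α)) V‖ ^ 2

/-- The kinetic energy in the profile variable. -/
def kinetic (α : ℝ) (V : L2) : ℝ := ‖pmul (kinMult α) V‖ ^ 2

theorem inner_pmul_propagatorSymbol (α t : ℝ) (F G : L2) :
    inner ℂ (pmul (propagatorSymbol α t) F) (pmul (propagatorSymbol α t) G) = inner ℂ F G := by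
  rw [inner_pmul_left (isContr_propagatorSymbol α t) (isContr_propagatorSymbol α (-t))
    (conj_propagatorSymbol α t), (isContr_propagatorSymbol α (-t)).pmul_pmul
    (isContr_propagatorSymbol α t), pmul_eq_self (propagatorSymbol_neg_mul α t)]

/-- The derivative of a quadratic quantity along the flow. -/
theorem IsFlow.hasDerivAt_norm_sq {σ α : ℝ} (hα : 1 / 2 < α) {V₀ : L2} {I : Set ℝ} {V : ℝ → L2}
    (h : IsFlow σ α α V₀ I V) {t : ℝ} (ht : I ∈ 𝓝 t) {m n : ℝ → ℂ} (hm : IsContr m)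
    (hn : IsContr n) (hmr : ∀ ξ, starRingEnd ℂ (m ξ) = m ξ) (hmn : ∀ ξ, m ξ * m ξ = n ξ) :
    HasDerivAt (fun τ => ‖pmul m (V τ)‖ ^ 2)
      (2 * σ * (inner ℂ (pmul n (pmul (propagatorSymbol α t) (V t)))
        (triL (wKerC α α) (pmul (propagatorSymbol α t) (V t)) (pmul (propagatorSymbol α t) (V t))
          (pmul (propagatorSymbol α t) (V t)))).im) t := by
  have hp := isContr_propagatorSymbol α t
  have hV := ((mulCLM m hm).restrictScalars ℝ).hasFDerivAt.comp_hasDerivAt t (h.hasDerivAt hα ht)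
  have h1 := (Complex.reCLM.hasFDerivAt.comp_hasDerivAt t (hV.inner ℂ hV))
  have e0 : (fun τ => ‖pmul m (V τ)‖ ^ 2) =
      fun τ => (inner ℂ (pmul m (V τ)) (pmul m (V τ))).re := by
    ext τ
    exact norm_sq_eq_re_inner (𝕜 := ℂ) _
  rw [e0]
  refine h1.congr_deriv ?_
  have e1 : inner ℂ (pmul m (V t)) (pmul m (nl σ α α t (V t))) =
      -(Complex.I * (σ : ℂ)) * inner ℂ (pmul n (pmul (propagatorSymbol α t) (V t)))
        (triL (wKerC α α) (pmul (propagatorSymbol α t) (V t)) (pmul (propagatorSymbol α t) (V t))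
          (pmul (propagatorSymbol α t) (V t))) := by
    have hnr : ∀ ξ, starRingEnd ℂ (n ξ) = n ξ := fun ξ => by rw [← hmn, map_mul, hmr]
    have hnn : pmul m (pmul m (V t)) = pmul n (V t) := by
      rw [hm.pmul_pmul hm]; simp only [hmn]
    rw [← inner_pmul_left hm hm hmr, hnn, ← inner_pmul_propagatorSymbol α t, pmul_comm hp hn, nl,
      hp.pmul_smul, inner_smul_right, pmul_triL_nlKer_eq hα]
  have e2 : inner ℂ (pmul m (nl σ α α t (V t))) (pmul m (V t)) =
      starRingEnd ℂ (inner ℂ (pmul m (V t)) (pmul m (nl σ α α t (V t)))) :=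
    (inner_conj_symm _ _).symm
  change (inner ℂ (pmul m (V t)) (pmul m (nl σ α α t (V t))) +
    inner ℂ (pmul m (nl σ α α t (V t))) (pmul m (V t))).re = _
  rw [e2, Complex.add_re, Complex.conj_re, e1]
  simp only [Complex.mul_re, Complex.neg_re, Complex.neg_im, Complex.mul_im, Complex.I_re,
    Complex.I_im, Complex.ofReal_re, Complex.ofReal_im]
  ring

theorem IsFlow.eq_of_hasDerivAt_zero {σ α s : ℝ} {V₀ : L2} {I : Set ℝ} {V : ℝ → L2}
    (h : IsFlow σ α s V₀ I V) {f : ℝ → ℝ} (hc : ContinuousOn f I)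
    (hd : ∀ t, I ∈ 𝓝 t → HasDerivAt f 0 t) {t : ℝ} (ht : t ∈ I) : f t = f 0 := by
  have hsub := h.ordConnected.uIcc_subset h.zero_mem ht
  have := intervalIntegral.integral_eq_sub_of_hasDeriv_right (f' := fun _ => (0 : ℝ)) (hc.mono hsub)
    (fun x hx => (hd x (mem_nhds_of_mem_Ioo_min_max h.ordConnected h.zero_mem ht
      hx)).hasDerivWithinAt) intervalIntegrable_const
  simp only [intervalIntegral.integral_zero] at this
  linarith

/-- The derivative is the imaginary part of a multiple of the real number `∫|u|⁴`. -/
theorem IsFlow.mass_eq {σ α : ℝ} (hα : 1 / 2 < α) {V₀ : L2} {I : Set ℝ} {V : ℝ → L2}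
    (h : IsFlow σ α α V₀ I V) {t : ℝ} (ht : t ∈ I) : mass α (V t) = mass α V₀ := by
  have hw := isContr_wtc (r := -α) (by linarith)
  rw [← h.zero_eq]
  refine h.eq_of_hasDerivAt_zero (f := fun t => mass α (V t))
    ((hw.continuous.comp_continuousOn h.continuousOn).norm.pow 2) (fun τ hτ => ?_) ht
  refine (h.hasDerivAt_norm_sq hα hτ hw (isContr_wtc (r := -(2 * α)) (by linarith)) (conj_wtc _)
    fun ξ => by rw [wtc_mul_wtc]; ring_nf).congr_deriv ?_
  rw [inner_pmul_triL_self hα, Complex.ofReal_im, mul_zero]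

theorem continuousOn_quartic {s : ℝ} (hs : 1 / 2 < s) {I : Set ℝ} {W : ℝ → L2}
    (hW : ContinuousOn W I) : ContinuousOn (fun t => quartic s (W t)) I := by
  have hw := isContr_wtc (r := -(2 * s)) (by linarith)
  have h1 := Complex.continuous_re.comp_continuousOn
    ((hw.continuous.comp_continuousOn hW).inner (𝕜 := ℂ) (continuousOn_triL_wKerC hs hW hW hW))
  refine h1.congr fun t _ => ?_
  simp only [Function.comp_apply]
  rw [inner_pmul_triL_self hs, Complex.ofReal_re]

/-- Both derivatives are multiples of the same imaginary part, `2σ` for the kinetic energy and `4`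
for the quartic one; the factor `σ/2` makes them cancel. -/
theorem IsFlow.energy_eq {σ α : ℝ} (hα : 1 / 2 < α) {V₀ : L2} {I : Set ℝ} {V : ℝ → L2}
    (h : IsFlow σ α α V₀ I V) {t : ℝ} (ht : t ∈ I) :
    kinetic α (V t) - σ / 2 * quartic α (pmul (propagatorSymbol α t) (V t)) =
      kinetic α V₀ - σ / 2 * quartic α V₀ := by
  have hα0 : 0 ≤ α := by linarith
  have hk := isContr_kinMult hα0
  have key := h.eq_of_hasDerivAt_zero
    (f := fun t => kinetic α (V t) - σ / 2 * quartic α (pmul (propagatorSymbol α t) (V t)))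
    (((hk.continuous.comp_continuousOn h.continuousOn).norm.pow 2).sub
      (continuousOn_const.mul (continuousOn_quartic hα h.continuousOn_pmul))) (fun τ hτ => ?_) ht
  · rw [key, h.zero_eq, pmul_eq_self (propagatorSymbol_zero α)]
  · refine ((h.hasDerivAt_norm_sq hα hτ hk (isContr_dispMult hα0)
      (fun ξ => Complex.conj_ofReal _) (kinMult_mul_self hα0)).sub
      ((h.hasDerivAt_quartic hα hτ).const_mul (σ / 2))).congr_deriv ?_
    ring

end

noncomputable section

/-! ### The a priori bound -/

theorem integral_norm_sq (f : L2) : ∫ x, ‖f x‖ ^ 2 = ‖f‖ ^ 2 := by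
  have h := inner_self_eq_norm_sq_to_K (𝕜 := ℂ) f
  rw [L2.inner_def] at h
  have e : ∀ x, inner ℂ (f x) (f x) = ((‖f x‖ ^ 2 : ℝ) : ℂ) := fun x => by
    rw [inner_self_eq_norm_sq_to_K]; simp
  simp only [e] at h
  rw [integral_complex_ofReal] at h
  have h2 : ((∫ x, ‖f x‖ ^ 2 : ℝ) : ℂ) = ((‖f‖ ^ 2 : ℝ) : ℂ) :=
    h.trans (Complex.ofReal_pow _ _).symm
  exact Complex.ofReal_injective h2

theorem norm_unlift (s : ℝ) (W : L2) : ‖unlift s W‖ = ‖pmul (wtc (-s)) W‖ := by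
  rw [← fourier_unlift]
  exact ((Lp.fourierTransformₗᵢ ℝ ℂ).norm_map (unlift s W)).symm

theorem quartic_le {s : ℝ} (hs : 1 / 2 < s) (W : L2) :
    quartic s W ≤ (∫ ξ, ‖pmul (wtc (-s)) W ξ‖) ^ 2 * mass s W := by
  have hi : Integrable ((𝓕 (unlift s W) : L2) : ℝ → ℂ) := by
    rw [fourier_unlift]
    exact integrable_pmul_wtc hs W
  have hb := norm_coe_le_of_integrable hi
  rw [fourier_unlift] at hb
  set K := ∫ ξ, ‖pmul (wtc (-s)) W ξ‖
  have h2 : Integrable fun x => ‖unlift s W x‖ ^ 2 :=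
    (Lp.memLp (unlift s W)).integrable_norm_pow (by norm_num)
  rw [mass, ← norm_unlift, ← integral_norm_sq, ← integral_const_mul, quartic]
  refine integral_mono_of_nonneg (Eventually.of_forall fun x => by positivity)
    (h2.const_mul _) ?_
  filter_upwards [hb] with x hx
  calc ‖unlift s W x‖ ^ 4 = ‖unlift s W x‖ ^ 2 * ‖unlift s W x‖ ^ 2 := by ring
    _ ≤ K ^ 2 * ‖unlift s W x‖ ^ 2 := by gcongr

/-- The squared norm of the low regularity embedding `H^α → 𝓕 L¹`, at the scale `l`. -/
def embConst (α l : ℝ) : ℝ≥0∞ := ∫⁻ ξ, ENNReal.ofReal (l + disp α ξ)⁻¹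

theorem wt_le_one_add_disp {α : ℝ} (hα : 0 ≤ α) (hα' : α ≤ 1) (ξ : ℝ) :
    wt (2 * α) ξ ≤ 1 + disp α ξ := by
  have h := Real.rpow_add_le_add_rpow zero_le_one (sq_nonneg (2 * Real.pi * ξ)) hα hα'
  have e : ((2 * Real.pi * ξ) ^ 2) ^ α = disp α ξ := by
    rw [disp, ← sq_abs, ← Real.rpow_natCast, ← Real.rpow_mul (abs_nonneg _)]
    norm_num
  rw [Real.one_rpow, e] at h
  rw [wt, show 2 * α / 2 = α by ring]
  exact h

/-- The embedding constant tends to zero as `l → ∞`, by dominated convergence with the majorant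
`⟨ξ⟩^{-2α}`, integrable because `2α > 1`. -/
theorem exists_embConst_le {α : ℝ} (hα : 1 / 2 < α) (hα' : α ≤ 1) {ε : ℝ} (hε : 0 < ε) :
    ∃ l, 1 ≤ l ∧ embConst α l ≤ ENNReal.ofReal ε := by
  have h := tendsto_lintegral_of_dominated_convergence (μ := (volume : Measure ℝ))
    (F := fun (n : ℕ) ξ => ENNReal.ofReal (((n : ℝ) + 1) + disp α ξ)⁻¹) (f := fun _ => 0)
    (ewt (-(2 * α))) (fun n => by fun_prop) (fun n => Eventually.of_forall fun ξ => ?_)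
    (lintegral_ewt_lt_top (by linarith)).ne (Eventually.of_forall fun ξ => ?_)
  · rw [lintegral_zero] at h
    obtain ⟨n, hn⟩ := (h.eventually (gt_mem_nhds (ENNReal.ofReal_pos.2 hε))).exists
    exact ⟨n + 1, by simp, hn.le⟩
  · refine ENNReal.ofReal_le_ofReal ?_
    have h1 := wt_le_one_add_disp (by linarith) hα' ξ
    have h2 : wt (-(2 * α)) ξ = (wt (2 * α) ξ)⁻¹ :=
      eq_inv_of_mul_eq_one_left (wt_neg_mul_wt _ _)
    rw [h2]
    refine inv_anti₀ (wt_pos _ _) (h1.trans ?_)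
    have : (0 : ℝ) ≤ n := n.cast_nonneg
    linarith
  · have h1 : Tendsto (fun n : ℕ => ((n : ℝ) + 1) + disp α ξ) atTop atTop :=
      tendsto_atTop_add_const_right _ _ (tendsto_atTop_add_const_right _ _
        tendsto_natCast_atTop_atTop)
    have h2 := (ENNReal.continuous_ofReal.tendsto 0).comp (tendsto_inv_atTop_zero.comp h1)
    rw [ENNReal.ofReal_zero] at h2
    exact h2

theorem lintegral_add_disp_mul {α l : ℝ} (hα : 0 ≤ α) (hl : 0 ≤ l) (W : L2) :
    ∫⁻ ξ, ENNReal.ofReal (l + disp α ξ) * ‖pmul (wtc (-α)) W ξ‖ₑ ^ 2 =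
      ENNReal.ofReal (l * mass α W + kinetic α W) := by
  have hw := isContr_wtc (r := -α) (by linarith)
  have hk := isContr_kinMult hα
  have e : ∀ᵐ ξ, ENNReal.ofReal (l + disp α ξ) * ‖pmul (wtc (-α)) W ξ‖ₑ ^ 2 =
      ENNReal.ofReal l * ‖pmul (wtc (-α)) W ξ‖ₑ ^ 2 + ‖pmul (kinMult α) W ξ‖ₑ ^ 2 := by
    filter_upwards [hw.coeFn W, hk.coeFn W] with ξ h1 h2
    have h3 : ‖kinMult α ξ‖ ^ 2 = disp α ξ * ‖wtc (-α) ξ‖ ^ 2 := by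
      rw [← norm_pow, sq, kinMult_mul_self hα, dispMult, Complex.norm_real, norm_wtc,
        Real.norm_of_nonneg (mul_nonneg (disp_nonneg _ _) (wt_nonneg _ _)), sq, wt_mul_wt]
      ring_nf
    have h4 : ‖kinMult α ξ‖ₑ ^ 2 = ENNReal.ofReal (disp α ξ) * ‖wtc (-α) ξ‖ₑ ^ 2 := by
      rw [← ofReal_norm, ← ofReal_norm, ← ENNReal.ofReal_pow (norm_nonneg _),
        ← ENNReal.ofReal_pow (norm_nonneg _), ← ENNReal.ofReal_mul (disp_nonneg _ _), h3]
    rw [h1, h2, enorm_mul, enorm_mul, mul_pow, mul_pow, h4,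
      ENNReal.ofReal_add hl (disp_nonneg _ _)]
    ring
  rw [lintegral_congr_ae e, lintegral_add_left (by fun_prop), lintegral_const_mul _ (by fun_prop)]
  have n1 := normSq_enorm (pmul (wtc (-α)) W)
  have n2 := normSq_enorm (pmul (kinMult α) W)
  unfold normSq at n1 n2
  rw [n1, n2, mass, kinetic, ENNReal.ofReal_add (by positivity) (by positivity),
    ENNReal.ofReal_mul hl, ENNReal.ofReal_pow (norm_nonneg _), ENNReal.ofReal_pow (norm_nonneg _),
    ofReal_norm, ofReal_norm]

theorem sq_lintegral_le_embConst {α l : ℝ} (hα : 0 ≤ α) (hl : 0 < l) (W : L2) :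
    (∫⁻ ξ, ‖pmul (wtc (-α)) W ξ‖ₑ) ^ 2 ≤
      embConst α l * ENNReal.ofReal (l * mass α W + kinetic α W) := by
  have h := sq_lintegral_mul_le volume
    (f := fun ξ => ENNReal.ofReal (Real.sqrt (l + disp α ξ)⁻¹))
    (g := fun ξ => ENNReal.ofReal (Real.sqrt (l + disp α ξ)) * ‖pmul (wtc (-α)) W ξ‖ₑ)
    (by fun_prop) (by fun_prop)
  have hp : ∀ ξ, 0 < l + disp α ξ := fun ξ => add_pos_of_pos_of_nonneg hl (disp_nonneg _ _)
  have e1 : ∀ ξ, ENNReal.ofReal (Real.sqrt (l + disp α ξ)⁻¹) *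
      (ENNReal.ofReal (Real.sqrt (l + disp α ξ)) * ‖pmul (wtc (-α)) W ξ‖ₑ) =
      ‖pmul (wtc (-α)) W ξ‖ₑ := fun ξ => by
    rw [← mul_assoc, ← ENNReal.ofReal_mul (Real.sqrt_nonneg _), ← Real.sqrt_mul (by
      have := hp ξ; positivity), inv_mul_cancel₀ (hp ξ).ne', Real.sqrt_one, ENNReal.ofReal_one,
      one_mul]
  have e2 : ∀ r : ℝ, 0 ≤ r → ENNReal.ofReal (Real.sqrt r) ^ 2 = ENNReal.ofReal r := fun r hr => by
    rw [← ENNReal.ofReal_pow (Real.sqrt_nonneg _), Real.sq_sqrt hr]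
  simp only [e1, mul_pow, e2 _ (hp _).le, e2 _ (inv_nonneg.2 (hp _).le)] at h
  rwa [lintegral_add_disp_mul hα hl.le] at h

theorem norm_sq_le_mass_add_kinetic {α : ℝ} (hα : 0 ≤ α) (hα' : α ≤ 1) (W : L2) :
    ‖W‖ ^ 2 ≤ mass α W + kinetic α W := by
  have h := lintegral_add_disp_mul hα zero_le_one W
  have hw := isContr_wtc (r := -α) (by linarith)
  have h0 : 0 ≤ mass α W + kinetic α W := add_nonneg (sq_nonneg _) (sq_nonneg _)
  rw [one_mul] at h
  rw [← ENNReal.ofReal_le_ofReal_iff h0, ← h, ENNReal.ofReal_pow (norm_nonneg _), ofReal_norm,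
    ← normSq_enorm]
  refine lintegral_mono_ae ?_
  filter_upwards [hw.coeFn W] with ξ h1
  have e : ewt (2 * α) ξ * ewt (-α) ξ ^ 2 = 1 := by
    rw [sq, ewt_mul_ewt, ewt_mul_ewt, show 2 * α + (-α + -α) = 0 by ring, ewt_zero]
  calc ‖W ξ‖ₑ ^ 2 = ewt (2 * α) ξ * ewt (-α) ξ ^ 2 * ‖W ξ‖ₑ ^ 2 := by rw [e, one_mul]
    _ = ewt (2 * α) ξ * ‖pmul (wtc (-α)) W ξ‖ₑ ^ 2 := by
        rw [h1, enorm_mul, enorm_wtc, mul_pow, mul_assoc]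
    _ ≤ _ := by
        gcongr
        exact ENNReal.ofReal_le_ofReal (wt_le_one_add_disp hα hα' ξ)

/-- A substitute for the Gagliardo-Nirenberg inequality, from `∫|u|⁴ ≤ ‖u‖_∞² ‖u‖₂²`: the kinetic
energy enters with a factor that can be made small, at the price of a large `l` in front of the
mass. -/
theorem quartic_le_embConst {α l : ℝ} (hα : 1 / 2 < α) (hl : 0 < l) {ε : ℝ} (hε : 0 ≤ ε)
    (h : embConst α l ≤ ENNReal.ofReal ε) (W : L2) :
    quartic α W ≤ ε * (l * mass α W + kinetic α W) * mass α W := by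
  have hm : 0 ≤ mass α W := sq_nonneg _
  have hk : 0 ≤ kinetic α W := sq_nonneg _
  refine (quartic_le hα W).trans (mul_le_mul_of_nonneg_right ?_ hm)
  have h1 := (sq_lintegral_le_embConst (by linarith) hl W).trans (mul_le_mul_left h _)
  rw [← ENNReal.ofReal_mul hε] at h1
  rw [integral_norm_eq_lintegral_enorm (measurable_coe _).aestronglyMeasurable,
    ← ENNReal.toReal_pow]
  exact ENNReal.toReal_le_of_le_ofReal (by positivity) h1

theorem mass_pmul_propagatorSymbol {α : ℝ} (hα : 0 ≤ α) (t : ℝ) (V : L2) :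
    mass α (pmul (propagatorSymbol α t) V) = mass α V := by
  rw [mass, mass, pmul_comm (isContr_wtc (by linarith)) (isContr_propagatorSymbol α t),
    norm_pmul_eq (measurable_propagatorSymbol α t) (norm_propagatorSymbol α t)]

theorem kinetic_pmul_propagatorSymbol {α : ℝ} (hα : 0 ≤ α) (t : ℝ) (V : L2) :
    kinetic α (pmul (propagatorSymbol α t) V) = kinetic α V := by
  rw [kinetic, kinetic, pmul_comm (isContr_kinMult hα) (isContr_propagatorSymbol α t),
    norm_pmul_eq (measurable_propagatorSymbol α t) (norm_propagatorSymbol α t)]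

/-- The `H^α` norm of a solution stays bounded in terms of the `H^α` norm of the data. -/
theorem exists_norm_flow_le {α : ℝ} (hα : 1 / 2 < α) (hα' : α ≤ 1) (R : ℝ) :
    ∃ K, 0 ≤ K ∧ ∀ σ : ℝ, (σ = 1 ∨ σ = -1) → ∀ V₀ I V, IsFlow σ α α V₀ I V → ‖V₀‖ ≤ R →
      ∀ t ∈ I, ‖V t‖ ≤ K := by
  have hα0 : 0 ≤ α := by linarith
  -- This `ε` satisfies `ε · mass ≤ 1`, hence the quartic term is at most `l · mass + kinetic`. It
  -- enters the energy with a factor `1/2`, so it absorbs only half of the kinetic energy.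
  obtain ⟨l, hl, hJ⟩ := exists_embConst_le hα hα' (ε := (R ^ 2 + 1)⁻¹) (by positivity)
  refine ⟨Real.sqrt ((4 + 2 * l) * R ^ 2), Real.sqrt_nonneg _, fun σ hσ V₀ I V h hV₀ t ht => ?_⟩
  have hM := h.mass_eq hα ht
  have hE := h.energy_eq hα ht
  have hR : ‖V₀‖ ^ 2 ≤ R ^ 2 := by gcongr
  have hM₀ : mass α V₀ ≤ R ^ 2 := le_trans (by
    unfold mass; gcongr; exact (isContr_wtc (by linarith)).norm_pmul_le V₀) hR
  have hK₀ : kinetic α V₀ ≤ R ^ 2 := le_trans (by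
    unfold kinetic; gcongr; exact (isContr_kinMult hα0).norm_pmul_le V₀) hR
  have hm0 : 0 ≤ mass α V₀ := sq_nonneg _
  have hQ : ∀ W, mass α W = mass α V₀ → quartic α W ≤ l * mass α V₀ + kinetic α W := by
    intro W hW
    have h1 := quartic_le_embConst hα (by linarith) (by positivity) hJ W
    have hk : 0 ≤ kinetic α W := sq_nonneg _
    rw [hW] at h1
    refine h1.trans ?_
    have h2 : (R ^ 2 + 1)⁻¹ * mass α V₀ ≤ 1 := by
      rw [inv_mul_le_iff₀ (by positivity)]
      linarith
    calc _ = (R ^ 2 + 1)⁻¹ * mass α V₀ * (l * mass α V₀ + kinetic α W) := by ring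
      _ ≤ 1 * (l * mass α V₀ + kinetic α W) := by gcongr
      _ = _ := one_mul _
  have q1 := hQ V₀ rfl
  have q2 := hQ (pmul (propagatorSymbol α t) (V t)) (by
    rw [mass_pmul_propagatorSymbol hα0, hM])
  rw [kinetic_pmul_propagatorSymbol hα0] at q2
  have p1 := quartic_nonneg α V₀
  have p2 := quartic_nonneg α (pmul (propagatorSymbol α t) (V t))
  have hb : kinetic α (V t) ≤ 3 * kinetic α V₀ + 2 * (l * mass α V₀) := by
    have hlm : 0 ≤ l * mass α V₀ := by positivity
    have hk0 : 0 ≤ kinetic α V₀ := sq_nonneg _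
    rcases hσ with rfl | rfl <;> linarith
  refine Real.le_sqrt_of_sq_le ((norm_sq_le_mass_add_kinetic hα0 hα' (V t)).trans ?_)
  have hlm : l * mass α V₀ ≤ l * R ^ 2 := by gcongr
  rw [hM]
  linarith

end

noncomputable section

/-! ### Global existence -/

theorem exists_nl_lipschitz {s : ℝ} (hs : 1 / 2 < s) : ∃ C, 0 ≤ C ∧ ∀ α σ : ℝ, (σ = 1 ∨ σ = -1) →
    ∀ (t ρ : ℝ) (V W : L2), ‖V‖ ≤ ρ → ‖W‖ ≤ ρ →
      ‖nl σ α s t V - nl σ α s t W‖ ≤ C * ρ ^ 2 * ‖V - W‖ := by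
  obtain ⟨C, hM⟩ := exists_isBddKernel_algebra hs
  have hC := hM.nonneg
  refine ⟨3 * C, by positivity, fun α σ hσ t ρ V W hV hW => ?_⟩
  have hρ : 0 ≤ ρ := (norm_nonneg V).trans hV
  have hD := isDom_nlKer α s t
  rw [nl, nl, ← smul_sub, norm_smul, norm_I_mul_sign hσ, one_mul, hM.triL_sub_triL hD]
  have b1 : ‖triL (nlKer α s t) (V - W) V V‖ ≤ C * ‖V - W‖ * ρ * ρ :=
    (hM.norm_triL_le hD _ _ _).trans (by gcongr)
  have b2 : ‖triL (nlKer α s t) W (V - W) V‖ ≤ C * ρ * ‖V - W‖ * ρ :=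
    (hM.norm_triL_le hD _ _ _).trans (by gcongr)
  have b3 : ‖triL (nlKer α s t) W W (V - W)‖ ≤ C * ρ * ρ * ‖V - W‖ :=
    (hM.norm_triL_le hD _ _ _).trans (by gcongr)
  refine (norm_add₃_le.trans (add_le_add (add_le_add b1 b2) b3)).trans (le_of_eq ?_)
  ring

theorem nl_zero (σ α s t : ℝ) (hs : 1 / 2 < s) : nl σ α s t 0 = 0 := by
  obtain ⟨C, hM⟩ := exists_isBddKernel_algebra hs
  have := hM.triL_smul_left (isDom_nlKer α s t) 0 0 0 0
  rw [zero_smul, zero_smul] at this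
  rw [nl, this, smul_zero]

/-- Local solvability of the profile equation. -/
theorem exists_local_flow {σ α s : ℝ} (hσ : σ = 1 ∨ σ = -1) (hs : 1 / 2 < s) (T : ℝ) (V₁ : L2) :
    ∃ δ > 0, ∃ y : ℝ → L2, ContinuousOn y (Set.Icc (T - δ) (T + δ)) ∧
      ∀ t ∈ Set.Icc (T - δ) (T + δ), y t = V₁ + ∫ τ in T..t, nl σ α s τ (y τ) := by
  obtain ⟨C, hC, H⟩ := exists_nl_lipschitz hs
  set ρ := ‖V₁‖ + 1 with hρ
  have hρ0 : 0 ≤ ρ := by positivity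
  have hball : ∀ V ∈ Metric.closedBall V₁ (1 : ℝ), ‖V‖ ≤ ρ := fun V hV => by
    have h1 := norm_le_norm_add_norm_sub V₁ V
    rw [mem_closedBall_iff_norm'] at hV
    exact h1.trans (by rw [hρ]; gcongr)
  set N := C * ρ ^ 2 * ρ with hN
  have hN0 : 0 ≤ N := by positivity
  -- Here `N` bounds the nonlinearity on the unit ball around `V₁`, and `N δ ≤ 1` keeps the Picard
  -- iterates inside that ball.
  set δ := (N + 1)⁻¹ with hδ
  have hδ0 : 0 < δ := by positivity
  have hT : T ∈ Set.Icc (T - δ) (T + δ) := ⟨by linarith, by linarith⟩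
  have hPL : IsPicardLindelof (fun t V => nl σ α s t V) (⟨T, hT⟩ : Set.Icc (T - δ) (T + δ)) V₁
      1 0 ⟨N, hN0⟩ ⟨C * ρ ^ 2, by positivity⟩ := by
    refine ⟨fun t _ => LipschitzOnWith.of_dist_le_mul fun V hV W hW => ?_, fun V _ => ?_,
      fun t _ V hV => ?_, ?_⟩
    · rw [dist_eq_norm, dist_eq_norm]
      exact H α σ hσ t ρ V W (hball V hV) (hball W hW)
    · exact continuousOn_nl σ α hs continuousOn_const
    · have := H α σ hσ t ρ V 0 (hball V hV) (by simpa using hρ0)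
      rw [nl_zero σ α s t hs, sub_zero, sub_zero] at this
      exact this.trans (mul_le_mul_of_nonneg_left (hball V hV) (by positivity))
    · have : max (T + δ - T) (T - (T - δ)) = δ := by
        rw [add_sub_cancel_left, sub_sub_cancel, max_self]
      simp only [NNReal.coe_one, NNReal.coe_zero, sub_zero, this]
      change N * δ ≤ 1
      rw [hδ, mul_inv_le_iff₀ (by positivity)]
      linarith
  obtain ⟨y, hy0, hy⟩ := hPL.exists_eq_forall_mem_Icc_hasDerivWithinAt
    (x := V₁) (by simp)
  have hyc : ContinuousOn y (Set.Icc (T - δ) (T + δ)) := fun t ht => (hy t ht).continuousWithinAt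
  refine ⟨δ, hδ0, y, hyc, fun t ht => ?_⟩
  have hsub := Set.ordConnected_Icc.uIcc_subset hT ht
  have hFTC := intervalIntegral.integral_eq_sub_of_hasDeriv_right (hyc.mono hsub)
    (fun x hx => ((hy x (hsub (Set.Ioo_subset_Icc_self hx))).hasDerivAt
      (mem_nhds_of_mem_Ioo_min_max Set.ordConnected_Icc hT ht hx)).hasDerivWithinAt)
    ((continuousOn_nl σ α hs hyc).mono hsub).intervalIntegrable
  have hy0' : y T = V₁ := hy0
  rw [hFTC, hy0']
  abel

/-- Gluing a flow with a local solution issued from a boundary point. -/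
theorem IsFlow.glue {σ α s : ℝ} (hs : 1 / 2 < s) {V₀ : L2} {I S : Set ℝ} {V y : ℝ → L2} {T : ℝ}
    (h : IsFlow σ α s V₀ I V) (hTI : T ∈ I) (hTS : T ∈ S) (hS : S.OrdConnected)
    (hIS : ∀ t ∈ closure I, t ∈ S → t = T) (hSI : ∀ t ∈ closure S, t ∈ I → t = T)
    (hy : ContinuousOn y S) (hyeq : ∀ t ∈ S, y t = V T + ∫ τ in T..t, nl σ α s τ (y τ)) :
    ∃ W, IsFlow σ α s V₀ (I ∪ S) W ∧ ∀ t ∈ I, W t = V t := by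
  classical
  have hyT : y T = V T := by simpa using hyeq T hTS
  set W : ℝ → L2 := fun t => if t ∈ I then V t else y t with hW
  have hWI : ∀ t ∈ I, W t = V t := fun t ht => if_pos ht
  have hWS : ∀ t ∈ S, W t = y t := fun t ht => by
    by_cases hI : t ∈ I
    · rw [hIS t (subset_closure hI) ht, hyT, hWI T hTI]
    · exact if_neg hI
  have hWcI : ContinuousOn W I := h.continuousOn.congr hWI
  have hWcS : ContinuousOn W S := hy.congr hWS
  have hord : (I ∪ S).OrdConnected := isPreconnected_iff_ordConnected.1
    (IsPreconnected.union T hTI hTS (isPreconnected_iff_ordConnected.2 h.ordConnected)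
      (isPreconnected_iff_ordConnected.2 hS))
  have hWc : ContinuousOn W (I ∪ S) := by
    -- Off the closure of a piece, continuity within that piece is vacuous; the pieces touch at `T`
    -- only.
    have hI : ∀ t ∈ I ∪ S, ContinuousWithinAt W I t := fun t ht => by
      by_cases hc : t ∈ closure I
      · rcases ht with ht | ht
        · exact hWcI t ht
        · rw [hIS t hc ht]; exact hWcI T hTI
      · exact continuousWithinAt_of_notMem_closure hc
    have hS : ∀ t ∈ I ∪ S, ContinuousWithinAt W S t := fun t ht => by
      by_cases hc : t ∈ closure S
      · rcases ht with ht | ht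
        · rw [hSI t hc ht]; exact hWcS T hTS
        · exact hWcS t ht
      · exact continuousWithinAt_of_notMem_closure hc
    exact fun t ht => (hI t ht).union (hS t ht)
  have hIeq : ∀ t ∈ I, W t = V₀ + ∫ τ in (0 : ℝ)..t, nl σ α s τ (W τ) := fun t ht => by
    rw [hWI t ht, h.integral_eq t ht]
    congr 1
    refine intervalIntegral.integral_congr fun τ hτ => ?_
    simp only [hWI τ (h.ordConnected.uIcc_subset h.zero_mem ht hτ)]
  refine ⟨W, ⟨hord, Or.inl h.zero_mem, hWc, fun t ht => ?_⟩, hWI⟩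
  rcases ht with ht | ht
  · exact hIeq t ht
  · have e : ∫ τ in T..t, nl σ α s τ (W τ) = ∫ τ in T..t, nl σ α s τ (y τ) :=
      intervalIntegral.integral_congr fun τ hτ => by
        simp only [hWS τ (hS.uIcc_subset hTS ht hτ)]
    have hn := continuousOn_nl σ α hs hWc
    have i1 : IntervalIntegrable (fun τ => nl σ α s τ (W τ)) volume 0 T :=
      (hn.mono (hord.uIcc_subset (Or.inl h.zero_mem) (Or.inl hTI))).intervalIntegrable
    have i2 : IntervalIntegrable (fun τ => nl σ α s τ (W τ)) volume T t :=
      (hn.mono (hord.uIcc_subset (Or.inl hTI) (Or.inr ht))).intervalIntegrable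
    rw [hWS t ht, hyeq t ht, ← hWI T hTI, hIeq T hTI, add_assoc, ← e,
      intervalIntegral.integral_add_adjacent_intervals i1 i2]

/-- Extension of a flow to a boundary point near which the nonlinearity is bounded. -/
theorem IsFlow.exists_extension_insert {σ α s : ℝ} (hs : 1 / 2 < s) {V₀ : L2} {I : Set ℝ}
    {V : ℝ → L2} {T N r : ℝ} (h : IsFlow σ α s V₀ I V) (hT : T ∈ closure I) (hTI : T ∉ I)
    (hr : 0 < r)
    (hN : ∀ t ∈ I ∩ Metric.ball T r, ‖nl σ α s t (V t)‖ ≤ N) :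
    ∃ W, IsFlow σ α s V₀ (insert T I) W ∧ ∀ t ∈ I, W t = V t := by
  classical
  have : (𝓝[I] T).NeBot := mem_closure_iff_nhdsWithin_neBot.1 hT
  -- A bounded nonlinearity makes the curve Lipschitz near `T`, so it has a limit there by
  -- completeness.
  have hlip : ∀ t ∈ I ∩ Metric.ball T r, ∀ t' ∈ I ∩ Metric.ball T r,
      dist (V t) (V t') ≤ N * |t - t'| := by
    intro t ht t' ht'
    have hord : (I ∩ Metric.ball T r).OrdConnected :=
      h.ordConnected.inter (convex_ball T r).ordConnected
    have hn := continuousOn_nl σ α hs h.continuousOn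
    have ii : ∀ x ∈ I, IntervalIntegrable (fun τ => nl σ α s τ (V τ)) volume 0 x := fun x hx =>
      (hn.mono (h.ordConnected.uIcc_subset h.zero_mem hx)).intervalIntegrable
    rw [dist_eq_norm, h.integral_eq t ht.1, h.integral_eq t' ht'.1, add_sub_add_left_eq_sub,
      intervalIntegral.integral_interval_sub_left (ii t ht.1) (ii t' ht'.1)]
    exact intervalIntegral.norm_integral_le_of_norm_le_const fun τ hτ =>
      hN τ (hord.uIcc_subset ht' ht (Set.uIoc_subset_uIcc hτ))
  have hcauchy : Cauchy (map V (𝓝[I] T)) := by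
    rw [Metric.cauchy_iff]
    refine ⟨inferInstance, fun ε hε => ?_⟩
    have hd : 0 < ε / (2 * (|N| + 1)) := by positivity
    refine ⟨V '' (I ∩ Metric.ball T (min r (ε / (2 * (|N| + 1))))), image_mem_map ?_, ?_⟩
    · exact inter_mem self_mem_nhdsWithin
        (mem_nhdsWithin_of_mem_nhds (Metric.ball_mem_nhds T (lt_min hr hd)))
    · rintro _ ⟨t, ht, rfl⟩ _ ⟨t', ht', rfl⟩
      have sub := Metric.ball_subset_ball (x := T) (min_le_left r (ε / (2 * (|N| + 1))))
      have sub' := Metric.ball_subset_ball (x := T) (min_le_right r (ε / (2 * (|N| + 1))))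
      have h1 := hlip t ⟨ht.1, sub ht.2⟩ t' ⟨ht'.1, sub ht'.2⟩
      have h2 : |t - t'| < 2 * (ε / (2 * (|N| + 1))) := by
        have a1 := sub' ht.2
        have a2 := sub' ht'.2
        rw [Metric.mem_ball] at a1 a2
        rw [← Real.dist_eq]
        have := dist_triangle_right t t' T
        linarith
      calc dist (V t) (V t') ≤ N * |t - t'| := h1
        _ ≤ (|N| + 1) * |t - t'| := by gcongr; linarith [le_abs_self N]
        _ < (|N| + 1) * (2 * (ε / (2 * (|N| + 1)))) := by gcongr
        _ = ε := by field_simp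
  obtain ⟨V₁, hV₁⟩ := CompleteSpace.complete hcauchy
  have hlim : Tendsto V (𝓝[I] T) (𝓝 V₁) := hV₁
  set W : ℝ → L2 := Function.update V T V₁ with hW
  have hWI : ∀ t ∈ I, W t = V t := fun t ht => by
    have hne : t ≠ T := fun e => hTI (e ▸ ht)
    exact Function.update_of_ne hne _ _
  have hWT : W T = V₁ := Function.update_self _ _ _
  have hlimW : Tendsto W (𝓝[I] T) (𝓝 (W T)) := by
    rw [hWT]
    refine hlim.congr' ?_
    filter_upwards [self_mem_nhdsWithin] with t ht
    exact (hWI t ht).symm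
  have hord : (insert T I).OrdConnected := isPreconnected_iff_ordConnected.1
    (IsPreconnected.subset_closure (isPreconnected_iff_ordConnected.2 h.ordConnected)
      (Set.subset_insert _ _) (Set.insert_subset hT subset_closure))
  have hWc : ContinuousOn W (insert T I) := by
    rintro t (rfl | ht)
    · exact (continuousWithinAt_insert_self).2 hlimW
    · refine continuousWithinAt_insert.2 ?_
      exact (h.continuousOn t ht).congr hWI (hWI t ht)
  have h0 : (0 : ℝ) ∈ insert T I := Or.inr h.zero_mem
  have hIeq : ∀ t ∈ I, W t = V₀ + ∫ τ in (0 : ℝ)..t, nl σ α s τ (W τ) := fun t ht => by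
    rw [hWI t ht, h.integral_eq t ht]
    congr 1
    refine intervalIntegral.integral_congr fun τ hτ => ?_
    simp only [hWI τ (h.ordConnected.uIcc_subset h.zero_mem ht hτ)]
  refine ⟨W, ⟨hord, h0, hWc, ?_⟩, hWI⟩
  rintro t (rfl | ht)
  · have hp := continuousOn_primitive_of_ordConnected hord h0 (continuousOn_nl σ α hs hWc)
    have h1 := ((hp t (Set.mem_insert _ _)).mono (Set.subset_insert _ _)).const_add V₀
    refine tendsto_nhds_unique hlimW (h1.tendsto.congr' ?_)
    filter_upwards [self_mem_nhdsWithin] with t' ht'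
    exact (hIeq t' ht').symm
  · exact hIeq t ht

/-- Exponential growth bound for a curve with `‖V'‖ ≤ c‖V‖`. -/
theorem IsFlow.norm_le_exp {σ α s : ℝ} (hs : 1 / 2 < s) {V₀ : L2} {I : Set ℝ} {V : ℝ → L2} {c : ℝ}
    (h : IsFlow σ α s V₀ I V) (hc : ∀ t ∈ I, ‖nl σ α s t (V t)‖ ≤ c * ‖V t‖) {t : ℝ} (ht : t ∈ I) :
    ‖V t‖ ≤ Real.exp (c * |t|) * ‖V₀‖ := by
  have hconv : Convex ℝ I := h.ordConnected.convex
  have hnc : ContinuousOn (fun τ => ‖V τ‖ ^ 2) I := h.continuousOn.norm.pow 2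
  have hder : ∀ τ ∈ interior I, HasDerivAt (fun τ => ‖V τ‖ ^ 2)
      (2 * (inner ℂ (V τ) (nl σ α s τ (V τ))).re) τ := fun τ hτ => by
    have hV := h.hasDerivAt hs (mem_interior_iff_mem_nhds.1 hτ)
    have h1 := Complex.reCLM.hasFDerivAt.comp_hasDerivAt τ (hV.inner ℂ hV)
    have e0 : (fun τ => ‖V τ‖ ^ 2) = fun τ => (inner ℂ (V τ) (V τ)).re := by
      ext τ
      exact norm_sq_eq_re_inner (𝕜 := ℂ) _
    rw [e0]
    refine h1.congr_deriv ?_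
    change (inner ℂ (V τ) (nl σ α s τ (V τ)) + inner ℂ (nl σ α s τ (V τ)) (V τ)).re = _
    rw [← inner_conj_symm (nl σ α s τ (V τ)) (V τ), Complex.add_re, Complex.conj_re, two_mul]
  have hbd : ∀ τ ∈ interior I, |2 * (inner ℂ (V τ) (nl σ α s τ (V τ))).re| ≤
      2 * c * ‖V τ‖ ^ 2 := fun τ hτ => by
    rw [abs_mul, abs_two]
    have h1 := (Complex.abs_re_le_norm _).trans (norm_inner_le_norm (𝕜 := ℂ) (V τ)
      (nl σ α s τ (V τ)))
    have h2 := mul_le_mul_of_nonneg_left (hc τ (interior_subset hτ)) (norm_nonneg (V τ))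
    nlinarith
  have hE : ∀ k τ : ℝ, HasDerivAt (fun τ => Real.exp (k * τ)) (Real.exp (k * τ) * k) τ :=
    fun k τ => by
      have := ((hasDerivAt_id τ).const_mul k).exp
      simpa using this
  -- For `k = -2c` this function decreases, which settles `t ≥ 0`; for `k = 2c` it increases, which
  -- settles `t ≤ 0`. The square keeps it differentiable where `V` vanishes.
  have hprod : ∀ k : ℝ, ∀ τ ∈ interior I, HasDerivAt (fun τ => Real.exp (k * τ) * ‖V τ‖ ^ 2)
      (Real.exp (k * τ) * (k * ‖V τ‖ ^ 2 + 2 * (inner ℂ (V τ) (nl σ α s τ (V τ))).re)) τ :=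
    fun k τ hτ => ((hE k τ).mul (hder τ hτ)).congr_deriv (by ring)
  have hcont : ∀ k : ℝ, ContinuousOn (fun τ => Real.exp (k * τ) * ‖V τ‖ ^ 2) I := fun k =>
    (by fun_prop : Continuous fun τ => Real.exp (k * τ)).continuousOn.mul hnc
  have hdiff : ∀ k : ℝ, DifferentiableOn ℝ (fun τ => Real.exp (k * τ) * ‖V τ‖ ^ 2) (interior I) :=
    fun k τ hτ => (hprod k τ hτ).differentiableAt.differentiableWithinAt
  have key : ‖V t‖ ^ 2 ≤ Real.exp (2 * c * |t|) * ‖V₀‖ ^ 2 := by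
    rw [← h.zero_eq]
    rcases le_total 0 t with h0 | h0
    · have hanti := antitoneOn_of_deriv_nonpos hconv (hcont (-(2 * c))) (hdiff _) fun τ hτ => by
        rw [(hprod _ τ hτ).deriv]
        refine mul_nonpos_of_nonneg_of_nonpos (Real.exp_pos _).le ?_
        linarith [(abs_le.1 (hbd τ hτ)).2]
      have := hanti h.zero_mem ht h0
      simp only [mul_zero, Real.exp_zero, one_mul] at this
      rw [abs_of_nonneg h0, ← mul_inv_le_iff₀' (Real.exp_pos _), ← Real.exp_neg]
      refine le_trans (le_of_eq ?_) this
      ring_nf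
    · have hmono := monotoneOn_of_deriv_nonneg hconv (hcont (2 * c)) (hdiff _) fun τ hτ => by
        rw [(hprod _ τ hτ).deriv]
        refine mul_nonneg (Real.exp_pos _).le ?_
        linarith [(abs_le.1 (hbd τ hτ)).1]
      have := hmono ht h.zero_mem h0
      simp only [mul_zero, Real.exp_zero, one_mul] at this
      rw [abs_of_nonpos h0, ← mul_inv_le_iff₀' (Real.exp_pos _), ← Real.exp_neg]
      refine le_trans (le_of_eq ?_) this
      ring_nf
  refine abs_le_of_sq_le_sq' ?_ (by positivity) |>.2
  rw [mul_pow, ← Real.exp_nat_mul, Nat.cast_ofNat, ← mul_assoc]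
  exact key

theorem IsSolution.mono_exponent {σ α s s' : ℝ} (hs : s' ≤ s) {u₀ : L2} {I : Set ℝ} {u : ℝ → L2}
    (h : IsSolution σ α s u₀ I u) : IsSolution σ α s' u₀ I u :=
  ⟨h.ordConnected, h.zero_mem, h.data_mem.mono hs, h.continuous.mono_exponent hs, h.duhamel⟩

/-- The a priori bound in the energy space. -/
theorem exists_sobolevNorm_energy_le {α s : ℝ} (hα : 1 / 2 < α) (hα' : α ≤ 1) (hs : α ≤ s) (R : ℝ) :
    ∃ K, 0 ≤ K ∧ ∀ σ : ℝ, (σ = 1 ∨ σ = -1) → ∀ (u₀ : L2) (I : Set ℝ) (u : ℝ → L2),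
      IsSolution σ α s u₀ I u → sobolevNorm α u₀ ≤ R → ∀ t ∈ I, sobolevNorm α (u t) ≤ K := by
  obtain ⟨K, hK, H⟩ := exists_norm_flow_le hα hα' R
  refine ⟨K, hK, fun σ hσ u₀ I u hu hR t ht => ?_⟩
  have hu' := hu.mono_exponent hs
  have h := H σ hσ _ I _ (hu'.isFlow hα) (by rwa [norm_lift hu'.data_mem]) t ht
  have hα0 : 0 ≤ α := by linarith
  rwa [← sobolevNorm_state α t hα0, state_profile α t hα0
    (hu'.continuous.1 t ht)] at h

theorem IsSolution.low_profile_eq {σ α s s₀ : ℝ} (hs : 0 ≤ s) (hs₀ : s₀ ≤ s) {u₀ : L2} {I : Set ℝ}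
    {u : ℝ → L2} (h : IsSolution σ α s u₀ I u) {t : ℝ} (ht : t ∈ I) :
    low s s₀ (profile α s t (u t)) = sobolevNorm s₀ (u t) := by
  rw [low, ← sobolevNorm_state_low α t hs hs₀, state_profile α t hs (h.continuous.1 t ht)]

/-- A maximal solution in (or above) the energy space has no finite endpoint. -/
theorem IsMaximalSolution.not_endpoint {σ α s : ℝ} (hσ : σ = 1 ∨ σ = -1) (hα : 1 / 2 < α)
    (hα' : α ≤ 1) (hs : α ≤ s) {u₀ : L2} {I : Set ℝ} {u : ℝ → L2}
    (h : IsMaximalSolution σ α s u₀ I u) {T : ℝ} (hT : T ∈ closure I) :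
    (∃ t ∈ I, T < t) ∧ ∃ t ∈ I, t < T := by
  have hu := h.isSolution
  have hs2 : 1 / 2 < s := by linarith
  have hs0 : 0 ≤ s := by linarith
  have hf := hu.isFlow hs2
  set V : ℝ → L2 := fun t => profile α s t (u t) with hV
  have hext : ∀ J W, IsFlow σ α s (lift s u₀) J W → I ⊆ J → (∀ t ∈ I, W t = V t) → J = I :=
    fun J W hW hIJ hWV => h.maximal J _ (hW.isSolution hs2 hu.data_mem) hIJ fun t ht => by
      rw [hWV t ht, hV, state_profile α t hs0 (hu.continuous.1 t ht)]
  -- Were `T` missing, it could be added: the `H^α` bound and the tame estimate make the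
  -- nonlinearity at most linear in the `H^s` norm, so this norm grows at most exponentially and the
  -- nonlinearity stays bounded near `T`.
  have hTI : T ∈ I := by
    by_contra hTI
    obtain ⟨K, hK, HK⟩ := exists_sobolevNorm_energy_le hα hα' hs (sobolevNorm α u₀)
    obtain ⟨C, hC, HC⟩ := exists_norm_nl_le hα hs
    have hc : ∀ t ∈ I, ‖nl σ α s t (V t)‖ ≤ C * K ^ 2 * ‖V t‖ := fun t ht => by
      have h1 : low s α (V t) ≤ K := by
        rw [hV, hu.low_profile_eq hs0 hs ht]
        exact HK σ hσ u₀ I u hu le_rfl t ht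
      have h2 := low_nonneg s α (V t)
      calc _ ≤ C * (‖V t‖ * low s α (V t) ^ 2) := HC α σ hσ t (V t)
        _ ≤ C * (‖V t‖ * K ^ 2) := by gcongr
        _ = _ := by ring
    obtain ⟨W, hW, hWV⟩ := hf.exists_extension_insert hs2 hT hTI one_pos
      (N := C * K ^ 2 * (Real.exp (C * K ^ 2 * (|T| + 1)) * ‖lift s u₀‖)) fun t ht => by
        have h1 := hf.norm_le_exp hs2 hc ht.1
        have h2 : |t| ≤ |T| + 1 := by
          have h3 := ht.2
          rw [Metric.mem_ball, Real.dist_eq] at h3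
          have := abs_sub_abs_le_abs_sub t T
          linarith
        refine (hc t ht.1).trans (mul_le_mul_of_nonneg_left (h1.trans ?_) (by positivity))
        gcongr
    have := hext _ W hW (Set.subset_insert _ _) hWV
    exact hTI (this ▸ Set.mem_insert T I)
  -- An endpoint that belongs to the interval is passed by a local solution glued at `T`, which
  -- contradicts maximality.
  obtain ⟨δ, hδ, y, hyc, hy⟩ := exists_local_flow (α := α) hσ hs2 T (V T)
  constructor
  · by_contra! hle
    have hcl : ∀ t ∈ closure I, t ≤ T := fun t ht =>
      closure_minimal (fun x hx => hle x hx) isClosed_Iic ht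
    have hsub : Set.Icc T (T + δ) ⊆ Set.Icc (T - δ) (T + δ) :=
      Set.Icc_subset_Icc_left (by linarith)
    obtain ⟨W, hW, hWV⟩ := hf.glue hs2 hTI (Set.left_mem_Icc.2 (by linarith)) Set.ordConnected_Icc
      (fun t ht ht' => le_antisymm (hcl t ht) ht'.1)
      (fun t ht ht' => by
        rw [isClosed_Icc.closure_eq] at ht
        exact le_antisymm (hle t ht') ht.1) (hyc.mono hsub) fun t ht => hy t (hsub ht)
    have := hext _ W hW Set.subset_union_left hWV
    have hmem : T + δ ∈ I := this ▸ Or.inr (Set.right_mem_Icc.2 (by linarith))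
    linarith [hle _ hmem]
  · by_contra! hle
    have hcl : ∀ t ∈ closure I, T ≤ t := fun t ht =>
      closure_minimal (fun x hx => hle x hx) isClosed_Ici ht
    have hsub : Set.Icc (T - δ) T ⊆ Set.Icc (T - δ) (T + δ) :=
      Set.Icc_subset_Icc_right (by linarith)
    obtain ⟨W, hW, hWV⟩ := hf.glue hs2 hTI (Set.right_mem_Icc.2 (by linarith)) Set.ordConnected_Icc
      (fun t ht ht' => le_antisymm ht'.2 (hcl t ht))
      (fun t ht ht' => by
        rw [isClosed_Icc.closure_eq] at ht
        exact le_antisymm ht.2 (hle t ht')) (hyc.mono hsub) fun t ht => hy t (hsub ht)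
    have := hext _ W hW Set.subset_union_left hWV
    have hmem : T - δ ∈ I := this ▸ Or.inr (Set.left_mem_Icc.2 (by linarith))
    linarith [hle _ hmem]

theorem IsMaximalSolution.eq_univ {σ α s : ℝ} (hσ : σ = 1 ∨ σ = -1) (hα : 1 / 2 < α)
    (hα' : α ≤ 1) (hs : α ≤ s) {u₀ : L2} {I : Set ℝ} {u : ℝ → L2}
    (h : IsMaximalSolution σ α s u₀ I u) : I = Set.univ := by
  have hne : I.Nonempty := ⟨0, h.isSolution.zero_mem⟩
  have hab : ¬ BddAbove I := fun hb => by
    obtain ⟨t, ht, hlt⟩ := (h.not_endpoint hσ hα hα' hs (csSup_mem_closure hne hb)).1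
    exact absurd (le_csSup hb ht) (not_le.2 hlt)
  have hbe : ¬ BddBelow I := fun hb => by
    obtain ⟨t, ht, hlt⟩ := (h.not_endpoint hσ hα hα' hs (csInf_mem_closure hne hb)).2
    exact absurd (csInf_le hb ht) (not_le.2 hlt)
  refine Set.eq_univ_of_forall fun x => ?_
  obtain ⟨a, ha, hxa⟩ := not_bddAbove_iff.1 hab x
  obtain ⟨b, hb, hbx⟩ := not_bddBelow_iff.1 hbe x
  exact h.isSolution.ordConnected.out hb ha ⟨hbx.le, hxa.le⟩

/-! ### The smoothing estimates -/

/-- The smoothing estimate for an arbitrary exponent below the threshold. -/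
theorem exists_sobolevNorm_sub_propagator_le_of_lt {α s a s₀ : ℝ} (hα : 1 / 2 < α) (hα' : α ≤ 1)
    (hs₀ : 1 / 2 < s₀) (h : s₀ ≤ s) (ha : a < 2 * α - 1) :
    ∃ C, 0 ≤ C ∧ ∀ σ : ℝ, (σ = 1 ∨ σ = -1) → ∀ (u₀ : L2) (I : Set ℝ) (u : ℝ → L2),
      IsSolution σ α s u₀ I u → ∀ t ∈ I,
      sobolevNorm (s + a) (u t - propagator α t u₀) ≤
        C * (sobolevNorm s u₀ * sobolevNorm s₀ u₀ ^ 2 + sobolevNorm s (u t) *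
          sobolevNorm s₀ (u t) ^ 2 +
          |∫ τ in (0 : ℝ)..t, sobolevNorm s (u τ) *
            (sobolevNorm s₀ (u τ) ^ 2 + sobolevNorm s₀ (u τ) ^ 4)|) := by
  -- The argument needs a positive gain, while `a` may be zero or negative; a larger admissible gain
  -- implies the claim.
  have hb : 0 < max a ((2 * α - 1) / 2) := lt_max_of_lt_right (by linarith)
  have hb' : max a ((2 * α - 1) / 2) < 2 * α - 1 := max_lt ha (by linarith)
  obtain ⟨C, hC, H⟩ := exists_sobolevNorm_sub_propagator_le hα hα' hs₀ h hb hb'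
  refine ⟨C, hC, fun σ hσ u₀ I u hu t ht => ?_⟩
  have hm := (memH_and_lift_sub_propagator hα hα' (by linarith) hb hb' hu ht).1
  exact (sobolevNorm_mono hm (by gcongr; exact le_max_left _ _)).trans (H σ hσ u₀ I u hu t ht)

theorem continuousInH_sub_propagator_of_lt {σ α s a : ℝ} (hα : 1 / 2 < α) (hα' : α ≤ 1)
    (hs : 1 / 2 < s) (ha : a < 2 * α - 1) {u₀ : L2} {I : Set ℝ} {u : ℝ → L2}
    (h : IsSolution σ α s u₀ I u) :
    ContinuousInH (s + a) I (fun t => u t - propagator α t u₀) := by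
  have hb : 0 < max a ((2 * α - 1) / 2) := lt_max_of_lt_right (by linarith)
  have hb' : max a ((2 * α - 1) / 2) < 2 * α - 1 := max_lt ha (by linarith)
  exact (continuousInH_sub_propagator hα hα' hs hb hb' h).mono_exponent
    (by gcongr; exact le_max_left _ _)

theorem IsSolution.continuousOn_sobolevNorm {σ α s r : ℝ} (hr : r ≤ s) {u₀ : L2} {I : Set ℝ}
    {u : ℝ → L2} (h : IsSolution σ α s u₀ I u) : ContinuousOn (fun t => sobolevNorm r (u t)) I := by
  obtain ⟨hm, hc⟩ := continuousInH_iff.1 (h.continuous.mono_exponent hr)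
  exact hc.norm.congr fun t ht => (norm_lift (hm t ht)).symm

/-- The smoothing estimate in (or above) the energy space. -/
theorem exists_sobolevNorm_sub_propagator_le_energy {α s a : ℝ} (hα : 1 / 2 < α) (hα' : α ≤ 1)
    (hs : α ≤ s) (ha : a < 2 * α - 1) (R : ℝ) :
    ∃ C : ℝ, ∀ σ : ℝ, (σ = 1 ∨ σ = -1) → ∀ (u₀ : L2) (I : Set ℝ) (u : ℝ → L2),
      IsSolution σ α s u₀ I u → sobolevNorm α u₀ ≤ R → ∀ t ∈ I,
      sobolevNorm (s + a) (u t - propagator α t u₀) ≤ C * (sobolevNorm s u₀ + sobolevNorm s (u t) +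
          |∫ τ in (0 : ℝ)..t, sobolevNorm s (u τ)|) := by
  obtain ⟨C, hC, H⟩ := exists_sobolevNorm_sub_propagator_le_of_lt hα hα' hα hs ha
  obtain ⟨K, hK, HK⟩ := exists_sobolevNorm_energy_le hα hα' hs R
  -- The general bound is used with `s₀ = α`. This single constant dominates the low-norm factors of
  -- the data, of the solution at time `t`, and of the integrand.
  set D := R ^ 2 + K ^ 2 + K ^ 4 with hD
  refine ⟨C * D, fun σ hσ u₀ I u hu hR t ht => (H σ hσ u₀ I u hu t ht).trans ?_⟩
  have hb := HK σ hσ u₀ I u hu hR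
  have n0 := sobolevNorm_nonneg α u₀
  have nn := sobolevNorm_nonneg
  have hsub := hu.ordConnected.uIcc_subset hu.zero_mem ht
  have cs := (hu.continuousOn_sobolevNorm le_rfl).mono hsub
  have hInt : |∫ τ in (0 : ℝ)..t, sobolevNorm s (u τ) *
      (sobolevNorm α (u τ) ^ 2 + sobolevNorm α (u τ) ^ 4)| ≤
      D * |∫ τ in (0 : ℝ)..t, sobolevNorm s (u τ)| := by
    rw [← abs_of_nonneg (show 0 ≤ D by positivity), ← abs_mul,
      ← intervalIntegral.integral_const_mul, ← Real.norm_eq_abs]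
    refine intervalIntegral.norm_integral_le_abs_of_norm_le ?_
      (continuousOn_const.mul cs).intervalIntegrable
    filter_upwards [ae_restrict_mem measurableSet_uIoc] with τ hτ
    have h1 := hb τ (hsub (Set.uIoc_subset_uIcc hτ))
    have h2 := nn α (u τ)
    have h3 := nn s (u τ)
    rw [Real.norm_of_nonneg (by positivity), mul_comm]
    refine mul_le_mul_of_nonneg_right ?_ h3
    have h4 : sobolevNorm α (u τ) ^ 2 ≤ K ^ 2 := by gcongr
    have h5 : sobolevNorm α (u τ) ^ 4 ≤ K ^ 4 := by gcongr
    nlinarith [sq_nonneg R]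
  have h1 : sobolevNorm α u₀ ^ 2 ≤ D := by
    have : sobolevNorm α u₀ ^ 2 ≤ R ^ 2 := by gcongr
    rw [hD]; linarith [sq_nonneg K, pow_nonneg hK 4]
  have h2 : sobolevNorm α (u t) ^ 2 ≤ D := by
    have h2' := nn α (u t)
    have : sobolevNorm α (u t) ^ 2 ≤ K ^ 2 := by gcongr; exact hb t ht
    rw [hD]; linarith [sq_nonneg R, pow_nonneg hK 4]
  calc _ ≤ C * (sobolevNorm s u₀ * D + sobolevNorm s (u t) * D +
        D * |∫ τ in (0 : ℝ)..t, sobolevNorm s (u τ)|) := by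
        have := nn s u₀
        have := nn s (u t)
        gcongr
    _ = _ := by ring

end

end FractionalNLS

/-- The first two conjuncts hold on every interval on which a solution is given, in particular on
the maximal interval of existence. For negative times the time integrals are taken over `[t, 0]`
(whence the absolute values). The constants are uniform in both signs of the nonlinearity; in the
case `s ≥ α` the constant depends on the data only through an upper bound `R` of the `H^α` norm. -/
theorem theorem3 (α s a : ℝ) (hα : 1 / 2 < α) (hα' : α ≤ 1) (hs : 1 / 2 < s)
    (ha : a < 2 * α - 1) :
    (∀ (σ : ℝ), (σ = 1 ∨ σ = -1) → ∀ (u₀ : FractionalNLS.L2) (I : Set ℝ)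
      (u : ℝ → FractionalNLS.L2), FractionalNLS.IsSolution σ α s u₀ I u →
        FractionalNLS.ContinuousInH (s + a) I
          (fun t => u t - FractionalNLS.propagator α t u₀)) ∧
    (∀ s₀ : ℝ, 1 / 2 < s₀ → s₀ ≤ s → ∃ C : ℝ, ∀ (σ : ℝ), (σ = 1 ∨ σ = -1) →
      ∀ (u₀ : FractionalNLS.L2) (I : Set ℝ) (u : ℝ → FractionalNLS.L2),
        FractionalNLS.IsSolution σ α s u₀ I u → ∀ t ∈ I,
          FractionalNLS.sobolevNorm (s + a) (u t - FractionalNLS.propagator α t u₀) ≤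
            C * (FractionalNLS.sobolevNorm s u₀ * (1 + FractionalNLS.sobolevNorm s₀ u₀ ^ 2) +
              FractionalNLS.sobolevNorm s (u t) * FractionalNLS.sobolevNorm s₀ (u t) ^ 2 +
              |∫ t' in (0 : ℝ)..t, FractionalNLS.sobolevNorm s (u t') *
                (FractionalNLS.sobolevNorm s₀ (u t') ^ 2 +
                  FractionalNLS.sobolevNorm s₀ (u t') ^ 4)|)) ∧
    (α ≤ s →
      (∀ R : ℝ, ∃ C : ℝ, ∀ (σ : ℝ), (σ = 1 ∨ σ = -1) →
        ∀ (u₀ : FractionalNLS.L2) (I : Set ℝ) (u : ℝ → FractionalNLS.L2),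
          FractionalNLS.IsSolution σ α s u₀ I u → FractionalNLS.sobolevNorm α u₀ ≤ R →
          ∀ t ∈ I,
            FractionalNLS.sobolevNorm (s + a) (u t - FractionalNLS.propagator α t u₀) ≤
              C * (FractionalNLS.sobolevNorm s u₀ + FractionalNLS.sobolevNorm s (u t) +
                |∫ t' in (0 : ℝ)..t, FractionalNLS.sobolevNorm s (u t')|)) ∧
      (∀ (σ : ℝ), (σ = 1 ∨ σ = -1) → ∀ (u₀ : FractionalNLS.L2) (I : Set ℝ)
        (u : ℝ → FractionalNLS.L2), FractionalNLS.IsMaximalSolution σ α s u₀ I u →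
          I = Set.univ)) := by
  refine ⟨fun σ _ u₀ I u hu => FractionalNLS.continuousInH_sub_propagator_of_lt hα hα' hs ha hu,
    fun s₀ hs₀ h => ?_, fun h => ⟨FractionalNLS.exists_sobolevNorm_sub_propagator_le_energy
      hα hα' h ha, fun σ hσ u₀ I u hu => hu.eq_univ hσ hα hα' h⟩⟩
  obtain ⟨C, hC, H⟩ := FractionalNLS.exists_sobolevNorm_sub_propagator_le_of_lt hα hα' hs₀ h ha
  refine ⟨C, fun σ hσ u₀ I u hu t ht => (H σ hσ u₀ I u hu t ht).trans ?_⟩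
  have h1 := FractionalNLS.sobolevNorm_nonneg s u₀
  -- The summand `1` next to the squared norm of the data is pure slack.
  gcongr
  linarith
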